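/- Conventions. Let $G$ be a locally compact (Hausdorff) group with a left Haar measure $dg$. A $G$-C*-algebra is a C*-algebra with a strongly continuous action $\beta$ of $G$ by $*$-automorphisms. A $G$-equivariant Hilbert module over a $G$-C*-algebra $B$ is a right Hilbert $B$-module $E$ (inner product linear in the second variable) with a strongly continuous linear action $\gamma$ of $G$ such that $\gamma_g(\xi b)=\gamma_g(\xi)\beta_g(b)$ and $\langle\gamma_g\xi,\gamma_g\eta\rangle=\beta_g\langle\xi,\eta\rangle$. $L^2(G,B)$ is the Hilbert $B$-module completion of $C_c(G,B)$ for $\langle f,k\rangle=\int_G f(g)^*k(g)\,dg$. For $K\in C_c(G,B)$, $b\in B$, $h\in G$ let $\rho_K,\rho_b,\rho_h$ be the operators on $L^2(G,B)$ with $$(\rho_Kf)(g)=\int_G\beta_g(K(g^{-1}h))f(h)\,dh,\qquad (\rho_bf)(g)=\beta_g(b)f(g),\qquad (\rho_hf)(g)=f(gh).$$ The reduced crossed product $C^*_r(G,B)$ is the norm closure of $\{\rho_K : K\in C_c(G,B)\}$ in the C*-algebra $\mathrm{Adj}(L^2(G,B))$ of adjointable operators. Let $C^*_r(G,E):=E\otimes_B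 C^*_r(G,B)$, where $B$ acts on $C^*_r(G,B)$ by $b\cdot x=\rho_b x$. An element $\xi\in E$ is square-integrable if for all $\eta\in E$ the functions $g\mapsto\chi(g)\langle\gamma_g(\xi),\eta\rangle$ converge in $L^2(G,B)$ as $\chi\in C_c(G,[0,1])$ converges to $1$ uniformly on compact subsets. Then $f\mapsto\int_G\gamma_g(\xi)f(g)\,dg$, $f\in C_c(G,B)$, extends to an adjointable operator $|\xi\rangle\rangle\colon L^2(G,B)\to E$; put $\langle\langle\xi|\eta\rangle\rangle:=|\xi\rangle\rangle^*|\eta\rangle\rangle$. A subset $R\subseteq E$ is relatively continuous if all its elements are square-integrable and $\langle\langle\xi|\eta\rangle\rangle\in C^*_r(G,B)$ for all $\xi,\eta\in R$. In this case $F(E,R)$ is the closed linear span of $\{|\xi\rangle\rangle x : \xi\in R,\ x\in C^*_r(G,B)\}\cup\{|\xi\rangle\rangle:\xi\in R\}$ in the bounded operators $L^2(G,B)\to E$; it is a Hilbert $C^*_r(G,B)$-module with $\langle T,T'\rangle=T^*T'$ and $T\cdot x=T\circ x$. Theorem. Let $A$ and $B$ be $G$-C*-algebras, let $E_1$ and $E_2$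 be $G$-equivariant Hilbert modules over $A$ and $B$, and let $\varphi\colon A\to\mathrm{Adj}(E_2)$ be an equivariant $*$-homomorphism that is essential, that is, $\varphi(A)E_2$ spans a dense subspace of $E_2$. Let $R_1\subseteq E_1$ be a relatively continuous linear subspace and let $R_{12}$ be the image of the algebraic tensor product $R_1\otimes E_2$ in $E_{12}:=E_1\otimes_A E_2$ (with the diagonal action of $G$). Then $R_{12}$ is relatively continuous, and if $R_1$ is dense in $E_1$, then $R_{12}$ is dense in $E_{12}$. Moreover, the $*$-homomorphism $\Phi\colon C^*_r(G,A)\to\mathrm{Adj}(C^*_r(G,E_2))$ induced by $\varphi$, which is determined by $$\Phi(\rho_K)(\eta\otimes x)=\int_G\varphi(K(h))\gamma_h(\eta)\otimes\rho_h x\,dh\qquad(K\in C_c(G,A),\ \eta\in E_2,\ x\in C^*_r(G,B)),$$ exists, and there is an isomorphism of Hilbert $C^*_r(G,B)$-modules $$F(E_{12},R_{12})\cong F(E_1,R_1)\otimes_{C^*_r(G,A)}C^*_r(G,E_2),$$ where the tensor product is formed along $\Phi$. -/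

import Mathlib

open MeasureTheory Filter Topology
open scoped CompactlySupported TensorProduct

set_option linter.unusedSectionVars false

noncomputable section

/-- A complex vector space `V` with a right action of the C*-algebra `B` and a positive semidefinite
`B`-valued inner product, conjugate linear in the first and linear in the second variable.
Positivity of `b` in the C*-algebra `B` is expressed as `b = star a * a`. -/
class SemiInnerModule (B V : Type*) [NonUnitalCStarAlgebra B] [AddCommGroup V] [Module ℂ V] where
  /-- The `B`-valued inner product. -/
  inner : V → V → B
  /-- The right action `x · b`. -/
  rsmul : V → B → V
  add_rsmul : ∀ x y b, rsmul (x + y) b = rsmul x b + rsmul y b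
  smul_rsmul : ∀ (c : ℂ) x b, rsmul (c • x) b = c • rsmul x b
  rsmul_add : ∀ x b b', rsmul x (b + b') = rsmul x b + rsmul x b'
  rsmul_smul : ∀ (c : ℂ) x b, rsmul x (c • b) = c • rsmul x b
  rsmul_mul : ∀ x b b', rsmul x (b * b') = rsmul (rsmul x b) b'
  inner_add_right : ∀ x y z, inner x (y + z) = inner x y + inner x z
  inner_smul_right : ∀ (c : ℂ) x y, inner x (c • y) = c • inner x y
  inner_rsmul_right : ∀ x y b, inner x (rsmul y b) = inner x y * b
  star_inner : ∀ x y, star (inner x y) = inner y x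
  inner_self_nonneg : ∀ x, ∃ a, inner x x = star a * a

/-- Modules with a `B`-valued inner product whose (semi)norm is `‖x‖ = ‖⟨x, x⟩‖^(1/2)`.
A (right) Hilbert `B`-module is such a module `E` that is a complete normed space:
`[NormedAddCommGroup E] [NormedSpace ℂ E] [CompleteSpace E] [InnerModule B E]`. -/
class InnerModule (B E : Type*) [NonUnitalCStarAlgebra B] [SeminormedAddCommGroup E]
    [NormedSpace ℂ E] extends SemiInnerModule B E where
  norm_sq_eq : ∀ x : E, ‖x‖ ^ 2 = ‖inner x x‖

/-- The `B`-valued inner product of `x` and `y`. -/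
abbrev ip (B : Type*) {V : Type*} [NonUnitalCStarAlgebra B] [AddCommGroup V] [Module ℂ V]
    [SemiInnerModule B V] (x y : V) : B := SemiInnerModule.inner x y

/-- The right action `x · b`. -/
abbrev rs {B V : Type*} [NonUnitalCStarAlgebra B] [AddCommGroup V] [Module ℂ V]
    [SemiInnerModule B V] (x : V) (b : B) : V := SemiInnerModule.rsmul x b

section SemiInner

variable {B V : Type*} [NonUnitalCStarAlgebra B] [AddCommGroup V] [Module ℂ V] [SemiInnerModule B V]

theorem ip_add_right (x y z : V) : ip B x (y + z) = ip B x y + ip B x z :=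
  SemiInnerModule.inner_add_right x y z

theorem ip_smul_right (c : ℂ) (x y : V) : ip B x (c • y) = c • ip B x y :=
  SemiInnerModule.inner_smul_right c x y

theorem ip_star (x y : V) : star (ip B x y) = ip B y x := SemiInnerModule.star_inner x y

theorem ip_rs_right (x y : V) (b : B) : ip B x (rs y b) = ip B x y * b :=
  SemiInnerModule.inner_rsmul_right x y b

theorem add_rs (x y : V) (b : B) : rs (x + y) b = rs x b + rs y b :=
  SemiInnerModule.add_rsmul x y b

theorem smul_rs (c : ℂ) (x : V) (b : B) : rs (c • x) b = c • rs x b :=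
  SemiInnerModule.smul_rsmul c x b

theorem rs_add (x : V) (b b' : B) : rs x (b + b') = rs x b + rs x b' :=
  SemiInnerModule.rsmul_add x b b'

theorem rs_smul (c : ℂ) (x : V) (b : B) : rs x (c • b) = c • rs x b :=
  SemiInnerModule.rsmul_smul c x b

theorem rs_mul (x : V) (b b' : B) : rs x (b * b') = rs (rs x b) b' :=
  SemiInnerModule.rsmul_mul x b b'

theorem ip_self_nonneg (x : V) : ∃ a, ip B x x = star a * a :=
  SemiInnerModule.inner_self_nonneg x

theorem ip_add_left (x y z : V) : ip B (x + y) z = ip B x z + ip B y z := by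
  rw [← ip_star, ip_add_right, star_add, ip_star, ip_star]

theorem ip_smul_left (c : ℂ) (x y : V) : ip B (c • x) y = star c • ip B x y := by
  rw [← ip_star, ip_smul_right, star_smul, ip_star]

theorem ip_rs_left (x y : V) (b : B) : ip B (rs x b) y = star b * ip B x y := by
  rw [← ip_star, ip_rs_right, star_mul, ip_star]

variable (B V) in
/-- The inner product as a sesquilinear map. -/
def ipₗ : V →ₗ⋆[ℂ] V →ₗ[ℂ] B :=
  LinearMap.mk₂'ₛₗ (starRingEnd ℂ) (RingHom.id ℂ) (fun x y => ip B x y)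
    ip_add_left ip_smul_left ip_add_right ip_smul_right

theorem ipₗ_apply (x y : V) : ipₗ B V x y = ip B x y := rfl

theorem ip_sub_right (x y z : V) : ip B x (y - z) = ip B x y - ip B x z := by
  simp only [← ipₗ_apply, map_sub]

theorem ip_sub_left (x y z : V) : ip B (x - y) z = ip B x z - ip B y z := by
  simp only [← ipₗ_apply, map_sub, LinearMap.sub_apply]

theorem ip_zero_right (x : V) : ip B x 0 = 0 := by simp only [← ipₗ_apply, map_zero]

theorem ip_zero_left (x : V) : ip B (0 : V) x = 0 := by
  simp only [← ipₗ_apply, map_zero, LinearMap.zero_apply]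

theorem ip_sum_right {ι : Type*} (s : Finset ι) (x : V) (y : ι → V) :
    ip B x (∑ i ∈ s, y i) = ∑ i ∈ s, ip B x (y i) := by
  simp only [← ipₗ_apply, map_sum]

theorem ip_sum_left {ι : Type*} (s : Finset ι) (x : V) (y : ι → V) :
    ip B (∑ i ∈ s, y i) x = ∑ i ∈ s, ip B (y i) x := by
  simp only [← ipₗ_apply, map_sum, LinearMap.sum_apply]

theorem norm_ip_sq_le (x y : V) : ‖ip B x y‖ ^ 2 ≤ ‖ip B x x‖ * ‖ip B y y‖ := by
  let _ := CStarAlgebra.spectralOrder B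
  have _ := CStarAlgebra.spectralOrderedRing B
  have key : ∀ t : ℝ, ‖ip B x x‖ < t → ‖ip B x y‖ ^ 2 ≤ t * ‖ip B y y‖ := by
    intro t ht
    have ht0 : 0 < t := (norm_nonneg _).trans_lt ht
    set a := ip B x y with ha
    have h1 : 0 ≤ ip B (rs x a - (t : ℂ) • y) (rs x a - (t : ℂ) • y) := by
      obtain ⟨c, hc⟩ := SemiInnerModule.inner_self_nonneg (B := B) (rs x a - (t : ℂ) • y)
      exact (CStarAlgebra.nonneg_iff_eq_star_mul_self).2 ⟨c, hc⟩
    have h2 : ip B (rs x a - (t : ℂ) • y) (rs x a - (t : ℂ) • y)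
        = star a * ip B x x * a - (2 * t) • (star a * a) + (t ^ 2) • ip B y y := by
      have hyx : ip B y x = star a := (ip_star x y).symm
      simp only [ip_sub_left, ip_sub_right, ip_rs_left, ip_rs_right, ip_smul_left, ip_smul_right,
        hyx, ← ha, ← Complex.coe_smul (E := B)]
      simp only [Complex.star_def, Complex.conj_ofReal, two_mul, add_smul, smul_sub,
        Complex.ofReal_add, pow_two, Complex.ofReal_mul, mul_smul, smul_mul_assoc, sub_mul]
      abel
    rw [h2] at h1
    have h3 : star a * ip B x x * a ≤ ‖ip B x x‖ • (star a * a) :=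
      CStarAlgebra.star_left_conjugate_le_norm_smul (hb := ip_star x x)
    have h0 : (0 : B) ≤ star a * a := star_mul_self_nonneg a
    have h4 : t • (star a * a) ≤ t • (t • ip B y y) := by
      have h5 : ‖ip B x x‖ • (star a * a) ≤ t • (star a * a) :=
        smul_le_smul_of_nonneg_right ht.le h0
      have h6 := h1.trans (add_le_add_left (sub_le_sub_right (h3.trans h5) _) _)
      have h7 : t • (star a * a) - (2 * t) • (star a * a) + t ^ 2 • ip B y y
          = t • (t • ip B y y) - t • (star a * a) := by
        rw [two_mul, add_smul, pow_two, mul_smul]; abel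
      rw [h7] at h6
      exact sub_nonneg.1 h6
    have h5 : star a * a ≤ t • ip B y y := (smul_le_smul_iff_of_pos_left ht0).1 h4
    have h6 := CStarAlgebra.norm_le_norm_of_nonneg_of_le h0 h5
    rw [CStarRing.norm_star_mul_self, norm_smul, Real.norm_of_nonneg ht0.le] at h6
    rwa [pow_two]
  refine le_of_forall_pos_le_add fun ε hε => ?_
  have := key (‖ip B x x‖ + ε / (‖ip B y y‖ + 1)) (lt_add_of_pos_right _ (by positivity))
  refine this.trans ?_
  rw [add_mul]
  gcongr
  rw [div_mul_eq_mul_div, div_le_iff₀ (by positivity)]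
  nlinarith [norm_nonneg (ip B y y)]

theorem norm_ip_le_sqrt (x y : V) : ‖ip B x y‖ ≤ √‖ip B x x‖ * √‖ip B y y‖ := by
  rw [← Real.sqrt_mul (norm_nonneg _)]
  exact Real.le_sqrt_of_sq_le (norm_ip_sq_le x y)

variable (B V) in
/-- The seminorm `‖x‖ = ‖⟨x, x⟩‖^(1/2)`. -/
abbrev SemiInnerModule.toNorm : Norm V := ⟨fun x => √‖ip B x x‖⟩

variable (B V) in
theorem SemiInnerModule.core :
    letI := SemiInnerModule.toNorm B V
    SeminormedSpace.Core ℂ V :=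
  letI := SemiInnerModule.toNorm B V
  { norm_nonneg := fun _ => Real.sqrt_nonneg _
    norm_smul := fun c x => by
      change √‖ip B (c • x) (c • x)‖ = ‖c‖ * √‖ip B x x‖
      rw [ip_smul_left, ip_smul_right, norm_smul, norm_smul, norm_star, ← mul_assoc,
        Real.sqrt_mul (by positivity), Real.sqrt_mul_self (norm_nonneg c)]
    norm_triangle := fun x y => by
      change √‖ip B (x + y) (x + y)‖ ≤ √‖ip B x x‖ + √‖ip B y y‖
      refine Real.sqrt_le_iff.2 ⟨by positivity, ?_⟩
      have e : ip B (x + y) (x + y) = ip B x x + ip B x y + ip B y x + ip B y y := by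
        rw [ip_add_left, ip_add_right, ip_add_right]; abel
      have h1 := norm_ip_le_sqrt (B := B) x y
      have h2 := norm_ip_le_sqrt (B := B) y x
      have h3 := Real.mul_self_sqrt (norm_nonneg (ip B x x))
      have h4 := Real.mul_self_sqrt (norm_nonneg (ip B y y))
      rw [e]
      have h5 := norm_add_le (ip B x x + ip B x y + ip B y x) (ip B y y)
      have h6 := norm_add_le (ip B x x + ip B x y) (ip B y x)
      have h7 := norm_add_le (ip B x x) (ip B x y)
      nlinarith }

variable (B V) in
/-- The seminormed group structure on a semi-inner product module. -/
abbrev SemiInnerModule.toSeminormedAddCommGroup : SeminormedAddCommGroup V :=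
  letI := SemiInnerModule.toNorm B V
  SeminormedAddCommGroup.ofCore (SemiInnerModule.core B V)

variable (B V) in
/-- The seminormed space structure on a semi-inner product module. -/
abbrev SemiInnerModule.toNormedSpace :
    letI := SemiInnerModule.toSeminormedAddCommGroup B V
    NormedSpace ℂ V :=
  letI := SemiInnerModule.toNorm B V
  letI := SemiInnerModule.toSeminormedAddCommGroup B V
  { norm_smul_le := fun c x => ((SemiInnerModule.core B V).norm_smul c x).le }

variable (B V) in
/-- A semi-inner product module with its seminorm. -/
abbrev SemiInnerModule.toInnerModule :
    letI := SemiInnerModule.toSeminormedAddCommGroup B V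
    letI := SemiInnerModule.toNormedSpace B V
    InnerModule B V :=
  letI := SemiInnerModule.toSeminormedAddCommGroup B V
  letI := SemiInnerModule.toNormedSpace B V
  { (inferInstance : SemiInnerModule B V) with
    norm_sq_eq := fun _ => Real.sq_sqrt (norm_nonneg _) }

end SemiInner

section InnerMod

variable {B E : Type*} [NonUnitalCStarAlgebra B] [SeminormedAddCommGroup E] [NormedSpace ℂ E]
  [InnerModule B E]

variable (B) in
theorem norm_sq_ip (x : E) : ‖x‖ ^ 2 = ‖ip B x x‖ := InnerModule.norm_sq_eq x

theorem InnerModule.norm_eq_sqrt (x : E) : ‖x‖ = √‖ip B x x‖ := by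
  rw [← InnerModule.norm_sq_eq (B := B) x, Real.sqrt_sq (norm_nonneg _)]

theorem norm_ip_le (x y : E) : ‖ip B x y‖ ≤ ‖x‖ * ‖y‖ := by
  rw [InnerModule.norm_eq_sqrt (B := B) x, InnerModule.norm_eq_sqrt (B := B) y]
  exact norm_ip_le_sqrt x y

theorem norm_rs_le (x : E) (b : B) : ‖rs x b‖ ≤ ‖x‖ * ‖b‖ := by
  refine abs_le_of_sq_le_sq' ?_ (by positivity) |>.2
  rw [norm_sq_ip B (rs x b), mul_pow, norm_sq_ip B x, ip_rs_right, ip_rs_left]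
  calc _ ≤ ‖star b‖ * ‖ip B x x‖ * ‖b‖ := norm_mul₃_le
    _ = _ := by rw [norm_star]; ring

variable (B E) in
/-- The inner product as a continuous sesquilinear map. -/
def ipSL : E →L⋆[ℂ] E →L[ℂ] B :=
  LinearMap.mkContinuous₂ (ipₗ B E) 1 fun x y => by
    rw [one_mul]; exact norm_ip_le x y

variable (B E) in
theorem continuous_ip_uncurry : Continuous fun p : E × E => ip B p.1 p.2 := by
  have : Continuous fun p : E × E => ipSL B E p.1 p.2 := by fun_prop
  exact this

@[fun_prop]
theorem Continuous.ip {α : Type*} [TopologicalSpace α] {f g : α → E} (hf : Continuous f)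
    (hg : Continuous g) : Continuous fun a => ip B (f a) (g a) :=
  (continuous_ip_uncurry B E).comp (hf.prodMk hg)

/-- Right multiplication by `b` as a continuous linear map. -/
def rsL (b : B) : E →L[ℂ] E :=
  LinearMap.mkContinuous
    { toFun := fun x => rs x b
      map_add' := fun x y => SemiInnerModule.add_rsmul x y b
      map_smul' := fun c x => SemiInnerModule.smul_rsmul c x b } ‖b‖
    fun x => (norm_rs_le x b).trans_eq (mul_comm _ _)

theorem rsL_apply (b : B) (x : E) : rsL b x = rs x b := rfl

variable (E) in
theorem continuous_rs (b : B) : Continuous fun x : E => rs x b := (rsL (E := E) b).continuous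

theorem continuous_rs_uncurry : Continuous fun p : E × B => rs p.1 p.2 := by
  let m : E →ₗ[ℂ] B →ₗ[ℂ] E := LinearMap.mk₂ ℂ (fun x b => rs x b)
    SemiInnerModule.add_rsmul SemiInnerModule.smul_rsmul SemiInnerModule.rsmul_add
    SemiInnerModule.rsmul_smul
  let M : E →L[ℂ] B →L[ℂ] E := LinearMap.mkContinuous₂ m 1 fun x b => by
    rw [one_mul]; exact norm_rs_le x b
  have : Continuous fun p : E × B => M p.1 p.2 := by fun_prop
  exact this

@[fun_prop]
theorem Continuous.rs {α : Type*} [TopologicalSpace α] {f : α → E} {g : α → B} (hf : Continuous f)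
    (hg : Continuous g) : Continuous fun a => rs (f a) (g a) :=
  continuous_rs_uncurry.comp (hf.prodMk hg)

theorem isClosed_star_mul_self : IsClosed {b : B | ∃ a : B, b = star a * a} := by
  let _ := CStarAlgebra.spectralOrder B
  have _ := CStarAlgebra.spectralOrderedRing B
  have : {b : B | ∃ a : B, b = star a * a} = {b | 0 ≤ b} :=
    Set.ext fun b => CStarAlgebra.nonneg_iff_eq_star_mul_self.symm
  rw [this]
  exact CStarAlgebra.isClosed_nonneg

end InnerMod

section Normed

variable {B E : Type*} [NonUnitalCStarAlgebra B] [NormedAddCommGroup E] [NormedSpace ℂ E]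
  [InnerModule B E]

variable (B) in
theorem eq_of_forall_ip {x y : E} (h : ∀ z, ip B z x = ip B z y) : x = y := by
  have : ‖x - y‖ ^ 2 = 0 := by
    rw [norm_sq_ip B, ip_sub_right (x - y), h, sub_self, norm_zero]
  exact sub_eq_zero.1 (norm_eq_zero.1 (pow_eq_zero_iff (two_ne_zero) |>.1 this))

end Normed

/-! ### Completion -/

section Completion

open UniformSpace

variable {B V : Type*} [NonUnitalCStarAlgebra B] [SeminormedAddCommGroup V] [NormedSpace ℂ V]
  [InnerModule B V]

variable (B V) in
/-- The inner product extended to the completion. -/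
def Completion.ipExt : Completion V → Completion V → B :=
  Function.curry <|
    (Completion.isDenseInducing_coe.prodMap Completion.isDenseInducing_coe).extend
      (Function.uncurry fun x y : V => ip B x y)

theorem Completion.ipExt_coe (x y : V) :
    Completion.ipExt B V (x : Completion V) (y : Completion V) = ip B x y :=
  (Completion.isDenseInducing_coe.prodMap Completion.isDenseInducing_coe).extend_eq
    (continuous_ip_uncurry B V) (x, y)

theorem Completion.continuous_ipExt_uncurry :
    Continuous (Function.uncurry (Completion.ipExt B V)) := by
  let inner' : V →+ V →+ B :=
    { toFun := fun x => (ipₗ B V x).toAddMonoidHom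
      map_zero' := by ext x; exact ip_zero_left _
      map_add' := fun x y => by ext z; exact ip_add_left _ _ _ }
  have : Continuous fun p : V × V => inner' p.1 p.2 := continuous_ip_uncurry B V
  rw [Completion.ipExt, Function.uncurry_curry _]
  change
    Continuous
      (((Completion.isDenseInducing_toCompl V).prodMap
        (Completion.isDenseInducing_toCompl V)).extend fun p : V × V => inner' p.1 p.2)
  exact (Completion.isDenseInducing_toCompl V).extend_Z_bilin
    (Completion.isDenseInducing_toCompl V) this

@[fun_prop]
theorem Completion.continuous_ipExt {α : Type*} [TopologicalSpace α] {f g : α → Completion V}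
    (hf : Continuous f) (hg : Continuous g) :
    Continuous fun a => Completion.ipExt B V (f a) (g a) :=
  Completion.continuous_ipExt_uncurry.comp (hf.prodMk hg :)

/-- The right action extended to the completion. -/
def Completion.rsExt (x : Completion V) (b : B) : Completion V :=
  Completion.map (fun y : V => rs y b) x

theorem Completion.rsExt_coe (x : V) (b : B) :
    Completion.rsExt (x : Completion V) b = ((rs x b : V) : Completion V) :=
  Completion.map_coe (rsL (E := V) b).uniformContinuous x

theorem Completion.continuous_rsExt' (b : B) :
    Continuous fun x : Completion V => Completion.rsExt x b := Completion.continuous_map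

@[fun_prop]
theorem Completion.continuous_rsExt {α : Type*} [TopologicalSpace α] {f : α → Completion V} (b : B)
    (hf : Continuous f) : Continuous fun a => Completion.rsExt (f a) b :=
  (Completion.continuous_rsExt' b).comp hf

/-- The completion of a semi-inner product module is a Hilbert module. -/
instance Completion.innerModule : InnerModule B (Completion V) where
  inner := Completion.ipExt B V
  rsmul := Completion.rsExt
  add_rsmul x y b := by
    induction x, y using Completion.induction_on₂ with
    | hp =>
      exact isClosed_eq (by fun_prop) (by fun_prop)
    | ih x y =>
      rw [← Completion.coe_add, rsExt_coe, rsExt_coe, rsExt_coe, ← Completion.coe_add,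
        add_rs x y]
  smul_rsmul c x b := by
    induction x using Completion.induction_on with
    | hp =>
      exact isClosed_eq ((continuous_rsExt' b).comp (continuous_const_smul c))
        ((continuous_rsExt' b).const_smul c)
    | ih x =>
      rw [← Completion.coe_smul, rsExt_coe, rsExt_coe, ← Completion.coe_smul,
        smul_rs c x]
  rsmul_add x b b' := by
    induction x using Completion.induction_on with
    | hp =>
      exact isClosed_eq (by fun_prop) (by fun_prop)
    | ih x =>
      rw [rsExt_coe, rsExt_coe, rsExt_coe, ← Completion.coe_add,
        rs_add x]
  rsmul_smul c x b := by
    induction x using Completion.induction_on with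
    | hp =>
      exact isClosed_eq (continuous_rsExt' _) ((continuous_rsExt' b).const_smul c)
    | ih x => rw [rsExt_coe, rsExt_coe, ← Completion.coe_smul, rs_smul c x]
  rsmul_mul x b b' := by
    induction x using Completion.induction_on with
    | hp =>
      exact isClosed_eq (by fun_prop) (by fun_prop)
    | ih x => rw [rsExt_coe, rsExt_coe, rsExt_coe, rs_mul x]
  inner_add_right x y z := by
    induction x, y, z using Completion.induction_on₃ with
    | hp =>
      exact isClosed_eq (by fun_prop) (by fun_prop)
    | ih x y z =>
      rw [← Completion.coe_add, ipExt_coe, ipExt_coe, ipExt_coe, ip_add_right]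
  inner_smul_right c x y := by
    induction x, y using Completion.induction_on₂ with
    | hp =>
      exact isClosed_eq (Completion.continuous_ipExt continuous_fst
        (continuous_snd.const_smul c)) ((Completion.continuous_ipExt continuous_fst
        continuous_snd).const_smul c)
    | ih x y => rw [← Completion.coe_smul, ipExt_coe, ipExt_coe, ip_smul_right]
  inner_rsmul_right x y b := by
    induction x, y using Completion.induction_on₂ with
    | hp =>
      exact isClosed_eq (by fun_prop) (by fun_prop)
    | ih x y => rw [rsExt_coe, ipExt_coe, ipExt_coe, ip_rs_right]
  star_inner x y := by
    induction x, y using Completion.induction_on₂ with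
    | hp =>
      exact isClosed_eq (by fun_prop) (by fun_prop)
    | ih x y => rw [ipExt_coe, ipExt_coe, ip_star]
  inner_self_nonneg x := by
    induction x using Completion.induction_on with
    | hp =>
      exact isClosed_star_mul_self.preimage (Completion.continuous_ipExt continuous_id
        continuous_id)
    | ih x => rw [ipExt_coe]; exact SemiInnerModule.inner_self_nonneg x
  norm_sq_eq x := by
    induction x using Completion.induction_on with
    | hp =>
      exact isClosed_eq (continuous_norm.pow 2)
        (Completion.continuous_ipExt continuous_id continuous_id).norm
    | ih x => rw [ipExt_coe, Completion.norm_coe]; exact InnerModule.norm_sq_eq x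

theorem ip_coe (x y : V) : ip B (x : Completion V) (y : Completion V) = ip B x y :=
  Completion.ipExt_coe x y

theorem rs_coe (x : V) (b : B) : rs (x : Completion V) b = ((rs x b : V) : Completion V) :=
  Completion.rsExt_coe x b

end Completion

/-! ### Adjointable operators -/

section Adjointable

variable {B E F D : Type*} [NonUnitalCStarAlgebra B]
  [NormedAddCommGroup E] [NormedSpace ℂ E] [InnerModule B E]
  [NormedAddCommGroup F] [NormedSpace ℂ F] [InnerModule B F]
  [NormedAddCommGroup D] [NormedSpace ℂ D] [InnerModule B D]

variable (B) in
/-- `S` is the adjoint of `T` with respect to the `B`-valued inner products. -/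
def IsAdjointPair (T : E →L[ℂ] F) (S : F →L[ℂ] E) : Prop :=
  ∀ x y, ip B (T x) y = ip B x (S y)

variable (B) in
/-- `T` is an adjointable operator between Hilbert `B`-modules. -/
def IsAdjointable (T : E →L[ℂ] F) : Prop := ∃ S : F →L[ℂ] E, IsAdjointPair B T S

variable (B) in
open Classical in
/-- The adjoint of an adjointable operator (and `0` for other operators). -/
def adj (T : E →L[ℂ] F) : F →L[ℂ] E := if h : IsAdjointable B T then h.choose else 0

theorem IsAdjointable.isAdjointPair {T : E →L[ℂ] F} (h : IsAdjointable B T) :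
    IsAdjointPair B T (adj B T) := by
  rw [adj, dif_pos h]; exact h.choose_spec

theorem IsAdjointPair.isAdjointable {T : E →L[ℂ] F} {S : F →L[ℂ] E} (h : IsAdjointPair B T S) :
    IsAdjointable B T := ⟨S, h⟩

theorem IsAdjointPair.symm {T : E →L[ℂ] F} {S : F →L[ℂ] E} (h : IsAdjointPair B T S) :
    IsAdjointPair B S T := fun x y => by rw [← ip_star, ← h, ip_star]

theorem IsAdjointPair.unique {T : E →L[ℂ] F} {S S' : F →L[ℂ] E} (h : IsAdjointPair B T S)
    (h' : IsAdjointPair B T S') : S = S' :=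
  ContinuousLinearMap.ext fun y => eq_of_forall_ip B fun x => by rw [← h, h']

theorem IsAdjointPair.adj_eq {T : E →L[ℂ] F} {S : F →L[ℂ] E} (h : IsAdjointPair B T S) :
    adj B T = S := h.isAdjointable.isAdjointPair.unique h

theorem IsAdjointPair.comp {T : E →L[ℂ] F} {S : F →L[ℂ] E} {T' : F →L[ℂ] D} {S' : D →L[ℂ] F}
    (h : IsAdjointPair B T S) (h' : IsAdjointPair B T' S') :
    IsAdjointPair B (T'.comp T) (S.comp S') := fun x y => by
  rw [ContinuousLinearMap.comp_apply, h', h, ContinuousLinearMap.comp_apply]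

theorem IsAdjointPair.add {T T' : E →L[ℂ] F} {S S' : F →L[ℂ] E} (h : IsAdjointPair B T S)
    (h' : IsAdjointPair B T' S') : IsAdjointPair B (T + T') (S + S') := fun x y => by
  rw [_root_.add_apply, ip_add_left, h, h', _root_.add_apply,
    ip_add_right]

theorem IsAdjointPair.smul {T : E →L[ℂ] F} {S : F →L[ℂ] E} (h : IsAdjointPair B T S) (c : ℂ) :
    IsAdjointPair B (c • T) (star c • S) := fun x y => by
  rw [_root_.smul_apply, ip_smul_left, h, _root_.smul_apply,
    ip_smul_right]

theorem isAdjointPair_zero : IsAdjointPair B (0 : E →L[ℂ] F) 0 := fun x y => by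
  rw [_root_.zero_apply, ip_zero_left, _root_.zero_apply, ip_zero_right]

theorem isAdjointPair_id : IsAdjointPair B (ContinuousLinearMap.id ℂ E) (.id ℂ E) :=
  fun _ _ => rfl

theorem IsAdjointPair.norm_le {T : E →L[ℂ] F} {S : F →L[ℂ] E} (h : IsAdjointPair B T S) :
    ‖S‖ ≤ ‖T‖ := by
  refine S.opNorm_le_bound (norm_nonneg _) fun y => ?_
  have h1 : ‖S y‖ * ‖S y‖ ≤ ‖T‖ * ‖y‖ * ‖S y‖ := by
    rw [← pow_two, norm_sq_ip B, ← h]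
    calc _ ≤ ‖T (S y)‖ * ‖y‖ := norm_ip_le _ _
      _ ≤ (‖T‖ * ‖S y‖) * ‖y‖ := by gcongr; exact T.le_opNorm _
      _ = _ := by ring
  rcases (norm_nonneg (S y)).eq_or_lt with h0 | h0
  · rw [← h0]; positivity
  · exact le_of_mul_le_mul_right h1 h0

theorem IsAdjointPair.norm_eq {T : E →L[ℂ] F} {S : F →L[ℂ] E} (h : IsAdjointPair B T S) :
    ‖S‖ = ‖T‖ := le_antisymm h.norm_le h.symm.norm_le

theorem IsAdjointPair.norm_sq_le {T : E →L[ℂ] F} {S : F →L[ℂ] E} (h : IsAdjointPair B T S) :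
    ‖T‖ * ‖T‖ ≤ ‖S.comp T‖ := by
  have : ‖T‖ ≤ √‖S.comp T‖ := by
    refine T.opNorm_le_bound (Real.sqrt_nonneg _) fun x => ?_
    refine abs_le_of_sq_le_sq' ?_ (by positivity) |>.2
    rw [norm_sq_ip B, h, mul_pow, Real.sq_sqrt (norm_nonneg _)]
    calc _ ≤ ‖x‖ * ‖S.comp T x‖ := norm_ip_le _ _
      _ ≤ ‖x‖ * (‖S.comp T‖ * ‖x‖) := by gcongr; exact (S.comp T).le_opNorm _
      _ = _ := by ring
  calc _ ≤ √‖S.comp T‖ * √‖S.comp T‖ := by gcongr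
    _ = _ := Real.mul_self_sqrt (norm_nonneg _)

theorem IsAdjointPair.map_rs {T : E →L[ℂ] F} {S : F →L[ℂ] E} (h : IsAdjointPair B T S) (x : E)
    (b : B) : T (rs x b) = rs (T x) b :=
  eq_of_forall_ip B fun z => by rw [← h.symm, ip_rs_right, ip_rs_right, h.symm]

theorem isClosed_isAdjointable [CompleteSpace E] :
    IsClosed {T : E →L[ℂ] F | IsAdjointable B T} := by
  refine isClosed_of_closure_subset fun T hT => ?_
  obtain ⟨u, hu, hlim⟩ := mem_closure_iff_seq_limit.1 hT
  choose S hS using hu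
  have hc : CauchySeq S := by
    refine Metric.cauchySeq_iff'.2 fun ε hε => ?_
    obtain ⟨N, hN⟩ := Metric.cauchySeq_iff'.1 hlim.cauchySeq ε hε
    refine ⟨N, fun n hn => ?_⟩
    have h1 : IsAdjointPair B (u n - u N) (S n - S N) := fun x y => by
      rw [_root_.sub_apply, ip_sub_left, hS, hS, _root_.sub_apply,
        ip_sub_right]
    rw [dist_eq_norm, h1.norm_eq, ← dist_eq_norm]
    exact hN n hn
  obtain ⟨S', hS'⟩ := cauchySeq_tendsto_of_complete hc
  refine ⟨S', fun x y => ?_⟩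
  have e1 : Tendsto (fun n => ip B (u n x) y) atTop (𝓝 (ip B (T x) y)) :=
    ((continuous_id.ip (B := B) (continuous_const (y := y))).tendsto _).comp
      (((ContinuousLinearMap.apply ℂ F x).continuous.tendsto T).comp hlim)
  have e2 : Tendsto (fun n => ip B x (S n y)) atTop (𝓝 (ip B x (S' y))) :=
    (((continuous_const (y := x)).ip (B := B) continuous_id).tendsto _).comp
      (((ContinuousLinearMap.apply ℂ E y).continuous.tendsto S').comp hS')
  exact tendsto_nhds_unique e1 (e2.congr fun n => (hS n x y).symm)

variable (B E) in
/-- The algebra of adjointable operators on `E`. -/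
def adjSubalgebra : Subalgebra ℂ (E →L[ℂ] E) where
  carrier := {T | IsAdjointable B T}
  mul_mem' := by
    rintro T T' ⟨S, h⟩ ⟨S', h'⟩
    exact ⟨S'.comp S, h'.comp h⟩
  add_mem' := by
    rintro T T' ⟨S, h⟩ ⟨S', h'⟩
    exact ⟨S + S', h.add h'⟩
  algebraMap_mem' c := by
    rw [Algebra.algebraMap_eq_smul_one]
    exact ⟨_, isAdjointPair_id.smul c⟩

variable (B E) in
/-- The C*-algebra of adjointable operators on `E`. -/
abbrev AdjAlg : Type _ := adjSubalgebra B E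

instance : Star (AdjAlg B E) where
  star T := ⟨adj B (T : E →L[ℂ] E), ⟨_, T.2.isAdjointPair.symm⟩⟩

theorem AdjAlg.coe_star (T : AdjAlg B E) : ((star T : AdjAlg B E) : E →L[ℂ] E) = adj B T.1 := rfl

theorem AdjAlg.isAdjointPair (T : AdjAlg B E) :
    IsAdjointPair B (T : E →L[ℂ] E) ((star T : AdjAlg B E) : E →L[ℂ] E) := T.2.isAdjointPair

theorem AdjAlg.star_eq {T S : AdjAlg B E} (h : IsAdjointPair B T.1 S.1) : star T = S :=
  Subtype.ext h.adj_eq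

instance : StarRing (AdjAlg B E) where
  star_involutive T := AdjAlg.star_eq T.isAdjointPair.symm
  star_mul T S := AdjAlg.star_eq (S.isAdjointPair.comp T.isAdjointPair)
  star_add T S := AdjAlg.star_eq (T.isAdjointPair.add S.isAdjointPair)

instance [CompleteSpace E] : CStarAlgebra (AdjAlg B E) where
  toCompleteSpace :=
    IsClosed.completeSpace_coe (s := ((adjSubalgebra B E : Set (E →L[ℂ] E))))
      (hs := isClosed_isAdjointable)
  norm_mul_self_le T := T.isAdjointPair.norm_sq_le
  star_smul c T := AdjAlg.star_eq (T.isAdjointPair.smul c)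

/-- A *-homomorphism `φ : A → AdjAlg B E` is essential if `φ(A)E` spans a dense subspace. -/
def IsEssential {A : Type*} [NonUnitalCStarAlgebra A] [CompleteSpace E]
    (φ : A →⋆ₙₐ[ℂ] AdjAlg B E) : Prop :=
  Dense (Submodule.span ℂ {y : E | ∃ (a : A) (x : E), y = (φ a : E →L[ℂ] E) x} : Set E)

end Adjointable

/-! ### Interior tensor products -/

section Tensor

open UniformSpace

/-- A self-adjoint element is the difference of two orthogonal positive elements. -/
theorem exists_pos_sub_pos {A : Type*} [NonUnitalCStarAlgebra A] (m : A) (hm : IsSelfAdjoint m) :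
    ∃ c d : A, m = star c * c - star d * d ∧ (star d * d) * (star c * c) = 0 := by
  let _ := CStarAlgebra.spectralOrder A
  have _ := CStarAlgebra.spectralOrderedRing A
  obtain ⟨c, hc⟩ := CStarAlgebra.nonneg_iff_eq_star_mul_self.1 (CFC.posPart_nonneg m)
  obtain ⟨d, hd⟩ := CStarAlgebra.nonneg_iff_eq_star_mul_self.1 (CFC.negPart_nonneg m)
  refine ⟨c, d, ?_, ?_⟩
  · rw [← hc, ← hd, CFC.posPart_sub_negPart m hm]
  · rw [← hc, ← hd, CFC.negPart_mul_posPart]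

/-- The matrix of inner products `⟨x i, x j⟩` is of the form `star S * S`. -/
theorem exists_gram {A E : Type*} [NonUnitalCStarAlgebra A] [AddCommGroup E] [Module ℂ E]
    [SemiInnerModule A E] {ι : Type*} [Fintype ι] (x : ι → E) :
    ∃ S : ι → ι → A, ∀ i j, ip A (x i) (x j) = ∑ k, star (S k i) * S k j := by
  classical
  let _ := CStarAlgebra.spectralOrder A
  have _ := CStarAlgebra.spectralOrderedRing A
  let M : CStarMatrix ι ι A := CStarMatrix.ofMatrix fun i j => ip A (x i) (x j)
  have hMa : ∀ i j, M i j = ip A (x i) (x j) := fun _ _ => rfl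
  have hM : IsSelfAdjoint M := by
    ext i j
    rw [CStarMatrix.star_apply, hMa, hMa, ip_star]
  obtain ⟨S, C, hSC, horth⟩ := exists_pos_sub_pos M hM
  obtain ⟨N, hN⟩ : ∃ N, N = star C * C := ⟨_, rfl⟩
  rw [← hN] at hSC horth
  have hNs : star N = N := by rw [hN, star_mul, star_star]
  have h1 : N * M * N = - (star (C * N) * (C * N)) := by
    calc N * M * N = N * (star S * S - N) * N := by rw [← hSC]
      _ = - (N * N * N) := by rw [mul_sub, horth, zero_sub, neg_mul]
      _ = - (N * (star C * C) * N) := by rw [← hN]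
      _ = - (star (C * N) * (C * N)) := by rw [star_mul, hNs, mul_assoc, mul_assoc, mul_assoc]
  have hdiag : ∀ k, 0 ≤ (N * M * N) k k := by
    intro k
    have e : (N * M * N) k k = ip A (∑ i, rs (x i) (N i k)) (∑ i, rs (x i) (N i k)) := by
      rw [ip_sum_right, CStarMatrix.mul_apply]
      refine Finset.sum_congr rfl fun j _ => ?_
      rw [CStarMatrix.mul_apply, ip_rs_right, ip_sum_left]
      congr 1
      refine Finset.sum_congr rfl fun i _ => ?_
      rw [ip_rs_left, hMa, ← CStarMatrix.star_apply, hNs]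
    rw [e]
    exact CStarAlgebra.nonneg_iff_eq_star_mul_self.2 (ip_self_nonneg _)
  have hD : C * N = 0 := by
    ext i k
    have h2 := hdiag k
    rw [h1, CStarMatrix.neg_apply, CStarMatrix.mul_apply, neg_nonneg] at h2
    have h3 : ∀ j ∈ Finset.univ, 0 ≤ (star (C * N)) k j * (C * N) j k := fun j _ => by
      rw [CStarMatrix.star_apply]; exact star_mul_self_nonneg _
    have h4 := (Finset.sum_eq_zero_iff_of_nonneg h3).1 (le_antisymm h2 (Finset.sum_nonneg h3)) i
      (Finset.mem_univ i)
    rw [CStarMatrix.star_apply] at h4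
    exact CStarRing.star_mul_self_eq_zero_iff _ |>.1 h4
  have hN0 : N = 0 := by
    refine CStarRing.star_mul_self_eq_zero_iff _ |>.1 ?_
    rw [hNs]
    nth_rw 1 [hN]
    rw [mul_assoc, hD, mul_zero]
  refine ⟨fun k i => S k i, fun i j => ?_⟩
  rw [← hMa, hSC, hN0, sub_zero, CStarMatrix.mul_apply]
  simp only [CStarMatrix.star_apply]

variable {A B E₂ : Type*} [NonUnitalCStarAlgebra A] [NonUnitalCStarAlgebra B]
  [NormedAddCommGroup E₂] [NormedSpace ℂ E₂] [CompleteSpace E₂] [InnerModule B E₂]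

/-- The algebraic tensor product `E₁ ⊗ E₂`, to be equipped with the inner product determined by
`φ : A → AdjAlg B E₂`. -/
def PreTensor (E₁ : Type*) [NormedAddCommGroup E₁] [NormedSpace ℂ E₁] [InnerModule A E₁]
    (_φ : A →⋆ₙₐ[ℂ] AdjAlg B E₂) : Type _ := E₁ ⊗[ℂ] E₂

variable (E₁ : Type*) [NormedAddCommGroup E₁] [NormedSpace ℂ E₁] [InnerModule A E₁]
  (φ : A →⋆ₙₐ[ℂ] AdjAlg B E₂)

instance : AddCommGroup (PreTensor E₁ φ) := inferInstanceAs (AddCommGroup (E₁ ⊗[ℂ] E₂))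
instance : Module ℂ (PreTensor E₁ φ) := inferInstanceAs (Module ℂ (E₁ ⊗[ℂ] E₂))

variable {E₁} in
/-- The functional `y ⊗ η ↦ ⟨ξ, φ(⟨x, y⟩) η⟩` on `E₁ ⊗ E₂`. -/
def PreTensor.functional (x : E₁) (ξ : E₂) : PreTensor E₁ φ →ₗ[ℂ] B :=
  TensorProduct.lift (LinearMap.mk₂ ℂ (fun y η => ip B ξ ((φ (ip A x y) : E₂ →L[ℂ] E₂) η))
    (fun y y' η => by
      rw [ip_add_right, map_add]; exact ip_add_right _ _ _)
    (fun c y η => by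
      rw [ip_smul_right, map_smul]; exact ip_smul_right _ _ _)
    (fun y η η' => by rw [map_add, ip_add_right])
    (fun c y η => by rw [map_smul, ip_smul_right]))

/-- The `B`-valued inner product on `E₁ ⊗ E₂` as a sesquilinear map. -/
def PreTensor.form : PreTensor E₁ φ →ₗ⋆[ℂ] PreTensor E₁ φ →ₗ[ℂ] B :=
  TensorProduct.lift (LinearMap.mk₂'ₛₗ (starRingEnd ℂ) (starRingEnd ℂ)
    (fun x ξ => PreTensor.functional φ x ξ)
    (fun x x' ξ => TensorProduct.ext' fun y η => by
      change ip B ξ ((φ (ip A (x + x') y) : E₂ →L[ℂ] E₂) η) =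
        ip B ξ ((φ (ip A x y) : E₂ →L[ℂ] E₂) η) + ip B ξ ((φ (ip A x' y) : E₂ →L[ℂ] E₂) η)
      rw [ip_add_left, map_add]; exact ip_add_right _ _ _)
    (fun c x ξ => TensorProduct.ext' fun y η => by
      change ip B ξ ((φ (ip A (c • x) y) : E₂ →L[ℂ] E₂) η) =
        star c • ip B ξ ((φ (ip A x y) : E₂ →L[ℂ] E₂) η)
      rw [ip_smul_left, map_smul]; exact ip_smul_right _ _ _)
    (fun x ξ ξ' => TensorProduct.ext' fun y η => by
      change ip B (ξ + ξ') ((φ (ip A x y) : E₂ →L[ℂ] E₂) η) =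
        ip B ξ ((φ (ip A x y) : E₂ →L[ℂ] E₂) η) + ip B ξ' ((φ (ip A x y) : E₂ →L[ℂ] E₂) η)
      rw [ip_add_left])
    (fun c x ξ => TensorProduct.ext' fun y η => by
      change ip B (c • ξ) ((φ (ip A x y) : E₂ →L[ℂ] E₂) η) =
        star c • ip B ξ ((φ (ip A x y) : E₂ →L[ℂ] E₂) η)
      rw [ip_smul_left]))

variable {E₁} in
/-- The elementary tensor `x ⊗ ξ` in the algebraic tensor product. -/
def PreTensor.tmul (x : E₁) (ξ : E₂) : PreTensor E₁ φ := x ⊗ₜ[ℂ] ξ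

theorem PreTensor.form_tmul (x y : E₁) (ξ η : E₂) :
    PreTensor.form E₁ φ (PreTensor.tmul φ x ξ) (PreTensor.tmul φ y η) =
      ip B ξ ((φ (ip A x y) : E₂ →L[ℂ] E₂) η) := rfl

variable {E₁ φ} in
theorem PreTensor.induction {p : PreTensor E₁ φ → Prop} (t : PreTensor E₁ φ) (h0 : p 0)
    (h1 : ∀ x ξ, p (PreTensor.tmul φ x ξ)) (h2 : ∀ s t, p s → p t → p (s + t)) : p t :=
  TensorProduct.induction_on t h0 h1 h2

theorem PreTensor.star_form (s t : PreTensor E₁ φ) :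
    star (PreTensor.form E₁ φ s t) = PreTensor.form E₁ φ t s := by
  induction s using PreTensor.induction with
  | h0 => simp
  | h2 s s' h h' => simp [h, h']
  | h1 x ξ =>
    induction t using PreTensor.induction with
    | h0 => simp
    | h2 s s' h h' => simp [h, h']
    | h1 y η =>
      rw [form_tmul, form_tmul, ip_star, ← ip_star x y, map_star]
      exact (φ (ip A x y)).isAdjointPair _ _

/-- The right action of `b` on `E₁ ⊗ E₂`. -/
def PreTensor.rsₗ (b : B) : PreTensor E₁ φ →ₗ[ℂ] PreTensor E₁ φ :=
  TensorProduct.map LinearMap.id (rsL (E := E₂) b : E₂ →ₗ[ℂ] E₂)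

theorem PreTensor.rsₗ_tmul (b : B) (x : E₁) (ξ : E₂) :
    PreTensor.rsₗ E₁ φ b (PreTensor.tmul φ x ξ) = PreTensor.tmul φ x (rs ξ b) := rfl

theorem PreTensor.exists_sum (t : PreTensor E₁ φ) : ∃ (n : ℕ) (x : Fin n → E₁) (ξ : Fin n → E₂),
    t = ∑ i, PreTensor.tmul φ (x i) (ξ i) := by
  induction t using PreTensor.induction with
  | h0 => exact ⟨0, Fin.elim0, Fin.elim0, by simp⟩
  | h1 x ξ => exact ⟨1, fun _ => x, fun _ => ξ, by simp⟩
  | h2 s t hs ht =>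
    obtain ⟨n, x, ξ, rfl⟩ := hs
    obtain ⟨m, y, η, rfl⟩ := ht
    exact ⟨n + m, Fin.append x y, Fin.append ξ η, by simp [Fin.sum_univ_add]⟩

theorem PreTensor.form_self_nonneg (t : PreTensor E₁ φ) :
    ∃ b : B, PreTensor.form E₁ φ t t = star b * b := by
  let _ := CStarAlgebra.spectralOrder B
  have _ := CStarAlgebra.spectralOrderedRing B
  obtain ⟨n, x, ξ, rfl⟩ := PreTensor.exists_sum E₁ φ t
  obtain ⟨S, hS⟩ := exists_gram (A := A) x
  have e : PreTensor.form E₁ φ (∑ i, PreTensor.tmul φ (x i) (ξ i))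
      (∑ i, PreTensor.tmul φ (x i) (ξ i)) =
      ∑ k, ip B (∑ i, (φ (S k i) : E₂ →L[ℂ] E₂) (ξ i)) (∑ i, (φ (S k i) : E₂ →L[ℂ] E₂) (ξ i)) := by
    simp only [map_sum, LinearMap.sum_apply, form_tmul, hS, ip_sum_left, ip_sum_right]
    have e1 : ∀ i j, ip B (ξ i) (((∑ k, φ (star (S k i) * S k j) : AdjAlg B E₂) :
        E₂ →L[ℂ] E₂) (ξ j)) = ∑ k, ip B ((φ (S k i) : E₂ →L[ℂ] E₂) (ξ i))
          ((φ (S k j) : E₂ →L[ℂ] E₂) (ξ j)) := by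
      intro i j
      rw [AddSubmonoidClass.coe_finsetSum, _root_.sum_apply, ip_sum_right]
      refine Finset.sum_congr rfl fun k _ => ?_
      rw [(φ (S k i)).isAdjointPair, ← map_star, map_mul]
      rfl
    simp only [e1]
    rw [Finset.sum_comm_cycle]
  rw [e]
  refine CStarAlgebra.nonneg_iff_eq_star_mul_self.1 (Finset.sum_nonneg fun k _ => ?_)
  exact CStarAlgebra.nonneg_iff_eq_star_mul_self.2 (ip_self_nonneg _)

/-- The algebraic tensor product with
`⟨x ⊗ ξ, y ⊗ η⟩ = ⟨ξ, φ(⟨x, y⟩) η⟩` and `(x ⊗ ξ) · b = x ⊗ (ξ · b)`. -/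
instance : SemiInnerModule B (PreTensor E₁ φ) where
  inner s t := PreTensor.form E₁ φ s t
  rsmul t b := PreTensor.rsₗ E₁ φ b t
  add_rsmul s t b := map_add _ _ _
  smul_rsmul c t b := map_smul _ _ _
  rsmul_add t b b' := by
    induction t using PreTensor.induction with
    | h0 => simp
    | h2 s t hs ht => simp only [map_add, hs, ht]; abel
    | h1 x ξ =>
      rw [PreTensor.rsₗ_tmul, rs_add]
      exact TensorProduct.tmul_add _ _ _
  rsmul_smul c t b := by
    induction t using PreTensor.induction with
    | h0 => simp
    | h2 s t hs ht => simp only [map_add, hs, ht, smul_add]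
    | h1 x ξ =>
      rw [PreTensor.rsₗ_tmul, rs_smul]
      exact TensorProduct.tmul_smul _ _ _
  rsmul_mul t b b' := by
    induction t using PreTensor.induction with
    | h0 => simp
    | h2 s t hs ht => simp only [map_add, hs, ht]
    | h1 x ξ => simp only [PreTensor.rsₗ_tmul, rs_mul]
  inner_add_right s t u := map_add _ _ _
  inner_smul_right c s t := map_smul _ _ _
  inner_rsmul_right s t b := by
    induction t using PreTensor.induction with
    | h0 => simp
    | h2 t t' h h' => simp only [map_add, h, h', add_mul]
    | h1 y η =>
      induction s using PreTensor.induction with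
      | h0 => simp
      | h2 t t' h h' => simp only [map_add, LinearMap.add_apply, h, h', add_mul]
      | h1 x ξ =>
        rw [PreTensor.rsₗ_tmul, PreTensor.form_tmul, PreTensor.form_tmul,
          (φ (ip A x y)).isAdjointPair.map_rs, ip_rs_right]
  star_inner := PreTensor.star_form E₁ φ
  inner_self_nonneg := PreTensor.form_self_nonneg E₁ φ

instance : SeminormedAddCommGroup (PreTensor E₁ φ) :=
  SemiInnerModule.toSeminormedAddCommGroup B (PreTensor E₁ φ)
instance : NormedSpace ℂ (PreTensor E₁ φ) := SemiInnerModule.toNormedSpace B (PreTensor E₁ φ)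
instance : InnerModule B (PreTensor E₁ φ) := SemiInnerModule.toInnerModule B (PreTensor E₁ φ)

/-- The tensor product `E₁ ⊗_A E₂` of the Hilbert `A`-module `E₁` and the Hilbert `B`-module `E₂`
along `φ : A → AdjAlg B E₂`: the completion of the algebraic tensor product. -/
abbrev InteriorTensor : Type _ := Completion (PreTensor E₁ φ)

variable {E₁} in
/-- The canonical map from the algebraic tensor product to `E₁ ⊗_A E₂`. -/
def InteriorTensor.ofTensor : E₁ ⊗[ℂ] E₂ →ₗ[ℂ] InteriorTensor E₁ φ :=
  (Completion.toComplL (𝕜 := ℂ) (E := PreTensor E₁ φ) : PreTensor E₁ φ →ₗ[ℂ] InteriorTensor E₁ φ)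

variable {E₁} in
/-- The elementary tensor `x ⊗ ξ` in `E₁ ⊗_A E₂`. -/
def InteriorTensor.tmul (x : E₁) (ξ : E₂) : InteriorTensor E₁ φ :=
  InteriorTensor.ofTensor φ (x ⊗ₜ[ℂ] ξ)

variable {E₁} in
theorem InteriorTensor.ip_tmul (x y : E₁) (ξ η : E₂) :
    ip B (InteriorTensor.tmul φ x ξ) (InteriorTensor.tmul φ y η) =
      ip B ξ ((φ (ip A x y) : E₂ →L[ℂ] E₂) η) :=
  (ip_coe (V := PreTensor E₁ φ) (PreTensor.tmul φ x ξ) (PreTensor.tmul φ y η)).trans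
    (PreTensor.form_tmul E₁ φ x y ξ η)

end Tensor

/-! ### Group actions -/

/-- `B` is a `G`-C*-algebra: `G` acts on `B` by *-automorphisms and the action is strongly
continuous. -/
class GCStarAlgebra (G B : Type*) [Group G] [TopologicalSpace G] [NonUnitalCStarAlgebra B] where
  /-- The action of `G` on `B`. -/
  act : G →* (B ≃⋆ₐ[ℂ] B)
  continuous_act : ∀ b : B, Continuous fun g => act g b

/-- The action of `g : G` on a `G`-C*-algebra. -/
abbrev actB {G B : Type*} [Group G] [TopologicalSpace G] [NonUnitalCStarAlgebra B]
    [GCStarAlgebra G B] (g : G) : B ≃⋆ₐ[ℂ] B := GCStarAlgebra.act g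

/-- `E` is a `G`-equivariant module over the `G`-C*-algebra `B`: the action of `G` on `E` is linear,
strongly continuous and compatible with the action on `B`. -/
class GInnerModule (G B E : Type*) [Group G] [TopologicalSpace G] [NonUnitalCStarAlgebra B]
    [GCStarAlgebra G B] [NormedAddCommGroup E] [NormedSpace ℂ E] [InnerModule B E] where
  /-- The action of `G` on `E`. -/
  act : G →* (E →L[ℂ] E)
  act_rsmul : ∀ g x (b : B), act g (rs x b) = rs (act g x) (actB g b)
  inner_act : ∀ g x y, ip B (act g x) (act g y) = actB g (ip B x y)
  continuous_act : ∀ x : E, Continuous fun g => act g x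

section Action

variable {G A B E₁ E₂ : Type*} [Group G] [TopologicalSpace G]
  [NonUnitalCStarAlgebra A] [GCStarAlgebra G A] [NonUnitalCStarAlgebra B] [GCStarAlgebra G B]
  [NormedAddCommGroup E₁] [NormedSpace ℂ E₁] [InnerModule A E₁] [GInnerModule G A E₁]
  [NormedAddCommGroup E₂] [NormedSpace ℂ E₂] [InnerModule B E₂] [GInnerModule G B E₂]

variable (B) in
/-- The action of `g : G` on a `G`-equivariant module. -/
abbrev actE (g : G) : E₂ →L[ℂ] E₂ := GInnerModule.act B g

theorem actB_mul (g h : G) (b : B) : actB (g * h) b = actB g (actB h b) := by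
  rw [actB, map_mul]; rfl

theorem actB_one (b : B) : actB (1 : G) b = b := by
  rw [actB, map_one]; rfl

theorem actE_mul (g h : G) (x : E₂) : actE B (g * h) x = actE B g (actE B h x) := by
  rw [actE, map_mul]; rfl

theorem actE_one (x : E₂) : actE B (1 : G) x = x := by
  rw [actE, map_one]; rfl

theorem norm_actB (g : G) (b : B) : ‖actB g b‖ = ‖b‖ :=
  NonUnitalStarAlgHom.norm_map (actB g) (actB g).injective b

theorem norm_actE (g : G) (x : E₂) : ‖actE B g x‖ = ‖x‖ := by
  refine (sq_eq_sq₀ (norm_nonneg _) (norm_nonneg _)).1 ?_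
  rw [norm_sq_ip B, norm_sq_ip B, GInnerModule.inner_act, norm_actB]

theorem continuous_actB_uncurry : Continuous fun p : G × B => actB p.1 p.2 := by
  refine continuous_iff_continuousAt.2 fun ⟨g, b⟩ => tendsto_iff_norm_sub_tendsto_zero.2 ?_
  have h1 : Tendsto (fun p : G × B => ‖p.2 - b‖ + ‖actB p.1 b - actB g b‖) (𝓝 (g, b)) (𝓝 0) := by
    have hc : Continuous fun p : G × B => ‖p.2 - b‖ + ‖actB p.1 b - actB g b‖ :=
      (continuous_snd.sub continuous_const).norm.add
        ((((GCStarAlgebra.continuous_act b).comp continuous_fst).sub continuous_const).norm)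
    simpa using hc.tendsto (g, b)
  refine squeeze_zero (fun _ => norm_nonneg _) (fun p => ?_) h1
  calc ‖actB p.1 p.2 - actB g b‖ = ‖actB p.1 (p.2 - b) + (actB p.1 b - actB g b)‖ := by
        rw [map_sub]; congr 1; abel
    _ ≤ _ := (norm_add_le _ _).trans_eq (by rw [norm_actB])

@[fun_prop]
theorem Continuous.actB {α : Type*} [TopologicalSpace α] {f : α → G} {u : α → B}
    (hf : Continuous f) (hu : Continuous u) : Continuous fun a => actB (f a) (u a) :=
  continuous_actB_uncurry.comp (hf.prodMk hu)

/-- A *-homomorphism `φ : A → AdjAlg B E₂` is equivariant if `γ_g(φ(a)ξ) = φ(α_g(a)) γ_g(ξ)`. -/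
class IsEquivariant (G : Type*) {A B E₂ : Type*} [Group G] [TopologicalSpace G]
    [NonUnitalCStarAlgebra A] [GCStarAlgebra G A] [NonUnitalCStarAlgebra B] [GCStarAlgebra G B]
    [NormedAddCommGroup E₂] [NormedSpace ℂ E₂] [CompleteSpace E₂] [InnerModule B E₂]
    [GInnerModule G B E₂] (φ : A →⋆ₙₐ[ℂ] AdjAlg B E₂) : Prop where
  map_act : ∀ (g : G) (a : A) (ξ : E₂),
    actE B g ((φ a : E₂ →L[ℂ] E₂) ξ) = (φ (actB g a) : E₂ →L[ℂ] E₂) (actE B g ξ)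

end Action

section TensorAction

open UniformSpace

variable {G A B E₂ : Type*} [Group G] [TopologicalSpace G]
  [NonUnitalCStarAlgebra A] [GCStarAlgebra G A] [NonUnitalCStarAlgebra B] [GCStarAlgebra G B]
  (E₁ : Type*) [NormedAddCommGroup E₁] [NormedSpace ℂ E₁] [InnerModule A E₁] [GInnerModule G A E₁]
  [NormedAddCommGroup E₂] [NormedSpace ℂ E₂] [CompleteSpace E₂] [InnerModule B E₂]
  [GInnerModule G B E₂] (φ : A →⋆ₙₐ[ℂ] AdjAlg B E₂)

/-- The diagonal action of `g` on the algebraic tensor product. -/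
def PreTensor.actₗ (g : G) : PreTensor E₁ φ →ₗ[ℂ] PreTensor E₁ φ :=
  TensorProduct.map (actE A g : E₁ →L[ℂ] E₁).toLinearMap (actE B g : E₂ →L[ℂ] E₂).toLinearMap

theorem PreTensor.actₗ_tmul (g : G) (x : E₁) (ξ : E₂) :
    PreTensor.actₗ E₁ φ g (PreTensor.tmul φ x ξ) = PreTensor.tmul φ (actE A g x) (actE B g ξ) := rfl

theorem PreTensor.ip_tmul (x y : E₁) (ξ η : E₂) :
    ip B (PreTensor.tmul φ x ξ) (PreTensor.tmul φ y η) =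
      ip B ξ ((φ (ip A x y) : E₂ →L[ℂ] E₂) η) := rfl

theorem PreTensor.rs_tmul (x : E₁) (ξ : E₂) (b : B) :
    rs (PreTensor.tmul φ x ξ) b = PreTensor.tmul φ x (rs ξ b) := rfl

theorem PreTensor.act_rs (g : G) (s : PreTensor E₁ φ) (b : B) :
    PreTensor.actₗ E₁ φ g (rs s b) = rs (PreTensor.actₗ E₁ φ g s) (actB g b) := by
  induction s using PreTensor.induction with
  | h0 =>
    rw [map_zero, ← rsL_apply, ← rsL_apply, map_zero, map_zero, map_zero]
  | h2 s s' h h' => rw [map_add, add_rs, add_rs, map_add, h, h']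
  | h1 x ξ => rw [rs_tmul, actₗ_tmul, actₗ_tmul, rs_tmul, GInnerModule.act_rsmul]

theorem PreTensor.act_mul (g h : G) (s : PreTensor E₁ φ) :
    PreTensor.actₗ E₁ φ (g * h) s = PreTensor.actₗ E₁ φ g (PreTensor.actₗ E₁ φ h s) := by
  induction s using PreTensor.induction with
  | h0 => simp only [map_zero]
  | h2 s s' h h' => simp only [map_add, h, h']
  | h1 x ξ => simp only [actₗ_tmul, actE_mul]

theorem PreTensor.act_one (s : PreTensor E₁ φ) : PreTensor.actₗ E₁ φ (1 : G) s = s := by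
  induction s using PreTensor.induction with
  | h0 => simp only [map_zero]
  | h2 s s' h h' => simp only [map_add, h, h']
  | h1 x ξ => simp only [actₗ_tmul, actE_one]

theorem PreTensor.norm_tmul_le (x : E₁) (ξ : E₂) : ‖PreTensor.tmul φ x ξ‖ ≤ ‖x‖ * ‖ξ‖ := by
  refine abs_le_of_sq_le_sq' ?_ (by positivity) |>.2
  rw [norm_sq_ip B, ip_tmul]
  calc _ ≤ ‖ξ‖ * ‖(φ (ip A x x) : E₂ →L[ℂ] E₂) ξ‖ := norm_ip_le _ _
    _ ≤ ‖ξ‖ * (‖φ (ip A x x)‖ * ‖ξ‖) := by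
      gcongr; exact (φ (ip A x x) : E₂ →L[ℂ] E₂).le_opNorm ξ
    _ ≤ ‖ξ‖ * (‖ip A x x‖ * ‖ξ‖) := by gcongr; exact NonUnitalStarAlgHom.norm_apply_le φ _
    _ = _ := by rw [← norm_sq_ip A]; ring

theorem PreTensor.continuous_tmul :
    Continuous fun p : E₁ × E₂ => PreTensor.tmul φ p.1 p.2 := by
  let m : E₁ →ₗ[ℂ] E₂ →ₗ[ℂ] PreTensor E₁ φ := LinearMap.mk₂ ℂ (fun x ξ => PreTensor.tmul φ x ξ)
    TensorProduct.add_tmul TensorProduct.smul_tmul' TensorProduct.tmul_add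
    (fun c x y => TensorProduct.tmul_smul c x y)
  let M : E₁ →L[ℂ] E₂ →L[ℂ] PreTensor E₁ φ := LinearMap.mkContinuous₂ m 1 fun x b => by
    rw [one_mul]; exact PreTensor.norm_tmul_le E₁ φ x b
  have : Continuous fun p : E₁ × E₂ => M p.1 p.2 := by fun_prop
  exact this

theorem PreTensor.continuous_act (s : PreTensor E₁ φ) :
    Continuous fun g : G => PreTensor.actₗ E₁ φ g s := by
  induction s using PreTensor.induction with
  | h0 => simpa only [map_zero] using continuous_const
  | h2 s s' h h' =>
    simp only [map_add]
    exact h.add h'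
  | h1 x ξ =>
    exact (PreTensor.continuous_tmul E₁ φ).comp
      ((GInnerModule.continuous_act (B := A) x).prodMk (GInnerModule.continuous_act (B := B) ξ))

variable [IsEquivariant G φ]

theorem PreTensor.ip_act (g : G) (s t : PreTensor E₁ φ) :
    ip B (PreTensor.actₗ E₁ φ g s) (PreTensor.actₗ E₁ φ g t) = actB g (ip B s t) := by
  induction s using PreTensor.induction with
  | h0 => rw [map_zero, ip_zero_left, ip_zero_left, map_zero]
  | h2 s s' h h' => rw [map_add, ip_add_left, ip_add_left, map_add, h, h']
  | h1 x ξ =>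
    induction t using PreTensor.induction with
    | h0 => rw [map_zero, ip_zero_right, ip_zero_right, map_zero]
    | h2 s s' h h' => rw [map_add, ip_add_right, ip_add_right, map_add, h, h']
    | h1 y η =>
      rw [actₗ_tmul, actₗ_tmul, ip_tmul, ip_tmul, GInnerModule.inner_act,
        ← IsEquivariant.map_act, GInnerModule.inner_act]

theorem PreTensor.norm_act (g : G) (s : PreTensor E₁ φ) :
    ‖PreTensor.actₗ E₁ φ g s‖ = ‖s‖ := by
  rw [InnerModule.norm_eq_sqrt (B := B) s, InnerModule.norm_eq_sqrt (B := B), ip_act, norm_actB]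

/-- The diagonal action of `g` on the algebraic tensor product as a continuous linear map. -/
def PreTensor.actL (g : G) : PreTensor E₁ φ →L[ℂ] PreTensor E₁ φ :=
  LinearMap.mkContinuous (PreTensor.actₗ E₁ φ g) 1 fun x => by
    rw [PreTensor.norm_act, one_mul]

theorem PreTensor.actL_apply (g : G) (s : PreTensor E₁ φ) :
    PreTensor.actL E₁ φ g s = PreTensor.actₗ E₁ φ g s := rfl

/-- The diagonal action of `G` on `E₁ ⊗_A E₂`. -/
instance InteriorTensor.gInnerModule : GInnerModule G B (InteriorTensor E₁ φ) where
  act :=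
    { toFun := fun g => (PreTensor.actL E₁ φ g).completion
      map_one' := by
        ext s
        induction s using Completion.induction_on with
        | hp => exact isClosed_eq (ContinuousLinearMap.continuous _) continuous_id
        | ih s =>
          rw [ContinuousLinearMap.completion_apply_coe, PreTensor.actL_apply, PreTensor.act_one]
          rfl
      map_mul' := fun g h => by
        ext s
        induction s using Completion.induction_on with
        | hp => exact isClosed_eq (ContinuousLinearMap.continuous _)
                  (ContinuousLinearMap.continuous _)
        | ih s =>
          rw [ContinuousLinearMap.mul_def, ContinuousLinearMap.comp_apply, ContinuousLinearMap.completion_apply_coe,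
            ContinuousLinearMap.completion_apply_coe, ContinuousLinearMap.completion_apply_coe,
            PreTensor.actL_apply, PreTensor.actL_apply, PreTensor.actL_apply, PreTensor.act_mul] }
  act_rsmul g s b := by
    change (PreTensor.actL E₁ φ g).completion (rs s b) =
      rs ((PreTensor.actL E₁ φ g).completion s) (actB g b)
    induction s using Completion.induction_on with
    | hp =>
      exact isClosed_eq ((ContinuousLinearMap.continuous _).comp (continuous_rs _ b))
        ((continuous_rs _ _).comp (ContinuousLinearMap.continuous _))
    | ih s =>
      rw [rs_coe, ContinuousLinearMap.completion_apply_coe,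
        ContinuousLinearMap.completion_apply_coe, rs_coe, PreTensor.actL_apply, PreTensor.act_rs,
        PreTensor.actL_apply]
  inner_act g s t := by
    change ip B ((PreTensor.actL E₁ φ g).completion s) ((PreTensor.actL E₁ φ g).completion t) =
      actB g (ip B s t)
    induction s, t using Completion.induction_on₂ with
    | hp =>
      exact isClosed_eq (((ContinuousLinearMap.continuous _).comp continuous_fst).ip
        ((ContinuousLinearMap.continuous _).comp continuous_snd))
        (continuous_const.actB (continuous_fst.ip continuous_snd))
    | ih s t =>
      rw [ContinuousLinearMap.completion_apply_coe, ContinuousLinearMap.completion_apply_coe,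
        ip_coe, ip_coe, PreTensor.actL_apply, PreTensor.actL_apply, PreTensor.ip_act]
  continuous_act s := by
    change Continuous fun g : G => (PreTensor.actL E₁ φ g).completion s
    have hn : ∀ (g : G) (t : InteriorTensor E₁ φ), ‖(PreTensor.actL E₁ φ g).completion t‖ = ‖t‖ := by
      intro g t
      induction t using Completion.induction_on with
      | hp => exact isClosed_eq (ContinuousLinearMap.continuous _).norm continuous_norm
      | ih t =>
        rw [ContinuousLinearMap.completion_apply_coe, Completion.norm_coe, Completion.norm_coe,
          PreTensor.actL_apply, PreTensor.norm_act]
    refine continuous_of_uniform_approx_of_continuous fun u hu => ?_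
    obtain ⟨ε, hε, hεu⟩ := Metric.mem_uniformity_dist.1 hu
    obtain ⟨t, ht⟩ := Completion.denseRange_coe.exists_dist_lt s hε
    refine ⟨fun g => (PreTensor.actL E₁ φ g).completion (t : InteriorTensor E₁ φ), ?_,
      fun g => hεu ?_⟩
    · simp only [ContinuousLinearMap.completion_apply_coe]
      exact (Completion.continuous_coe _).comp (PreTensor.continuous_act E₁ φ t)
    · rw [dist_eq_norm, ← map_sub, hn, ← dist_eq_norm]
      exact ht

end TensorAction

/-! ### The Hilbert module `L²(G, B)` -/

section L2

open UniformSpace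

/-- A continuous function with compact support as an element of `C_c(G, E)`. -/
def ccMk {G E : Type*} [TopologicalSpace G] [TopologicalSpace E] [Zero E] (f : G → E)
    (hf : Continuous f) (hs : HasCompactSupport f) : C_c(G, E) := ⟨⟨f, hf⟩, hs⟩

theorem ccMk_apply {G E : Type*} [TopologicalSpace G] [TopologicalSpace E] [Zero E] (f : G → E)
    (hf : Continuous f) (hs : HasCompactSupport f) (g : G) : ccMk f hf hs g = f g := rfl

theorem cc_ext {G E : Type*} [TopologicalSpace G] [TopologicalSpace E] [Zero E] {f k : C_c(G, E)}
    (h : ∀ g, f g = k g) : f = k := DFunLike.ext f k h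

theorem cc_apply_eq_zero {G E : Type*} [TopologicalSpace G] [TopologicalSpace E] [Zero E]
    (f : C_c(G, E)) {g : G} (h : g ∉ tsupport f) : f g = 0 := image_eq_zero_of_notMem_tsupport h

variable {G : Type*} [Group G] [TopologicalSpace G] [IsTopologicalGroup G] [T2Space G]
  [MeasurableSpace G] [BorelSpace G]
  {B : Type*} [NonUnitalCStarAlgebra B]

theorem cc_integrable {E : Type*} [NormedAddCommGroup E] (μ : Measure G)
    [IsFiniteMeasureOnCompacts μ] (f : C_c(G, E)) : Integrable (fun g => f g) μ :=
  f.continuous.integrable_of_hasCompactSupport f.hasCompactSupport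

/-- The function `g ↦ ∫ u(g, h) dh`. -/
def ccInt {E : Type*} [NormedAddCommGroup E] [NormedSpace ℝ E] (μ : Measure G)
    [IsFiniteMeasureOnCompacts μ] (u : G → G → E) (hu : Continuous u.uncurry)
    (hs : HasCompactSupport u.uncurry) : C_c(G, E) :=
  ccMk (fun g => ∫ h, u g h ∂μ)
    (continuousOn_univ.1 (continuousOn_integral_of_compact_support
      (IsCompact.image hs continuous_snd) (hu.continuousOn) fun g h _ hh => by
        by_contra h0
        exact hh ⟨(g, h), subset_tsupport _ h0, rfl⟩))
    (HasCompactSupport.intro (IsCompact.image hs continuous_fst) fun g hg => by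
      refine integral_eq_zero_of_ae (Eventually.of_forall fun h => ?_)
      by_contra h0
      exact hg ⟨(g, h), subset_tsupport _ h0, rfl⟩)

theorem ccInt_apply {E : Type*} [NormedAddCommGroup E] [NormedSpace ℝ E] (μ : Measure G)
    [IsFiniteMeasureOnCompacts μ] (u : G → G → E) (hu : Continuous u.uncurry)
    (hs : HasCompactSupport u.uncurry) (g : G) : ccInt μ u hu hs g = ∫ h, u g h ∂μ := rfl

theorem hasCompactSupport_of_left {E : Type*} [NormedAddCommGroup E]
    (f : C_c(G, E)) (k : G → E) (h : ∀ g, f g = 0 → k g = 0) : HasCompactSupport k :=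
  HasCompactSupport.intro f.hasCompactSupport fun g hg => h g (cc_apply_eq_zero f hg)

/-- The pointwise right action of `b` on `C_c(G, B)`. -/
def ccRs (f : C_c(G, B)) (b : B) : C_c(G, B) :=
  ccMk (fun g => f g * b) (f.continuous.mul continuous_const)
    (hasCompactSupport_of_left f _ fun g h => by rw [h, zero_mul])

/-- The function `g ↦ f(g)* k(g)` for `f, k` in `C_c(G, B)`. -/
def ccStarMul (f k : C_c(G, B)) : C_c(G, B) :=
  ccMk (fun g => star (f g) * k g) (f.continuous.star.mul k.continuous)
    (hasCompactSupport_of_left f _ fun g h => by rw [h, star_zero, zero_mul])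

/-- The space `C_c(G, B)`, to be equipped with the inner product given by the measure `μ`. -/
def PreL2 (_μ : Measure G) (B : Type*) [NonUnitalCStarAlgebra B] : Type _ := C_c(G, B)

variable (μ : Measure G)

instance : AddCommGroup (PreL2 μ B) := inferInstanceAs (AddCommGroup C_c(G, B))
instance : Module ℂ (PreL2 μ B) := inferInstanceAs (Module ℂ C_c(G, B))

variable [μ.IsHaarMeasure]

/-- The space `C_c(G, B)` with `⟨f, k⟩ = ∫ f(g)* k(g) dg` and `(f · b)(g) = f(g) b`. -/
instance PreL2.semiInnerModule : SemiInnerModule B (PreL2 μ B) where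
  inner (f k : C_c(G, B)) := ∫ g, ccStarMul f k g ∂μ
  rsmul (f : C_c(G, B)) b := (ccRs f b : C_c(G, B))
  add_rsmul f k b := cc_ext (f := (_ : C_c(G, B))) (k := (_ : C_c(G, B)))
    fun g => add_mul (R := B) _ _ _
  smul_rsmul c f b := cc_ext (f := (_ : C_c(G, B))) (k := (_ : C_c(G, B)))
    fun g => smul_mul_assoc (β := B) _ _ _
  rsmul_add f b b' := cc_ext (f := (_ : C_c(G, B))) (k := (_ : C_c(G, B)))
    fun g => mul_add (R := B) _ _ _
  rsmul_smul c f b := cc_ext (f := (_ : C_c(G, B))) (k := (_ : C_c(G, B)))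
    fun g => mul_smul_comm (β := B) _ _ _
  rsmul_mul f b b' := cc_ext (f := (_ : C_c(G, B))) (k := (_ : C_c(G, B)))
    fun g => (mul_assoc (G := B) _ _ _).symm
  inner_add_right (f k l : C_c(G, B)) := by
    refine Eq.trans ?_ (integral_add (cc_integrable μ _) (cc_integrable μ _))
    exact integral_congr_ae (Eventually.of_forall fun g => mul_add (R := B) _ _ _)
  inner_smul_right c (f k : C_c(G, B)) := by
    refine Eq.trans ?_ (integral_smul c _)
    exact integral_congr_ae (Eventually.of_forall fun g => mul_smul_comm (β := B) _ _ _)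
  inner_rsmul_right (f k : C_c(G, B)) b := by
    refine Eq.trans ?_ (((ContinuousLinearMap.mul ℂ B).flip b).integral_comp_comm
      (cc_integrable μ (ccStarMul f k)))
    exact integral_congr_ae (Eventually.of_forall fun g => (mul_assoc (G := B) _ _ _).symm)
  star_inner (f k : C_c(G, B)) := by
    refine Eq.trans ((starL' ℝ (A := B)).integral_comp_comm _).symm ?_
    refine integral_congr_ae (Eventually.of_forall fun g => ?_)
    change star (star (f g) * k g) = star (k g) * f g
    rw [star_mul, star_star]
  inner_self_nonneg (f : C_c(G, B)) := by
    let _ := CStarAlgebra.spectralOrder B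
    have _ := CStarAlgebra.spectralOrderedRing B
    refine CStarAlgebra.nonneg_iff_eq_star_mul_self.1 (integral_nonneg fun g => ?_)
    exact star_mul_self_nonneg (f g)

instance : SeminormedAddCommGroup (PreL2 μ B) :=
  SemiInnerModule.toSeminormedAddCommGroup B (PreL2 μ B)
instance : NormedSpace ℂ (PreL2 μ B) := SemiInnerModule.toNormedSpace B (PreL2 μ B)
instance : InnerModule B (PreL2 μ B) := SemiInnerModule.toInnerModule B (PreL2 μ B)

/-- The Hilbert `B`-module `L²(G, B)`: the completion of `C_c(G, B)` with respect to the inner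
product `⟨f, k⟩ = ∫ f(g)* k(g) dg`. -/
abbrev L2 (μ : Measure G) [μ.IsHaarMeasure] (B : Type*) [NonUnitalCStarAlgebra B] : Type _ :=
  Completion (PreL2 μ B)

/-- The canonical map `C_c(G, B) → L²(G, B)`. -/
def toL2 : C_c(G, B) →ₗ[ℂ] L2 μ B :=
  (Completion.toComplL (𝕜 := ℂ) (E := PreL2 μ B) : PreL2 μ B →ₗ[ℂ] L2 μ B)

theorem ip_toL2 (f k : C_c(G, B)) :
    ip B (toL2 μ f) (toL2 μ k) = ∫ g, star (f g) * k g ∂μ :=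
  ip_coe (V := PreL2 μ B) f k

theorem rs_toL2 (f : C_c(G, B)) (b : B) : rs (toL2 μ f) b = toL2 μ (ccRs f b) :=
  rs_coe (V := PreL2 μ B) f b

theorem denseRange_toL2 : DenseRange (toL2 μ : C_c(G, B) → L2 μ B) :=
  Completion.denseRange_coe (α := PreL2 μ B)

/-- A densely defined criterion for adjoint pairs on `L²(G, B)`. -/
theorem eq_of_forall_ip_toL2 {x y : L2 μ B}
    (h : ∀ k : C_c(G, B), ip B (toL2 μ k) x = ip B (toL2 μ k) y) : x = y := by
  refine eq_of_forall_ip B fun z => ?_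
  induction z using (denseRange_toL2 μ).induction_on with
  | hp => exact isClosed_eq (continuous_id.ip continuous_const) (continuous_id.ip continuous_const)
  | ih k => exact h k

end L2

/-! ### The reduced crossed product -/

section CrossedProduct

open UniformSpace

variable {G : Type*} [Group G] [TopologicalSpace G] [IsTopologicalGroup G] [T2Space G]
  [MeasurableSpace G] [BorelSpace G] (μ : Measure G) [μ.IsHaarMeasure]
  {B : Type*} [NonUnitalCStarAlgebra B] [GCStarAlgebra G B]

theorem hasCompactSupport_rho {E F D : Type*} [Zero E] [TopologicalSpace E] [Zero F]
    [TopologicalSpace F] [Zero D] (K : C_c(G, E)) (f : C_c(G, F)) (u : G → G → D)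
    (h0 : ∀ g h, f h = 0 → u g h = 0) (h1 : ∀ g h, K (g⁻¹ * h) = 0 → u g h = 0) :
    HasCompactSupport u.uncurry := by
  refine HasCompactSupport.intro (K := (fun p : G × G => (p.1 * p.2⁻¹, p.1)) ''
    (tsupport f ×ˢ tsupport K)) ((f.hasCompactSupport.isCompact.prod
      K.hasCompactSupport.isCompact).image (by fun_prop)) ?_
  rintro ⟨g, h⟩ hp
  by_cases hf : h ∈ tsupport f
  · by_cases hK : g⁻¹ * h ∈ tsupport K
    · exact absurd ⟨(h, g⁻¹ * h), ⟨hf, hK⟩, by simp⟩ hp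
    · exact h1 g h (cc_apply_eq_zero K hK)
  · exact h0 g h (cc_apply_eq_zero f hf)

theorem hasCompactSupport_conv {E F D : Type*} [Zero E] [TopologicalSpace E] [Zero F]
    [TopologicalSpace F] [Zero D] (K : C_c(G, E)) (f : C_c(G, F)) (u : G → G → D)
    (h0 : ∀ g h, K h = 0 → u g h = 0) (h1 : ∀ g h, f (h⁻¹ * g) = 0 → u g h = 0) :
    HasCompactSupport u.uncurry := by
  refine HasCompactSupport.intro (K := (fun p : G × G => (p.1 * p.2, p.1)) ''
    (tsupport K ×ˢ tsupport f)) ((K.hasCompactSupport.isCompact.prod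
      f.hasCompactSupport.isCompact).image (by fun_prop)) ?_
  rintro ⟨g, h⟩ hp
  by_cases hK : h ∈ tsupport K
  · by_cases hf : h⁻¹ * g ∈ tsupport f
    · exact absurd ⟨(h, h⁻¹ * g), ⟨hK, hf⟩, by simp⟩ hp
    · exact h1 g h (cc_apply_eq_zero f hf)
  · exact h0 g h (cc_apply_eq_zero K hK)

/-- `(ρ_K f)(g) = ∫ β_g(K(g⁻¹ h)) f(h) dh` for `K, f` in `C_c(G, B)`. -/
def rhoCc (K f : C_c(G, B)) : C_c(G, B) :=
  ccInt μ (fun g h => actB g (K (g⁻¹ * h)) * f h)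
    (by
      have hK := K.continuous
      have hf := f.continuous
      exact (continuous_fst.actB (hK.comp (continuous_fst.inv.mul continuous_snd))).mul
        (hf.comp continuous_snd))
    (hasCompactSupport_rho K f _ (fun g h h0 => by rw [h0, mul_zero])
      (fun g h h0 => by rw [h0, map_zero, zero_mul]))

theorem rhoCc_apply (K f : C_c(G, B)) (g : G) :
    rhoCc μ K f g = ∫ h, actB g (K (g⁻¹ * h)) * f h ∂μ := rfl

/-- The convolution `(K * L)(g) = ∫ K(h) β_h(L(h⁻¹ g)) dh`. -/
def ccConv (K L : C_c(G, B)) : C_c(G, B) :=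
  ccInt μ (fun g h => K h * actB h (L (h⁻¹ * g)))
    (by
      have hK := K.continuous
      have hL := L.continuous
      exact (hK.comp continuous_snd).mul
        (continuous_snd.actB (hL.comp (continuous_snd.inv.mul continuous_fst))))
    (hasCompactSupport_conv K L _ (fun g h h0 => by rw [h0, zero_mul])
      (fun g h h0 => by rw [h0, map_zero, mul_zero]))

theorem ccConv_apply (K L : C_c(G, B)) (g : G) :
    ccConv μ K L g = ∫ h, K h * actB h (L (h⁻¹ * g)) ∂μ := rfl

/-- The involution `K*(g) = β_g(K(g⁻¹))*` on `C_c(G, B)`. -/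
def ccAdj (K : C_c(G, B)) : C_c(G, B) :=
  ccMk (fun g => star (actB g (K g⁻¹)))
    ((continuous_id.actB (K.continuous.comp continuous_inv)).star)
    (HasCompactSupport.intro (K.hasCompactSupport.isCompact.image continuous_inv) fun g hg => by
      have : g⁻¹ ∉ tsupport K := fun h => hg ⟨g⁻¹, h, inv_inv g⟩
      rw [cc_apply_eq_zero K this, map_zero, star_zero])

theorem ccAdj_apply (K : C_c(G, B)) (g : G) : ccAdj K g = star (actB g (K g⁻¹)) := rfl

theorem actB_integral (g : G) (f : C_c(G, B)) : actB g (∫ h, f h ∂μ) = ∫ h, actB g (f h) ∂μ := by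
  let L : B →L[ℂ] B := LinearMap.mkContinuous
    { toFun := fun b => actB g b
      map_add' := map_add _
      map_smul' := fun c b => map_smul (actB g) c b } 1 fun b => by
        rw [one_mul]; exact (norm_actB g b).le
  exact (L.integral_comp_comm (cc_integrable μ f)).symm

theorem mul_integral_cc (b : B) (f : C_c(G, B)) : b * (∫ h, f h ∂μ) = ∫ h, b * f h ∂μ :=
  ((ContinuousLinearMap.mul ℂ B b).integral_comp_comm (cc_integrable μ f)).symm

theorem integral_mul_cc (b : B) (f : C_c(G, B)) : (∫ h, f h ∂μ) * b = ∫ h, f h * b ∂μ :=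
  (((ContinuousLinearMap.mul ℂ B).flip b).integral_comp_comm (cc_integrable μ f)).symm

theorem star_integral_cc (f : C_c(G, B)) : star (∫ h, f h ∂μ) = ∫ h, star (f h) ∂μ :=
  ((starL' ℝ (A := B)).integral_comp_comm fun h => f h).symm

/-- The slice `h ↦ u g h` of a compactly supported continuous function. -/
def ccSlice {E : Type*} [Zero E] [TopologicalSpace E] (u : G → G → E) (hu : Continuous u.uncurry)
    (hs : HasCompactSupport u.uncurry) (g : G) : C_c(G, E) :=
  ccMk (fun h => u g h) (hu.comp (continuous_const.prodMk continuous_id))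
    (HasCompactSupport.intro (IsCompact.image hs continuous_snd) fun h hh => by
      by_contra h0
      exact hh ⟨(g, h), subset_tsupport _ h0, rfl⟩)

theorem rhoCc_comp (K L f : C_c(G, B)) :
    rhoCc μ K (rhoCc μ L f) = rhoCc μ (ccConv μ K L) f := by
  refine cc_ext fun g => ?_
  have hK := K.continuous
  have hL := L.continuous
  have hf := f.continuous
  have hc : Continuous (Function.uncurry fun h s : G =>
      actB g (K (g⁻¹ * h)) * (actB h (L (h⁻¹ * s)) * f s)) := by
    refine Continuous.mul ?_ ?_
    · exact continuous_const.actB (hK.comp (continuous_const.mul continuous_fst))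
    · exact (continuous_fst.actB (hL.comp (continuous_fst.inv.mul continuous_snd))).mul
        (hf.comp continuous_snd)
  have hs : HasCompactSupport (Function.uncurry fun h s : G =>
      actB g (K (g⁻¹ * h)) * (actB h (L (h⁻¹ * s)) * f s)) :=
    hasCompactSupport_rho L f _ (fun g h h0 => by rw [h0, mul_zero, mul_zero])
      (fun g h h0 => by rw [h0, map_zero, zero_mul, mul_zero])
  have e1 : rhoCc μ K (rhoCc μ L f) g =
      ∫ h, ∫ s, actB g (K (g⁻¹ * h)) * (actB h (L (h⁻¹ * s)) * f s) ∂μ ∂μ := by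
    rw [rhoCc_apply]
    refine integral_congr_ae (Eventually.of_forall fun h => ?_)
    exact mul_integral_cc μ _ (ccSlice (fun h s => actB h (L (h⁻¹ * s)) * f s)
      ((continuous_fst.actB (hL.comp (continuous_fst.inv.mul continuous_snd))).mul
        (hf.comp continuous_snd))
      (hasCompactSupport_rho L f _ (fun g h h0 => by rw [h0, mul_zero])
        (fun g h h0 => by rw [h0, map_zero, zero_mul])) h)
  rw [e1, integral_integral_swap_of_hasCompactSupport hc hs, rhoCc_apply]
  refine integral_congr_ae (Eventually.of_forall fun s => ?_)
  change ∫ h, actB g (K (g⁻¹ * h)) * (actB h (L (h⁻¹ * s)) * f s) ∂μ =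
    actB g (ccConv μ K L (g⁻¹ * s)) * f s
  have hc2 : Continuous (Function.uncurry fun x h : G => K h * actB h (L (h⁻¹ * x))) :=
    (hK.comp continuous_snd).mul
        (continuous_snd.actB (hL.comp (continuous_snd.inv.mul continuous_fst)))
  have hs2 : HasCompactSupport (Function.uncurry fun x h : G => K h * actB h (L (h⁻¹ * x))) :=
    hasCompactSupport_conv K L _ (fun g h h0 => by rw [h0, zero_mul])
      (fun g h h0 => by rw [h0, map_zero, mul_zero])
  let v : C_c(G, B) := ccSlice _ hc2 hs2 (g⁻¹ * s)
  have e2 : actB g (ccConv μ K L (g⁻¹ * s)) * f s = ∫ h, actB g (v h) * f s ∂μ := by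
    have e3 : actB g (ccConv μ K L (g⁻¹ * s)) = ∫ h, actB g (v h) ∂μ := actB_integral μ g v
    rw [e3]
    exact integral_mul_cc μ (f s) (ccMk (fun h => actB g (v h))
      (continuous_const.actB v.continuous)
      (hasCompactSupport_of_left v _ fun h h0 => by rw [h0, map_zero]))
  rw [e2, ← integral_mul_left_eq_self (fun h => actB g (v h) * f s) g⁻¹]
  refine integral_congr_ae (Eventually.of_forall fun h => ?_)
  change actB g (K (g⁻¹ * h)) * (actB h (L (h⁻¹ * s)) * f s) =
    actB g (K (g⁻¹ * h) * actB (g⁻¹ * h) (L ((g⁻¹ * h)⁻¹ * (g⁻¹ * s)))) * f s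
  have e4 : (g⁻¹ * h)⁻¹ * (g⁻¹ * s) = h⁻¹ * s := by group
  rw [e4, map_mul (actB g), ← actB_mul, mul_inv_cancel_left, mul_assoc]

theorem ip_rhoCc (K f k : C_c(G, B)) :
    ip B (toL2 μ (rhoCc μ K f)) (toL2 μ k) = ip B (toL2 μ f) (toL2 μ (rhoCc μ (ccAdj K) k)) := by
  have hK := K.continuous
  have hf := f.continuous
  have hk := k.continuous
  rw [ip_toL2, ip_toL2]
  have hcu : ∀ (K f : C_c(G, B)),
      Continuous (Function.uncurry fun g h : G => actB g (K (g⁻¹ * h)) * f h) := fun K f =>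
    (continuous_fst.actB (K.continuous.comp (continuous_fst.inv.mul continuous_snd))).mul
        (f.continuous.comp continuous_snd)
  have hsu : ∀ (K f : C_c(G, B)),
      HasCompactSupport (Function.uncurry fun g h : G => actB g (K (g⁻¹ * h)) * f h) := fun K f =>
    hasCompactSupport_rho K f _ (fun g h h0 => by rw [h0, mul_zero])
      (fun g h h0 => by rw [h0, map_zero, zero_mul])
  have e1 : ∀ g, star (rhoCc μ K f g) * k g =
      ∫ h, star (actB g (K (g⁻¹ * h)) * f h) * k g ∂μ := by
    intro g
    let v := ccSlice _ (hcu K f) (hsu K f) g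
    have e2 : star (rhoCc μ K f g) = ∫ h, star (v h) ∂μ := star_integral_cc μ v
    rw [e2]
    exact integral_mul_cc μ (k g) (ccMk (fun h => star (v h)) v.continuous.star
      (hasCompactSupport_of_left v _ fun h h0 => by rw [h0, star_zero]))
  have e3 : ∀ g, star (f g) * rhoCc μ (ccAdj K) k g =
      ∫ h, star (f g) * (actB g (ccAdj K (g⁻¹ * h)) * k h) ∂μ := by
    intro g
    exact mul_integral_cc μ (star (f g)) (ccSlice _ (hcu (ccAdj K) k) (hsu (ccAdj K) k) g)
  simp only [e1, e3]
  have hc : Continuous (Function.uncurry fun g h : G =>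
      star (actB g (K (g⁻¹ * h)) * f h) * k g) :=
    ((hcu K f).star).mul (hk.comp continuous_fst)
  have hs : HasCompactSupport (Function.uncurry fun g h : G =>
      star (actB g (K (g⁻¹ * h)) * f h) * k g) :=
    hasCompactSupport_rho K f _ (fun g h h0 => by rw [h0, mul_zero, star_zero, zero_mul])
      (fun g h h0 => by rw [h0, map_zero, zero_mul, star_zero, zero_mul])
  rw [integral_integral_swap_of_hasCompactSupport hc hs]
  refine integral_congr_ae (Eventually.of_forall fun h => integral_congr_ae
    (Eventually.of_forall fun g => ?_))
  change star (actB g (K (g⁻¹ * h)) * f h) * k g =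
    star (f h) * (actB h (star (actB (h⁻¹ * g) (K (h⁻¹ * g)⁻¹))) * k g)
  rw [map_star, ← actB_mul, mul_inv_cancel_left, star_mul, mul_assoc, mul_inv_rev, inv_inv]

/-- `T` is the operator `ρ_K` on `L²(G, B)`, that is, `T f = ρ_K f` for all `f` in `C_c(G, B)`. -/
def IsLaurent (K : C_c(G, B)) (T : L2 μ B →L[ℂ] L2 μ B) : Prop :=
  ∀ f : C_c(G, B), T (toL2 μ f) = toL2 μ (rhoCc μ K f)

theorem IsLaurent.comp {K L : C_c(G, B)} {T S : L2 μ B →L[ℂ] L2 μ B} (hT : IsLaurent μ K T)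
    (hS : IsLaurent μ L S) : IsLaurent μ (ccConv μ K L) (T.comp S) := fun f => by
  rw [ContinuousLinearMap.comp_apply, hS, hT, rhoCc_comp]

theorem IsLaurent.adj {K : C_c(G, B)} {T S : L2 μ B →L[ℂ] L2 μ B} (hT : IsLaurent μ K T)
    (hS : IsAdjointPair B T S) : IsLaurent μ (ccAdj K) S := fun f =>
  eq_of_forall_ip_toL2 μ fun k => by rw [← hS, hT, ip_rhoCc]

theorem IsLaurent.add {K L : C_c(G, B)} {T S : L2 μ B →L[ℂ] L2 μ B} (hT : IsLaurent μ K T)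
    (hS : IsLaurent μ L S) : IsLaurent μ (K + L) (T + S) := fun f => by
  rw [_root_.add_apply, hT, hS, ← map_add]
  congr 1
  refine cc_ext fun g => ?_
  change rhoCc μ K f g + rhoCc μ L f g = _
  rw [rhoCc_apply, rhoCc_apply, rhoCc_apply, ← integral_add]
  · refine integral_congr_ae (Eventually.of_forall fun h => ?_)
    change _ = actB g (K (g⁻¹ * h) + L (g⁻¹ * h)) * f h
    rw [map_add, add_mul]
  · exact cc_integrable μ (ccMk (fun h => actB g (K (g⁻¹ * h)) * f h)
      ((continuous_const.actB (K.continuous.comp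
      (continuous_const.mul continuous_id))).mul f.continuous)
      (hasCompactSupport_of_left f _ fun h h0 => by rw [h0, mul_zero]))
  · exact cc_integrable μ (ccMk (fun h => actB g (L (g⁻¹ * h)) * f h)
      ((continuous_const.actB (L.continuous.comp
      (continuous_const.mul continuous_id))).mul f.continuous)
      (hasCompactSupport_of_left f _ fun h h0 => by rw [h0, mul_zero]))

theorem IsLaurent.smul (c : ℂ) {K : C_c(G, B)} {T : L2 μ B →L[ℂ] L2 μ B} (hT : IsLaurent μ K T) :
    IsLaurent μ (c • K) (c • T) := fun f => by
  rw [_root_.smul_apply, hT, ← map_smul]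
  congr 1
  refine cc_ext fun g => ?_
  change c • rhoCc μ K f g = _
  rw [rhoCc_apply, rhoCc_apply, ← integral_smul]
  refine integral_congr_ae (Eventually.of_forall fun h => ?_)
  change _ = actB g (c • K (g⁻¹ * h)) * f h
  rw [map_smul, smul_mul_assoc]

theorem isLaurent_zero : IsLaurent μ (0 : C_c(G, B)) 0 := fun f => by
  rw [_root_.zero_apply, ← map_zero (toL2 μ)]
  congr 1
  refine cc_ext fun g => ?_
  rw [rhoCc_apply]
  change 0 = ∫ h, actB g (0 : B) * f h ∂μ
  simp

variable (B) in
/-- The *-algebra `ρ(C_c(G, B))` of adjointable operators on `L²(G, B)`. -/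
def laurentAlg : NonUnitalStarSubalgebra ℂ (AdjAlg B (L2 μ B)) where
  carrier := {T | ∃ K : C_c(G, B), IsLaurent μ K T.1}
  mul_mem' := by
    rintro T S ⟨K, hK⟩ ⟨L, hL⟩
    exact ⟨_, hK.comp μ hL⟩
  add_mem' := by
    rintro T S ⟨K, hK⟩ ⟨L, hL⟩
    exact ⟨_, hK.add μ hL⟩
  zero_mem' := ⟨0, isLaurent_zero μ⟩
  smul_mem' := by
    rintro c T ⟨K, hK⟩
    exact ⟨_, hK.smul μ c⟩
  star_mem' := by
    rintro T ⟨K, hK⟩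
    exact ⟨_, hK.adj μ T.isAdjointPair⟩

/-- The reduced crossed product `C*_r(G, B)`: the norm closure of `ρ(C_c(G, B))` in the C*-algebra
of adjointable operators on `L²(G, B)`. -/
def reducedCrossedProduct (μ : Measure G) [μ.IsHaarMeasure] (B : Type*) [NonUnitalCStarAlgebra B]
    [GCStarAlgebra G B] : NonUnitalStarSubalgebra ℂ (AdjAlg B (L2 μ B)) :=
  (laurentAlg μ B).topologicalClosure

instance isClosed_reducedCrossedProduct :
    IsClosed (reducedCrossedProduct μ B : Set (AdjAlg B (L2 μ B))) :=
  NonUnitalStarSubalgebra.isClosed_topologicalClosure _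

/-- The reduced crossed product as a C*-algebra. -/
def Cr (μ : Measure G) [μ.IsHaarMeasure] (B : Type*) [NonUnitalCStarAlgebra B]
    [GCStarAlgebra G B] : Type _ := reducedCrossedProduct μ B

instance : NonUnitalCStarAlgebra (Cr μ B) :=
  inferInstanceAs (NonUnitalCStarAlgebra (reducedCrossedProduct μ B))

end CrossedProduct

/-! ### Multipliers of the reduced crossed product -/

section Multipliers

open UniformSpace

variable {G : Type*} [Group G] [TopologicalSpace G] [IsTopologicalGroup G] [T2Space G]
  [MeasurableSpace G] [BorelSpace G] (μ : Measure G) [μ.IsHaarMeasure]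
  {B : Type*} [NonUnitalCStarAlgebra B]

/-- A C*-algebra `B` is a Hilbert `B`-module with `⟨a, b⟩ = a* b`. -/
instance selfInnerModule : InnerModule B B where
  inner a b := star a * b
  rsmul a b := a * b
  add_rsmul := add_mul
  smul_rsmul c a b := smul_mul_assoc c a b
  rsmul_add := mul_add
  rsmul_smul c a b := mul_smul_comm c a b
  rsmul_mul a b c := (mul_assoc a b c).symm
  inner_add_right a b c := mul_add _ _ _
  inner_smul_right c a b := mul_smul_comm c _ b
  inner_rsmul_right a b c := (mul_assoc _ _ _).symm
  star_inner a b := by rw [star_mul, star_star]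
  inner_self_nonneg a := ⟨a, rfl⟩
  norm_sq_eq a := by
    change ‖a‖ ^ 2 = ‖star a * a‖
    rw [CStarRing.norm_star_mul_self, pow_two]

theorem AdjAlg.ext_toL2 {T S : AdjAlg B (L2 μ B)} (h : ∀ f, T.1 (toL2 μ f) = S.1 (toL2 μ f)) :
    T = S :=
  Subtype.ext (ContinuousLinearMap.ext fun x => by
    induction x using (denseRange_toL2 μ).induction_on with
    | hp => exact isClosed_eq (ContinuousLinearMap.continuous _) (ContinuousLinearMap.continuous _)
    | ih f => exact h f)

/-- A linear operator on `C_c(G, B)` that has an adjoint and is bounded for the norm of `L²(G, B)`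
extends to an adjointable operator on `L²(G, B)`. -/
theorem exists_adjAlg (t s : C_c(G, B) →ₗ[ℂ] C_c(G, B)) (ct cs : ℝ)
    (hts : ∀ f k, ip B (toL2 μ (t f)) (toL2 μ k) = ip B (toL2 μ f) (toL2 μ (s k)))
    (ht : ∀ f, ‖toL2 μ (t f)‖ ≤ ct * ‖toL2 μ f‖) (hs : ∀ f, ‖toL2 μ (s f)‖ ≤ cs * ‖toL2 μ f‖) :
    ∃ T : AdjAlg B (L2 μ B), ∀ f, T.1 (toL2 μ f) = toL2 μ (t f) := by
  have key : ∀ (t : C_c(G, B) →ₗ[ℂ] C_c(G, B)) (ct : ℝ),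
      (∀ f, ‖toL2 μ (t f)‖ ≤ ct * ‖toL2 μ f‖) →
      ∃ T : L2 μ B →L[ℂ] L2 μ B, ∀ f, T (toL2 μ f) = toL2 μ (t f) := by
    intro t ct ht
    have hn : ∀ f : C_c(G, B), ‖toL2 μ f‖ = ‖(id f : PreL2 μ B)‖ := fun f => Completion.norm_coe _
    let t' : PreL2 μ B →ₗ[ℂ] PreL2 μ B := t
    let T : PreL2 μ B →L[ℂ] PreL2 μ B := LinearMap.mkContinuous t' ct fun f => by
      have h1 := ht f
      have h2 := hn (t f)
      have h3 := hn f
      exact (h2.symm.le.trans h1).trans_eq (congrArg (ct * ·) h3)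
    exact ⟨T.completion, fun f => T.completion_apply_coe f⟩
  obtain ⟨T, hT⟩ := key t ct ht
  obtain ⟨S, hS⟩ := key s cs hs
  refine ⟨⟨T, S, fun x y => ?_⟩, hT⟩
  induction x using (denseRange_toL2 μ).induction_on with
  | hp => exact isClosed_eq (T.continuous.ip continuous_const) (continuous_id.ip continuous_const)
  | ih f =>
    induction y using (denseRange_toL2 μ).induction_on with
    | hp => exact isClosed_eq (continuous_const.ip continuous_id) (continuous_const.ip S.continuous)
    | ih k => rw [hT, hS, hts]

variable [GCStarAlgebra G B]

/-- `(ρ_b f)(g) = β_g(b) f(g)`. -/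
def ccRhoB (b : B) : C_c(G, B) →ₗ[ℂ] C_c(G, B) where
  toFun f := ccMk (fun g => actB g b * f g)
    ((continuous_id.actB continuous_const).mul f.continuous)
    (hasCompactSupport_of_left f _ fun g h => by rw [h, mul_zero])
  map_add' f k := cc_ext fun g => mul_add (actB g b) (f g) (k g)
  map_smul' c f := cc_ext fun g => mul_smul_comm c (actB g b) (f g)

theorem ccRhoB_apply (b : B) (f : C_c(G, B)) (g : G) : ccRhoB b f g = actB g b * f g := rfl

theorem norm_ccRhoB_le (b : B) (f : C_c(G, B)) : ‖toL2 μ (ccRhoB b f)‖ ≤ ‖b‖ * ‖toL2 μ f‖ := by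
  let _ := CStarAlgebra.spectralOrder B
  have _ := CStarAlgebra.spectralOrderedRing B
  refine abs_le_of_sq_le_sq' ?_ (by positivity) |>.2
  rw [mul_pow, norm_sq_ip B (toL2 μ (ccRhoB b f)), norm_sq_ip B (toL2 μ f), ip_toL2, ip_toL2]
  have h1 : ∀ g, star (ccRhoB b f g) * ccRhoB b f g ≤ (‖b‖ ^ 2) • (star (f g) * f g) := by
    intro g
    have h2 : star (ccRhoB b f g) * ccRhoB b f g =
        star (f g) * (star (actB g b) * actB g b) * f g := by
      rw [ccRhoB_apply, star_mul]; simp only [mul_assoc]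
    rw [h2]
    refine (CStarAlgebra.star_left_conjugate_le_norm_smul
      (hb := IsSelfAdjoint.star_mul_self (actB g b))).trans_eq ?_
    rw [CStarRing.norm_star_mul_self, norm_actB, pow_two]
  have h3 : ∫ g, star (ccRhoB b f g) * ccRhoB b f g ∂μ ≤
      ∫ g, (‖b‖ ^ 2) • (star (f g) * f g) ∂μ :=
    integral_mono (cc_integrable μ (ccStarMul (ccRhoB b f) (ccRhoB b f)))
      ((cc_integrable μ (ccStarMul f f)).smul (‖b‖ ^ 2)) h1
  rw [integral_smul] at h3
  refine (CStarAlgebra.norm_le_norm_of_nonneg_of_le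
    (integral_nonneg fun g => star_mul_self_nonneg _) h3).trans_eq ?_
  rw [norm_smul, Real.norm_of_nonneg (by positivity)]

theorem ip_ccRhoB (b : B) (f k : C_c(G, B)) :
    ip B (toL2 μ (ccRhoB b f)) (toL2 μ k) = ip B (toL2 μ f) (toL2 μ (ccRhoB (star b) k)) := by
  rw [ip_toL2, ip_toL2]
  refine integral_congr_ae (Eventually.of_forall fun g => ?_)
  change star (ccRhoB b f g) * k g = star (f g) * ccRhoB (star b) k g
  rw [ccRhoB_apply, ccRhoB_apply, star_mul, map_star, mul_assoc]

theorem exists_rhoB (b : B) :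
    ∃ T : AdjAlg B (L2 μ B), ∀ f, T.1 (toL2 μ f) = toL2 μ (ccRhoB b f) :=
  exists_adjAlg μ (ccRhoB b) (ccRhoB (star b)) ‖b‖ ‖star b‖ (ip_ccRhoB μ b) (norm_ccRhoB_le μ b)
    (norm_ccRhoB_le μ (star b))

/-- The operator `ρ_b` on `L²(G, B)`, `(ρ_b f)(g) = β_g(b) f(g)`. -/
def rhoB (b : B) : AdjAlg B (L2 μ B) := (exists_rhoB μ b).choose

theorem rhoB_toL2 (b : B) (f : C_c(G, B)) : (rhoB μ b).1 (toL2 μ f) = toL2 μ (ccRhoB b f) :=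
  (exists_rhoB μ b).choose_spec f

theorem rhoB_add (b b' : B) : rhoB μ (b + b') = rhoB μ b + rhoB μ b' :=
  AdjAlg.ext_toL2 μ fun f => by
    change _ = (rhoB μ b).1 (toL2 μ f) + (rhoB μ b').1 (toL2 μ f)
    rw [rhoB_toL2, rhoB_toL2, rhoB_toL2, ← map_add]
    congr 1
    refine cc_ext fun g => ?_
    change _ = ccRhoB b f g + ccRhoB b' f g
    rw [ccRhoB_apply, ccRhoB_apply, ccRhoB_apply, map_add, add_mul]

theorem rhoB_smul (c : ℂ) (b : B) : rhoB μ (c • b) = c • rhoB μ b :=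
  AdjAlg.ext_toL2 μ fun f => by
    change _ = c • (rhoB μ b).1 (toL2 μ f)
    rw [rhoB_toL2, rhoB_toL2, ← map_smul]
    congr 1
    refine cc_ext fun g => ?_
    change _ = c • ccRhoB b f g
    rw [ccRhoB_apply, ccRhoB_apply, map_smul, smul_mul_assoc]

theorem rhoB_mul (b b' : B) : rhoB μ (b * b') = rhoB μ b * rhoB μ b' :=
  AdjAlg.ext_toL2 μ fun f => by
    change _ = (rhoB μ b).1 ((rhoB μ b').1 (toL2 μ f))
    rw [rhoB_toL2, rhoB_toL2, rhoB_toL2]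
    congr 1
    refine cc_ext fun g => ?_
    rw [ccRhoB_apply, ccRhoB_apply, ccRhoB_apply, map_mul, mul_assoc]

theorem rhoB_star (b : B) : rhoB μ (star b) = star (rhoB μ b) :=
  AdjAlg.ext_toL2 μ fun f => eq_of_forall_ip_toL2 μ fun k => by
    rw [rhoB_toL2, ← (rhoB μ b).isAdjointPair, rhoB_toL2, ip_ccRhoB]

/-- `(ρ_h f)(g) = f(g h)`. -/
def ccRhoG (h : G) : C_c(G, B) →ₗ[ℂ] C_c(G, B) where
  toFun f := ccMk (fun g => f (g * h)) (f.continuous.comp (continuous_mul_const h))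
    (f.hasCompactSupport.comp_homeomorph (Homeomorph.mulRight h))
  map_add' _ _ := cc_ext fun _ => rfl
  map_smul' _ _ := cc_ext fun _ => rfl

theorem ccRhoG_apply (h : G) (f : C_c(G, B)) (g : G) : ccRhoG h f g = f (g * h) := rfl

variable [LocallyCompactSpace G] [μ.Regular]

theorem exists_integral_mul_right (h : G) : ∃ c : ℝ, 0 ≤ c ∧ ∀ f : C_c(G, B),
    ∫ g, f (g * h) ∂μ = c • ∫ g, f g ∂μ := by
  have hreg : (Measure.map (· * h) μ).Regular :=
    Measure.Regular.map (Homeomorph.mulRight h)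
  refine ⟨Measure.haarScalarFactor (Measure.map (· * h) μ) μ, NNReal.coe_nonneg _, fun f => ?_⟩
  have h1 := Measure.isMulLeftInvariant_eq_smul_of_regular (Measure.map (· * h) μ) μ
  have h2 : ∫ g, f g ∂(Measure.map (· * h) μ) = ∫ g, f (g * h) ∂μ :=
    (Homeomorph.mulRight h).measurableEmbedding.integral_map f
  rw [← h2]
  nth_rw 1 [h1]
  rw [integral_smul_nnreal_measure]
  rfl

theorem exists_rhoG (h : G) :
    ∃ T : AdjAlg B (L2 μ B), ∀ f, T.1 (toL2 μ f) = toL2 μ (ccRhoG h f) := by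
  have key : ∀ h : G, ∃ c : ℝ, 0 ≤ c ∧ ∀ f k : C_c(G, B),
      ip B (toL2 μ (ccRhoG h f)) (toL2 μ k) = c • ip B (toL2 μ f) (toL2 μ (ccRhoG h⁻¹ k)) := by
    intro h
    obtain ⟨c, hc, hint⟩ := exists_integral_mul_right (B := B) μ h
    refine ⟨c, hc, fun f k => ?_⟩
    have := hint (ccStarMul f (ccRhoG h⁻¹ k))
    rw [ip_toL2, ip_toL2]
    refine Eq.trans ?_ this
    refine integral_congr_ae (Eventually.of_forall fun g => ?_)
    change star (f (g * h)) * k g = star (f (g * h)) * k (g * h * h⁻¹)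
    rw [mul_inv_cancel_right]
  have bound : ∀ h : G, ∃ c : ℝ, ∀ f : C_c(G, B), ‖toL2 μ (ccRhoG h f)‖ ≤ c * ‖toL2 μ f‖ := by
    intro h
    obtain ⟨c, hc, hcc⟩ := key h
    refine ⟨√c, fun f => abs_le_of_sq_le_sq' ?_ (by positivity) |>.2⟩
    have e : ccRhoG h⁻¹ (ccRhoG h f) = f := cc_ext fun g => by
      rw [ccRhoG_apply, ccRhoG_apply, inv_mul_cancel_right]
    rw [mul_pow, Real.sq_sqrt hc, norm_sq_ip B (toL2 μ (ccRhoG h f)), norm_sq_ip B (toL2 μ f), hcc, e, norm_smul,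
      Real.norm_of_nonneg hc]
  obtain ⟨c, hc, hcc⟩ := key h
  obtain ⟨c1, h1⟩ := bound h
  obtain ⟨c2, h2⟩ := bound h⁻¹
  refine exists_adjAlg μ (ccRhoG h) ((c : ℂ) • ccRhoG h⁻¹) c1 (c * c2) (fun f k => ?_) h1
    (fun f => ?_)
  · rw [hcc, LinearMap.smul_apply, map_smul, ip_smul_right]
    exact (Complex.coe_smul (E := B) c _).symm
  · rw [LinearMap.smul_apply, map_smul, norm_smul, Complex.norm_of_nonneg hc, mul_assoc]
    exact mul_le_mul_of_nonneg_left (h2 f) hc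

/-- The operator `ρ_h` on `L²(G, B)`, `(ρ_h f)(g) = f(g h)`. -/
def rhoG (h : G) : AdjAlg B (L2 μ B) := (exists_rhoG μ h).choose

theorem rhoG_toL2 (h : G) (f : C_c(G, B)) :
    (rhoG μ h : AdjAlg B (L2 μ B)).1 (toL2 μ f) = toL2 μ (ccRhoG h f) :=
  (exists_rhoG μ h).choose_spec f

theorem mul_mem_reducedCrossedProduct {M : AdjAlg B (L2 μ B)}
    (hM : ∀ T ∈ laurentAlg μ B, M * T ∈ laurentAlg μ B) {T : AdjAlg B (L2 μ B)}
    (hT : T ∈ reducedCrossedProduct μ B) : M * T ∈ reducedCrossedProduct μ B :=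
  map_mem_closure (f := fun T => M * T) (continuous_const_mul M) hT hM

theorem rhoB_mul_mem (b : B) {T : AdjAlg B (L2 μ B)} (hT : T ∈ reducedCrossedProduct μ B) :
    rhoB μ b * T ∈ reducedCrossedProduct μ B := by
  refine mul_mem_reducedCrossedProduct μ ?_ hT
  rintro T ⟨K, hK⟩
  refine ⟨ccMk (fun g => b * K g) (continuous_const.mul K.continuous)
    (hasCompactSupport_of_left K _ fun g h => by rw [h, mul_zero]), fun f => ?_⟩
  change (rhoB μ b).1 (T.1 (toL2 μ f)) = _
  rw [hK, rhoB_toL2]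
  congr 1
  refine cc_ext fun g => ?_
  rw [ccRhoB_apply, rhoCc_apply, rhoCc_apply]
  refine (mul_integral_cc μ (actB g b) (ccMk (fun h => actB g (K (g⁻¹ * h)) * f h)
    ((continuous_const.actB (K.continuous.comp (continuous_const.mul continuous_id))).mul
      f.continuous) (hasCompactSupport_of_left f _ fun h h0 => by rw [h0, mul_zero]))).trans ?_
  refine integral_congr_ae (Eventually.of_forall fun h => ?_)
  change actB g b * (actB g (K (g⁻¹ * h)) * f h) = actB g (b * K (g⁻¹ * h)) * f h
  rw [map_mul (actB g), mul_assoc]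

theorem rhoG_mul_mem (h : G) {T : AdjAlg B (L2 μ B)} (hT : T ∈ reducedCrossedProduct μ B) :
    rhoG μ h * T ∈ reducedCrossedProduct μ B := by
  refine mul_mem_reducedCrossedProduct μ ?_ hT
  rintro T ⟨K, hK⟩
  refine ⟨ccMk (fun g => actB h (K (h⁻¹ * g)))
    (continuous_const.actB (K.continuous.comp (continuous_const_mul _)))
    (HasCompactSupport.intro (K.hasCompactSupport.isCompact.image (continuous_const_mul h))
      fun g hg => ?_), fun f => ?_⟩
  · have : h⁻¹ * g ∉ tsupport K := fun h' => hg ⟨h⁻¹ * g, h', by simp⟩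
    rw [cc_apply_eq_zero K this, map_zero]
  change (rhoG μ h : AdjAlg B (L2 μ B)).1 (T.1 (toL2 μ f)) = _
  rw [hK, rhoG_toL2]
  congr 1
  refine cc_ext fun g => ?_
  rw [ccRhoG_apply, rhoCc_apply, rhoCc_apply]
  refine integral_congr_ae (Eventually.of_forall fun s => ?_)
  change actB (g * h) (K ((g * h)⁻¹ * s)) * f s = actB g (actB h (K (h⁻¹ * (g⁻¹ * s)))) * f s
  rw [actB_mul, mul_inv_rev, mul_assoc]

/-- Left multiplication by `ρ_h` on the reduced crossed product. -/
def crLeftG (h : G) (x : Cr μ B) : Cr μ B := ⟨rhoG μ h * x.1, rhoG_mul_mem μ h x.2⟩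

/-- Left multiplication by `ρ_b` on the reduced crossed product as a continuous linear map. -/
def crLeftBL (b : B) : Cr μ B →L[ℂ] Cr μ B :=
  LinearMap.mkContinuous
    { toFun := fun x => ⟨rhoB μ b * x.1, rhoB_mul_mem μ b x.2⟩
      map_add' := fun x y => Subtype.ext (mul_add (rhoB μ b) x.1 y.1)
      map_smul' := fun c x => Subtype.ext (mul_smul_comm c (rhoB μ b) x.1) } ‖rhoB μ b‖
    fun x => norm_mul_le (rhoB μ b) x.1

theorem crLeftBL_isAdjointPair (b : B) :
    IsAdjointPair (E := Cr μ B) (F := Cr μ B) (Cr μ B) (crLeftBL μ b : Cr μ B →L[ℂ] Cr μ B)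
      (crLeftBL μ (star b)) := fun x y => Subtype.ext (by
  change star (rhoB μ b * x.1) * y.1 = star x.1 * (rhoB μ (star b) * y.1)
  rw [star_mul, rhoB_star, mul_assoc])

/-- Left multiplication by `ρ_b` as an element of the adjointable operators. -/
def crLeftAdj (b : B) : AdjAlg (Cr μ B) (Cr μ B) :=
  ⟨crLeftBL μ b, (crLeftBL_isAdjointPair μ b).isAdjointable⟩

theorem crLeftAdj_star (b : B) : crLeftAdj μ (star b) = star (crLeftAdj μ b) :=
  (AdjAlg.star_eq (T := crLeftAdj μ b) (S := crLeftAdj μ (star b))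
    (crLeftBL_isAdjointPair μ b)).symm

variable (B) in
/-- The canonical *-homomorphism from `B` to the multipliers of the reduced crossed product,
`b ↦ (x ↦ ρ_b x)`. -/
def crLeftB : B →⋆ₙₐ[ℂ] AdjAlg (Cr μ B) (Cr μ B) where
  toFun := crLeftAdj μ
  map_smul' c b := Subtype.ext (ContinuousLinearMap.ext fun x => Subtype.ext (by
    change rhoB μ (c • b) * x.1 = c • (rhoB μ b * x.1)
    rw [rhoB_smul, smul_mul_assoc]))
  map_zero' := Subtype.ext (ContinuousLinearMap.ext fun x => Subtype.ext (by
    change rhoB μ 0 * x.1 = 0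
    rw [← zero_smul ℂ (0 : B), rhoB_smul, zero_smul, zero_mul]))
  map_add' b b' := Subtype.ext (ContinuousLinearMap.ext fun x => Subtype.ext (by
    change rhoB μ (b + b') * x.1 = rhoB μ b * x.1 + rhoB μ b' * x.1
    rw [rhoB_add, add_mul]))
  map_mul' b b' := Subtype.ext (ContinuousLinearMap.ext fun x => Subtype.ext (by
    change rhoB μ (b * b') * x.1 = rhoB μ b * (rhoB μ b' * x.1)
    rw [rhoB_mul, mul_assoc]))
  map_star' := crLeftAdj_star μ

/-- The Hilbert module `C*_r(G, E) = E ⊗_B C*_r(G, B)` over `C*_r(G, B)`. -/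
abbrev CrMod (μ : Measure G) [μ.IsHaarMeasure] [μ.Regular] (B E : Type*) [NonUnitalCStarAlgebra B]
    [GCStarAlgebra G B] [NormedAddCommGroup E] [NormedSpace ℂ E] [InnerModule B E] : Type _ :=
  InteriorTensor E (crLeftB μ B)

end Multipliers

/-! ### Square-integrable elements and relative continuity -/

section SquareIntegrable

variable {G : Type*} [Group G] [TopologicalSpace G] [IsTopologicalGroup G] [T2Space G]
  [MeasurableSpace G] [BorelSpace G] (μ : Measure G) [μ.IsHaarMeasure]
  {B : Type*} [NonUnitalCStarAlgebra B] [GCStarAlgebra G B]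
  {E : Type*} [NormedAddCommGroup E] [NormedSpace ℂ E] [CompleteSpace E] [InnerModule B E]
  [GInnerModule G B E]

/-- The function `g ↦ χ(g) ⟨γ_g(ξ), η⟩`. -/
def braTrunc (ξ η : E) (χ : C_c(G, ℝ)) : C_c(G, B) :=
  ccMk (fun g => χ g • ip B (actE B g ξ) η)
    (by
      have h1 : Continuous fun g : G => actE B g ξ := GInnerModule.continuous_act (B := B) ξ
      have h2 : Continuous fun g : G => ip B (actE B g ξ) η :=
        Continuous.ip (E := E) h1 continuous_const
      have h3 := χ.continuous
      exact h3.smul h2)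
    (HasCompactSupport.intro χ.hasCompactSupport fun g hg => by
      rw [cc_apply_eq_zero χ hg, zero_smul])

variable (G) in
/-- The filter along which functions `χ` in `C_c(G, ℝ)` with `0 ≤ χ ≤ 1` converge to `1` uniformly
on compact subsets of `G`. -/
def cutoffFilter : Filter C_c(G, ℝ) :=
  comap (fun χ : C_c(G, ℝ) => χ.toContinuousMap) (𝓝 (1 : C(G, ℝ))) ⊓
    𝓟 {χ : C_c(G, ℝ) | ∀ g, 0 ≤ χ g ∧ χ g ≤ 1}

variable (B) in
/-- `ξ` is square-integrable if for every `η` the function `g ↦ ⟨γ_g(ξ), η⟩` belongs to `L²(G, B)`: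
the functions `χ(g) ⟨γ_g(ξ), η⟩` converge in `L²(G, B)` as `χ → 1`. -/
def SquareIntegrable (ξ : E) : Prop :=
  ∀ η : E, ∃ F : L2 μ B, Tendsto (fun χ => toL2 μ (braTrunc ξ η χ)) (cutoffFilter G) (𝓝 F)

/-- `∫ γ_g(ξ) · f(g) dg` for `f` in `C_c(G, B)`. -/
def ketFun (ξ : E) (f : C_c(G, B)) : E := ∫ g, rs (actE B g ξ) (f g) ∂μ

/-- `T` is an adjointable operator `L²(G, B) → E` with `T f = ∫ γ_g(ξ) · f(g) dg` for all `f` in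
`C_c(G, B)`. -/
def IsKet (ξ : E) (T : L2 μ B →L[ℂ] E) : Prop :=
  IsAdjointable B T ∧ ∀ f : C_c(G, B), T (toL2 μ f) = ketFun μ ξ f

variable (B) in
open Classical in
/-- The adjointable operator `|ξ⟩⟩ : L²(G, B) → E`, `f ↦ ∫ γ_g(ξ) · f(g) dg`. It exists if `ξ` is
square-integrable; if there is no such operator, the value is `0`. -/
def ket (ξ : E) : L2 μ B →L[ℂ] E := if h : ∃ T, IsKet μ ξ T then h.choose else 0

theorem isAdjointable_ket (ξ : E) : IsAdjointable B (ket μ B ξ) := by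
  by_cases h : ∃ T : L2 μ B →L[ℂ] E, IsKet μ ξ T
  · rw [ket, dif_pos h]; exact h.choose_spec.1
  · rw [ket, dif_neg h]; exact isAdjointPair_zero.isAdjointable

variable (B) in
/-- A subset `R` of `E` is relatively continuous if its elements are square-integrable and
`⟨⟨ξ|η⟩⟩ = |ξ⟩⟩* |η⟩⟩` belongs to the reduced crossed product for all `ξ, η` in `R`. -/
def RelCont (R : Set E) : Prop :=
  (∀ ξ ∈ R, SquareIntegrable μ B ξ) ∧
    ∀ ξ ∈ R, ∀ η ∈ R, ∃ c : Cr μ B, c.1.1 = (adj B (ket μ B ξ)).comp (ket μ B η)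

variable (B) in
/-- The operators `|ξ⟩⟩` and `|ξ⟩⟩ x` for `ξ` in `R` and `x` in the reduced crossed product. -/
def ketSet (R : Set E) : Set (L2 μ B →L[ℂ] E) :=
  {T | ∃ ξ ∈ R, T = ket μ B ξ} ∪ {T | ∃ ξ ∈ R, ∃ x : Cr μ B, T = (ket μ B ξ).comp x.1.1}

variable (B) in
/-- The closed linear span of the operators `|ξ⟩⟩` and `|ξ⟩⟩ x` for `ξ` in `R` and `x` in the reduced
crossed product. -/
def ketSpan (R : Set E) : Submodule ℂ (L2 μ B →L[ℂ] E) :=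
  (Submodule.span ℂ (ketSet μ B R)).topologicalClosure

theorem mem_of_mem_ketSpan {R : Set E} {S : Submodule ℂ (L2 μ B →L[ℂ] E)}
    (hc : IsClosed (S : Set (L2 μ B →L[ℂ] E))) (h : ∀ T ∈ ketSet μ B R, T ∈ S)
    {T : L2 μ B →L[ℂ] E} (hT : T ∈ ketSpan μ B R) : T ∈ S :=
  Submodule.topologicalClosure_minimal _ (Submodule.span_le.2 h) hc hT

theorem subset_ketSpan (R : Set E) : ketSet μ B R ⊆ ketSpan μ B R :=
  Submodule.subset_span.trans (Submodule.le_topologicalClosure _)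

theorem isAdjointable_of_mem_ketSet {R : Set E} {T : L2 μ B →L[ℂ] E} (hT : T ∈ ketSet μ B R) :
    IsAdjointable B T := by
  rcases hT with ⟨ξ, _, rfl⟩ | ⟨ξ, _, x, rfl⟩
  · exact isAdjointable_ket μ ξ
  · exact (x.1.isAdjointPair.comp (isAdjointable_ket μ ξ).isAdjointPair).isAdjointable

theorem isAdjointable_of_mem_ketSpan {R : Set E} {T : L2 μ B →L[ℂ] E}
    (hT : T ∈ ketSpan μ B R) : IsAdjointable B T :=
  mem_of_mem_ketSpan μ (R := R)
    (S := { carrier := {T | IsAdjointable B T}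
            add_mem' := fun h h' => ⟨_, h.isAdjointPair.add h'.isAdjointPair⟩
            zero_mem' := ⟨_, isAdjointPair_zero⟩
            smul_mem' := fun c _ h => ⟨_, h.isAdjointPair.smul c⟩ })
    isClosed_isAdjointable (fun _ h => isAdjointable_of_mem_ketSet μ h) hT

theorem comp_mem_ketSpan {R : Set E} {T : L2 μ B →L[ℂ] E} (hT : T ∈ ketSpan μ B R) (x : Cr μ B) :
    T.comp x.1.1 ∈ ketSpan μ B R := by
  let L : (L2 μ B →L[ℂ] E) →L[ℂ] (L2 μ B →L[ℂ] E) :=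
    (ContinuousLinearMap.compL ℂ (L2 μ B) (L2 μ B) E).flip x.1.1
  refine mem_of_mem_ketSpan μ (R := R) (S := (ketSpan μ B R).comap L.toLinearMap)
    ((Submodule.isClosed_topologicalClosure _).preimage L.continuous) (fun T hT => ?_) hT
  refine subset_ketSpan μ R (Or.inr ?_)
  rcases hT with ⟨ξ, hξ, rfl⟩ | ⟨ξ, hξ, y, rfl⟩
  · exact ⟨ξ, hξ, x, rfl⟩
  · exact ⟨ξ, hξ, y * x, rfl⟩

variable (B) in
/-- The reduced crossed product as a space of operators on `L²(G, B)`. -/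
def crOps : Submodule ℂ (L2 μ B →L[ℂ] L2 μ B) where
  carrier := Set.range fun c : Cr μ B => c.1.1
  add_mem' := by
    rintro _ _ ⟨c, rfl⟩ ⟨d, rfl⟩
    exact ⟨c + d, rfl⟩
  zero_mem' := ⟨0, rfl⟩
  smul_mem' := by
    rintro z _ ⟨c, rfl⟩
    exact ⟨z • c, rfl⟩

theorem isClosed_crOps : IsClosed (crOps μ B : Set (L2 μ B →L[ℂ] L2 μ B)) := by
  have h : Isometry fun c : Cr μ B => c.1.1 := Isometry.of_dist_eq fun _ _ => rfl
  exact h.isClosedEmbedding.isClosed_range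

theorem star_mem_crOps {T T' : L2 μ B →L[ℂ] E} (hT : IsAdjointable B T) (hT' : IsAdjointable B T')
    (h : (adj B T).comp T' ∈ crOps μ B) : (adj B T').comp T ∈ crOps μ B := by
  obtain ⟨c, hc⟩ := h
  refine ⟨star c, ?_⟩
  have h1 := hT'.isAdjointPair.comp hT.isAdjointPair.symm
  rw [← hc] at h1
  exact h1.adj_eq

theorem adj_comp_mem_of_mem_ketSet {R : Set E} (hR : RelCont μ B R) {T T' : L2 μ B →L[ℂ] E}
    (hT : T ∈ ketSet μ B R) (hT' : T' ∈ ketSet μ B R) : (adj B T).comp T' ∈ crOps μ B := by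
  have hadj : ∀ (ξ : E) (x : Cr μ B), adj B ((ket μ B ξ).comp x.1.1) =
      (star x).1.1.comp (adj B (ket μ B ξ)) := fun ξ x =>
    (x.1.isAdjointPair.comp (isAdjointable_ket μ ξ).isAdjointPair).adj_eq
  rcases hT with ⟨ξ, hξ, rfl⟩ | ⟨ξ, hξ, x, rfl⟩ <;>
  rcases hT' with ⟨η, hη, rfl⟩ | ⟨η, hη, y, rfl⟩ <;>
  obtain ⟨c, hc⟩ := hR.2 ξ hξ η hη
  · exact ⟨c, hc⟩
  · refine ⟨c * y, ?_⟩
    rw [← ContinuousLinearMap.comp_assoc, ← hc]; rfl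
  · refine ⟨star x * c, ?_⟩
    rw [hadj, ContinuousLinearMap.comp_assoc, ← hc]; rfl
  · refine ⟨star x * (c * y), ?_⟩
    rw [hadj, ContinuousLinearMap.comp_assoc, ← ContinuousLinearMap.comp_assoc _ _ y.1.1, ← hc]
    rfl

theorem adj_comp_mem_crOps {R : Set E} (hR : RelCont μ B R) {T T' : L2 μ B →L[ℂ] E}
    (hT : T ∈ ketSpan μ B R) (hT' : T' ∈ ketSpan μ B R) : (adj B T).comp T' ∈ crOps μ B := by
  have key : ∀ (S : L2 μ B →L[ℂ] E), (∀ S' ∈ ketSet μ B R, (adj B S).comp S' ∈ crOps μ B) →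
      ∀ S' ∈ ketSpan μ B R, (adj B S).comp S' ∈ crOps μ B := by
    intro S hS S' hS'
    let L : (L2 μ B →L[ℂ] E) →L[ℂ] (L2 μ B →L[ℂ] L2 μ B) :=
      ContinuousLinearMap.compL ℂ (L2 μ B) E (L2 μ B) (adj B S)
    exact mem_of_mem_ketSpan μ (R := R) (S := (crOps μ B).comap L.toLinearMap)
      ((isClosed_crOps μ).preimage L.continuous) hS hS'
  refine key T (fun S hS => ?_) T' hT'
  have hSa := isAdjointable_of_mem_ketSet μ hS
  refine star_mem_crOps μ hSa (isAdjointable_of_mem_ketSpan μ hT) ?_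
  exact key S (fun S' hS' => adj_comp_mem_of_mem_ketSet μ hR hS hS') T hT

/-- A self-adjoint element of the reduced crossed product that is positive as an operator on
`L²(G, B)` is of the form `star a * a`. -/
theorem exists_star_mul_self (c : Cr μ B) (hc : IsSelfAdjoint c)
    (hpos : ∀ y : L2 μ B, ∃ b : B, ip B y (c.1.1 y) = star b * b) : ∃ a : Cr μ B, c = star a * a := by
  let _ := CStarAlgebra.spectralOrder B
  have _ := CStarAlgebra.spectralOrderedRing B
  obtain ⟨a, d, hcd, horth⟩ := exists_pos_sub_pos c hc
  refine ⟨a, ?_⟩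
  obtain ⟨n, hn⟩ : ∃ n, n = star d * d := ⟨_, rfl⟩
  rw [← hn] at hcd horth
  have hns : star n = n := by rw [hn, star_mul, star_star]
  have h1 : n * c * n = -(star (d * n) * (d * n)) := by
    calc n * c * n = n * (star a * a - n) * n := by rw [← hcd]
      _ = -(n * n * n) := by rw [mul_sub, horth, zero_sub, neg_mul]
      _ = -(n * (star d * d) * n) := by rw [← hn]
      _ = -(star (d * n) * (d * n)) := by rw [star_mul, hns, mul_assoc, mul_assoc, mul_assoc]
  have h2 : d * n = 0 := by
    refine Subtype.ext (Subtype.ext (ContinuousLinearMap.ext fun x => ?_))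
    change (d * n).1.1 x = 0
    have e1 : ip B (n.1.1 x) (c.1.1 (n.1.1 x)) = ip B x ((n * c * n).1.1 x) := by
      have := n.1.isAdjointPair x (c.1.1 (n.1.1 x))
      rw [show star n.1 = n.1 from congrArg Subtype.val hns] at this
      exact this
    have e2 : ip B x ((n * c * n).1.1 x) = -ip B ((d * n).1.1 x) ((d * n).1.1 x) := by
      have e3 := (d * n).1.isAdjointPair x ((d * n).1.1 x)
      have e4 := ip_smul_right (B := B) (-1) x ((star (d * n) * (d * n)).1.1 x)
      rw [neg_one_smul, neg_one_smul] at e4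
      rw [h1]
      exact e4.trans (congrArg Neg.neg e3.symm)
    obtain ⟨b, hb⟩ := hpos (n.1.1 x)
    obtain ⟨b', hb'⟩ := ip_self_nonneg (B := B) ((d * n).1.1 x)
    have e3 : star b * b = -(star b' * b') := by rw [← hb, ← hb', e1, e2]
    have e4 : star b' * b' = 0 := by
      refine le_antisymm ?_ (star_mul_self_nonneg b')
      rw [← neg_nonneg, ← e3]
      exact star_mul_self_nonneg b
    have e5 : ‖(d * n).1.1 x‖ ^ 2 = 0 := by rw [norm_sq_ip B, hb', e4, norm_zero]
    exact norm_eq_zero.1 (pow_eq_zero_iff (two_ne_zero) |>.1 e5)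
  have h3 : n * n = 0 := by
    nth_rw 1 [hn]
    rw [mul_assoc, h2, mul_zero]
  have h4 : n = 0 := by
    rw [← CStarRing.star_mul_self_eq_zero_iff, hns, h3]
  rw [hcd, h4, sub_zero]

/-- The Hilbert module `F(E, R)` over the reduced crossed product: the closed linear span of
`|ξ⟩⟩` and `|ξ⟩⟩ x` for `ξ` in `R` and `x` in the reduced crossed product, with
`⟨T, T'⟩ = T* T'` and `T · x = T x`. -/
def FMod {R : Set E} (_h : RelCont μ B R) : Type _ := ketSpan μ B R

variable {R : Set E} (hR : RelCont μ B R)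

instance : NormedAddCommGroup (FMod μ hR) := inferInstanceAs (NormedAddCommGroup (ketSpan μ B R))
instance : NormedSpace ℂ (FMod μ hR) := inferInstanceAs (NormedSpace ℂ (ketSpan μ B R))
instance : CompleteSpace (FMod μ hR) :=
  (Submodule.isClosed_topologicalClosure _).completeSpace_coe

/-- The operator `T* T'` as an element of the reduced crossed product. -/
def FMod.inner (T T' : FMod μ hR) : Cr μ B :=
  ⟨⟨(adj B T.1).comp T'.1, by
    obtain ⟨c, hc⟩ := adj_comp_mem_crOps μ hR T.2 T'.2
    rw [← hc]; exact c.1.2⟩, by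
    obtain ⟨c, hc⟩ := adj_comp_mem_crOps μ hR T.2 T'.2
    have h : c.1 = ⟨(adj B T.1).comp T'.1, by rw [← hc]; exact c.1.2⟩ := Subtype.ext hc
    rw [← h]; exact c.2⟩

theorem FMod.ext_op {c d : Cr μ B} (h : c.1.1 = d.1.1) : c = d := Subtype.ext (Subtype.ext h)

theorem FMod.isAdjointPair (T : FMod μ hR) : IsAdjointPair B T.1 (adj B T.1) :=
  (isAdjointable_of_mem_ketSpan μ T.2).isAdjointPair

theorem FMod.star_inner' (T T' : FMod μ hR) : star (FMod.inner μ hR T T') = FMod.inner μ hR T' T :=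
  FMod.ext_op μ ((FMod.isAdjointPair μ hR T').comp (FMod.isAdjointPair μ hR T).symm).adj_eq

instance FMod.innerModule : InnerModule (Cr μ B) (FMod μ hR) where
  inner := FMod.inner μ hR
  rsmul T x := ⟨T.1.comp x.1.1, comp_mem_ketSpan μ T.2 x⟩
  add_rsmul T T' x := Subtype.ext (ContinuousLinearMap.add_comp T.1 T'.1 x.1.1)
  smul_rsmul z T x := Subtype.ext (ContinuousLinearMap.smul_comp z T.1 x.1.1)
  rsmul_add T x y := Subtype.ext (ContinuousLinearMap.comp_add T.1 x.1.1 y.1.1)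
  rsmul_smul z T x := Subtype.ext (ContinuousLinearMap.comp_smul T.1 z x.1.1)
  rsmul_mul T x y := rfl
  inner_add_right T T' T'' :=
    FMod.ext_op μ (ContinuousLinearMap.comp_add (adj B T.1) T'.1 T''.1)
  inner_smul_right z T T' := FMod.ext_op μ (ContinuousLinearMap.comp_smul (adj B T.1) z T'.1)
  inner_rsmul_right T T' x := rfl
  star_inner := FMod.star_inner' μ hR
  inner_self_nonneg T := exists_star_mul_self μ _ (FMod.star_inner' μ hR T T) fun y => by
    obtain ⟨b, hb⟩ := ip_self_nonneg (B := B) (T.1 y)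
    refine ⟨b, ?_⟩
    rw [← hb]
    exact (FMod.isAdjointPair μ hR T y (T.1 y)).symm
  norm_sq_eq T := by
    change ‖T.1‖ ^ 2 = ‖(adj B T.1).comp T.1‖
    have h := FMod.isAdjointPair μ hR T
    refine le_antisymm ?_ ?_
    · rw [pow_two]; exact h.norm_sq_le
    · refine (ContinuousLinearMap.opNorm_comp_le _ _).trans_eq ?_
      rw [h.norm_eq, pow_two]

end SquareIntegrable

/-! ### The induced homomorphism and the tensor product of relatively continuous subspaces -/

section Induced

variable {G : Type*} [Group G] [TopologicalSpace G] [IsTopologicalGroup G] [T2Space G]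
  [LocallyCompactSpace G] [MeasurableSpace G] [BorelSpace G]
  (μ : Measure G) [μ.IsHaarMeasure] [μ.Regular]
  {A B E₁ E₂ : Type*} [NonUnitalCStarAlgebra A] [GCStarAlgebra G A]
  [NonUnitalCStarAlgebra B] [GCStarAlgebra G B]
  [NormedAddCommGroup E₁] [NormedSpace ℂ E₁] [InnerModule A E₁]
  [NormedAddCommGroup E₂] [NormedSpace ℂ E₂] [CompleteSpace E₂] [InnerModule B E₂]
  [GInnerModule G B E₂]

/-- `Φ` is the *-homomorphism `C*_r(G, A) → AdjAlg C*_r(G, E₂)` induced by the equivariant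
*-homomorphism `φ : A → AdjAlg B E₂`, that is, its integrated form:
`Φ(ρ_K)(η ⊗ x) = ∫ φ(K(h)) γ_h(η) ⊗ ρ_h x dh` for `K` in `C_c(G, A)`, `η` in `E₂` and `x` in
`C*_r(G, B)`. Since `ρ(C_c(G, A))` is dense in `C*_r(G, A)`, this determines `Φ`. -/
def IsInduced (φ : A →⋆ₙₐ[ℂ] AdjAlg B E₂)
    (Φ : Cr μ A →⋆ₙₐ[ℂ] AdjAlg (Cr μ B) (CrMod μ B E₂)) : Prop :=
  ∀ (K : C_c(G, A)) (T : Cr μ A), IsLaurent μ K T.1.1 → ∀ (η : E₂) (x : Cr μ B),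
    (Φ T : CrMod μ B E₂ →L[ℂ] CrMod μ B E₂) (InteriorTensor.tmul (crLeftB μ B) η x) =
      ∫ h, InteriorTensor.tmul (crLeftB μ B) ((φ (K h) : E₂ →L[ℂ] E₂) (actE B h η))
        (crLeftG μ h x) ∂μ

/-- The image of `R ⊗ E₂` in `E₁ ⊗_A E₂`. -/
def tensorImage (φ : A →⋆ₙₐ[ℂ] AdjAlg B E₂) (R : Submodule ℂ E₁) :
    Submodule ℂ (InteriorTensor E₁ φ) :=
  LinearMap.range
    (InteriorTensor.ofTensor φ ∘ₗ TensorProduct.map R.subtype (LinearMap.id : E₂ →ₗ[ℂ] E₂))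

/-- Isomorphisms of Hilbert `B`-modules: linear bijections that are compatible with the right action
of `B` and with the `B`-valued inner products. -/
structure HilbertModuleIso (B E F : Type*) [NonUnitalCStarAlgebra B]
    [NormedAddCommGroup E] [NormedSpace ℂ E] [InnerModule B E]
    [NormedAddCommGroup F] [NormedSpace ℂ F] [InnerModule B F] extends E ≃ₗ[ℂ] F where
  map_rs : ∀ (x : E) (b : B), toFun (rs x b) = rs (toFun x) b
  ip_map : ∀ x y : E, ip B (toFun x) (toFun y) = ip B x y

end Induced

end

/-! Everything is transported to operators between Hilbert modules over `B`. Since `φ` is essential,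
`f ⊗ ζ ↦ φ(f) ζ` is a unitary from `L²(G, A) ⊗_A E₂` onto `L²(G, E₂)` (`ampU`). Hence an adjointable
`T : L²(G, A) → E₁` induces an operator `T ⊗ 1 : L²(G, E₂) → E₁ ⊗_A E₂` (`liftL`), and an
adjointable operator `S` on `L²(G, A)` induces `S ⊗ 1` on `L²(G, E₂)` (`hatL`). Each `η` in `E₂`
gives `|η⟩ : L²(G, B) → L²(G, E₂)`, `f ↦ (g ↦ γ_g(η) f(g))` (`ketL`), with `⟨η|η'⟩ = ρ_b` for `b =
⟨η, η'⟩`.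

The central identity is `|ξ ⊗ η⟩⟩ = (|ξ⟩⟩ ⊗ 1) |η⟩` (`IsKet.tmul`). Square-integrability of a vector
is equivalent to the existence of its ket operator, so elements of `R₁₂` are square-integrable.
Moreover `⟨⟨ξ ⊗ η | ξ' ⊗ η'⟩⟩ = ⟨η| (⟨⟨ξ|ξ'⟩⟩ ⊗ 1) |η'⟩`. For `T = ρ_K` the operator `⟨η| (T ⊗ 1)
|η'⟩` is `ρ_L` with `L(h) = ⟨η, φ(K(h)) γ_h(η')⟩` (`ccBra_ccRhoE`). As `T ↦ T ⊗ 1` is contractive,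
`⟨η| (T ⊗ 1) |η'⟩` lies in `C*_r(G, B)` for all `T` in `C*_r(G, A)` (`bra_hatL_ket_mem_crOps`). This
proves relative continuity.

For the induced homomorphism, `η ⊗ x ↦ |η⟩ x` embeds `C*_r(G, E₂)` isometrically into the operators
`L²(G, B) → L²(G, E₂)` (`thetaL`). The image is closed and invariant under every `T ⊗ 1`, because
`(ρ_K ⊗ 1) |η⟩ = ∫ |φ(K(h)) γ_h(η)⟩ ρ_h dh` (`thetaL_twistInt_eq`). Then `Φ(T)` is the restriction
of `T ⊗ 1` to this image, and the integral is the prescribed formula. That `h ↦ ρ_h x` is continuous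
(`continuous_crLeftG`) gives the integral a meaning in `C*_r(G, E₂)`.

For the isomorphism, `T ⊗ n ↦ (T ⊗ 1) θ(n)`, with `θ` the embedding just described, preserves inner
products and therefore embeds `F(E₁, R₁) ⊗ C*_r(G, E₂)` isometrically into the operators `L²(G, B) →
E₁ ⊗_A E₂` (`tensorOp`). It sends `|ξ⟩⟩ ⊗ (η ⊗ x)` to `|ξ ⊗ η⟩⟩ x`, so its image lies in `F(E₁₂,
R₁₂)` and contains all `|t⟩⟩ x` with `t` in `R₁₂`. The generators `|t⟩⟩` without a factor `x` are
limits of `|t⟩⟩ u` along an approximate unit of `C*_r(G, B)`, because `⟨⟨t|t⟩⟩` lies in that algebra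
(`mem_of_comp_mem`). As the image is closed, it is all of `F(E₁₂, R₁₂)`. -/

noncomputable section

/-! ### Densely defined operators with a formal adjoint. -/

section Extension

variable {B V W E F : Type*} [NonUnitalCStarAlgebra B]
  [AddCommGroup V] [Module ℂ V] [AddCommGroup W] [Module ℂ W]
  [NormedAddCommGroup E] [NormedSpace ℂ E] [InnerModule B E] [CompleteSpace E]
  [NormedAddCommGroup F] [NormedSpace ℂ F] [InnerModule B F] [CompleteSpace F]

/-- A bounded densely defined linear map that has a densely defined formal adjoint extends to an
adjointable operator. -/
theorem exists_isAdjointPair_extension (e : V →ₗ[ℂ] E) (e' : W →ₗ[ℂ] F) (he : DenseRange e)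
    (he' : DenseRange e') (t : V →ₗ[ℂ] F) (s : W →ₗ[ℂ] E) {c : ℝ} (hc : 0 ≤ c)
    (h : ∀ x y, ip B (t x) (e' y) = ip B (e x) (s y)) (ht : ∀ x, ‖t x‖ ≤ c * ‖e x‖) :
    ∃ (T : E →L[ℂ] F) (S : F →L[ℂ] E), IsAdjointPair B T S ∧ (∀ x, T (e x) = t x) ∧
      (∀ y, S (e' y) = s y) ∧ ‖T‖ ≤ c := by
  have hT : ∀ x, t.extendOfNorm e (e x) = t x := LinearMap.extendOfNorm_eq he ⟨c, ht⟩
  have hTn : ‖t.extendOfNorm e‖ ≤ c := LinearMap.opNorm_extendOfNorm_le he hc ht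
  have h1 : ∀ z y, ip B (t.extendOfNorm e z) (e' y) = ip B z (s y) := fun z y => by
    induction z using he.induction_on with
    | hp => exact isClosed_eq ((ContinuousLinearMap.continuous _).ip continuous_const)
              (continuous_id.ip continuous_const)
    | ih x => rw [hT, h]
  -- Only `t` is assumed bounded. The bound for `s` follows by pairing `s y` with itself and moving
  -- one factor to the extension of `t`.
  have hs : ∀ y, ‖s y‖ ≤ c * ‖e' y‖ := fun y => by
    have h2 : ‖s y‖ * ‖s y‖ ≤ c * ‖e' y‖ * ‖s y‖ := by
      rw [← pow_two, norm_sq_ip B, ← h1]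
      calc _ ≤ ‖t.extendOfNorm e (s y)‖ * ‖e' y‖ := norm_ip_le _ _
        _ ≤ (c * ‖s y‖) * ‖e' y‖ := by
          gcongr; exact (t.extendOfNorm e).le_of_opNorm_le hTn _
        _ = _ := by ring
    rcases (norm_nonneg (s y)).eq_or_lt with h0 | h0
    · rw [← h0]; positivity
    · exact le_of_mul_le_mul_right h2 h0
  have hS : ∀ x, s.extendOfNorm e' (e' x) = s x := LinearMap.extendOfNorm_eq he' ⟨c, hs⟩
  refine ⟨t.extendOfNorm e, s.extendOfNorm e', fun x y => ?_, hT, hS, hTn⟩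
  induction y using he'.induction_on with
  | hp => exact isClosed_eq (continuous_const.ip continuous_id)
            (continuous_const.ip (ContinuousLinearMap.continuous _))
  | ih y => rw [hS, h1]

theorem IsAdjointPair.sub {T T' : E →L[ℂ] F} {S S' : F →L[ℂ] E} (h : IsAdjointPair B T S)
    (h' : IsAdjointPair B T' S') : IsAdjointPair B (T - T') (S - S') := fun x y => by
  rw [_root_.sub_apply, ip_sub_left, h, h', _root_.sub_apply, ip_sub_right]

/-- A surjective map that preserves the inner products commutes with the right actions. -/
theorem map_rs_of_ip_map {T : E → F} (hT : Function.Surjective T)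
    (h : ∀ x y, ip B (T x) (T y) = ip B x y) (x : E) (b : B) : T (rs x b) = rs (T x) b :=
  eq_of_forall_ip B fun z => by
    obtain ⟨z, rfl⟩ := hT z
    rw [h, ip_rs_right, ip_rs_right, h]

end Extension

/-! ### Interior tensor products and the operators `T ⊗ 1`. -/

section TensorRight

open UniformSpace

variable {A B E₁ F₁ D₁ E₂ : Type*} [NonUnitalCStarAlgebra A] [NonUnitalCStarAlgebra B]
  [NormedAddCommGroup E₁] [NormedSpace ℂ E₁] [InnerModule A E₁]
  [NormedAddCommGroup F₁] [NormedSpace ℂ F₁] [InnerModule A F₁]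
  [NormedAddCommGroup D₁] [NormedSpace ℂ D₁] [InnerModule A D₁]
  [NormedAddCommGroup E₂] [NormedSpace ℂ E₂] [CompleteSpace E₂] [InnerModule B E₂]
  (φ : A →⋆ₙₐ[ℂ] AdjAlg B E₂)

theorem InteriorTensor.norm_tmul_le (x : E₁) (ξ : E₂) :
    ‖InteriorTensor.tmul φ x ξ‖ ≤ ‖x‖ * ‖ξ‖ :=
  (Completion.norm_coe (PreTensor.tmul φ x ξ)).trans_le (PreTensor.norm_tmul_le E₁ φ x ξ)

variable (E₁) in
/-- The elementary tensors as a continuous bilinear map. -/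
def InteriorTensor.tmulL : E₁ →L[ℂ] E₂ →L[ℂ] InteriorTensor E₁ φ :=
  LinearMap.mkContinuous₂ ((TensorProduct.mk ℂ E₁ E₂).compr₂ (InteriorTensor.ofTensor φ)) 1
    fun x ξ => by rw [one_mul]; exact InteriorTensor.norm_tmul_le φ x ξ

theorem InteriorTensor.tmulL_apply (x : E₁) (ξ : E₂) :
    InteriorTensor.tmulL E₁ φ x ξ = InteriorTensor.tmul φ x ξ := rfl

@[fun_prop]
theorem Continuous.tmul {α : Type*} [TopologicalSpace α] {f : α → E₁} {g : α → E₂}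
    (hf : Continuous f) (hg : Continuous g) :
    Continuous fun a => InteriorTensor.tmul φ (f a) (g a) := by
  simp only [← InteriorTensor.tmulL_apply]
  fun_prop

theorem InteriorTensor.rs_tmul (x : E₁) (ξ : E₂) (b : B) :
    rs (InteriorTensor.tmul φ x ξ) b = InteriorTensor.tmul φ x (rs ξ b) :=
  rs_coe (V := PreTensor E₁ φ) (PreTensor.tmul φ x ξ) b

/-- A closed additive property of elements of `E₁ ⊗_A E₂` holds if it holds for elementary
tensors. -/
theorem InteriorTensor.induction {p : InteriorTensor E₁ φ → Prop} (hc : IsClosed {t | p t})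
    (h : ∀ x ξ, p (InteriorTensor.tmul φ x ξ)) (ha : ∀ s t, p s → p t → p (s + t))
    (t : InteriorTensor E₁ φ) : p t := by
  induction t using Completion.induction_on with
  | hp => exact hc
  | ih t =>
    induction t using PreTensor.induction with
    | h1 x ξ => exact h x ξ
    | h2 s t hs ht => rw [Completion.coe_add]; exact ha _ _ hs ht
    | h0 =>
      by_cases hne : Nonempty E₁
      -- The zero vector is the elementary tensor `0 ⊗ 0`.
      · have := h 0 0
        rw [← InteriorTensor.tmulL_apply, map_zero] at this
        exact this
      · exact absurd ⟨0⟩ hne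

theorem InteriorTensor.eq_of_tmul {D : Type*} [TopologicalSpace D] [T2Space D] [AddCommGroup D]
    {S T : InteriorTensor E₁ φ → D} (hS : Continuous S) (hT : Continuous T)
    (hS' : ∀ s t, S (s + t) = S s + S t) (hT' : ∀ s t, T (s + t) = T s + T t)
    (h : ∀ x ξ, S (InteriorTensor.tmul φ x ξ) = T (InteriorTensor.tmul φ x ξ))
    (t : InteriorTensor E₁ φ) : S t = T t :=
  InteriorTensor.induction φ (p := fun t => S t = T t) (isClosed_eq hS hT) h
    (fun s t hs ht => by rw [hS', hT', hs, ht]) t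

/-- Two elements of `E₁ ⊗_A E₂` are equal if they have the same inner products with elementary
tensors. -/
theorem InteriorTensor.eq_of_ip_tmul {s t : InteriorTensor E₁ φ}
    (h : ∀ x ξ, ip B (InteriorTensor.tmul φ x ξ) s = ip B (InteriorTensor.tmul φ x ξ) t) : s = t :=
  eq_of_forall_ip B fun z => InteriorTensor.eq_of_tmul φ (S := fun z => ip B z s)
    (T := fun z => ip B z t) (continuous_id.ip continuous_const) (continuous_id.ip continuous_const)
    (fun _ _ => ip_add_left _ _ _) (fun _ _ => ip_add_left _ _ _) h z

/-- Multiplicativity of `φ` gives both vectors the same inner product `⟨η, φ(⟨y, x⟩ a) ξ⟩` with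
every `y ⊗ η`. So the completion is balanced over `A`, although the algebraic tensor product is only
taken over `ℂ`. -/
theorem InteriorTensor.tmul_rs (x : E₁) (a : A) (ξ : E₂) :
    InteriorTensor.tmul φ (rs x a) ξ = InteriorTensor.tmul φ x ((φ a : E₂ →L[ℂ] E₂) ξ) :=
  InteriorTensor.eq_of_ip_tmul φ fun y η => by
    rw [InteriorTensor.ip_tmul, InteriorTensor.ip_tmul, ip_rs_right, map_mul]
    rfl

/-- The map `T ⊗ 1` on the algebraic tensor product. -/
def PreTensor.mapₗ (T : E₁ →L[ℂ] F₁) : PreTensor E₁ φ →ₗ[ℂ] PreTensor F₁ φ :=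
  TensorProduct.map T.toLinearMap LinearMap.id

theorem PreTensor.mapₗ_tmul (T : E₁ →L[ℂ] F₁) (x : E₁) (ξ : E₂) :
    PreTensor.mapₗ φ T (PreTensor.tmul φ x ξ) = PreTensor.tmul φ (T x) ξ := rfl

theorem PreTensor.ip_mapₗ_left {T : E₁ →L[ℂ] F₁} {S : F₁ →L[ℂ] E₁} (h : IsAdjointPair A T S)
    (s : PreTensor E₁ φ) (t : PreTensor F₁ φ) :
    ip B (PreTensor.mapₗ φ T s) t = ip B s (PreTensor.mapₗ φ S t) := by
  induction s using PreTensor.induction with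
  | h0 => rw [map_zero, ip_zero_left, ip_zero_left]
  | h2 x x' hx hx' => rw [map_add, ip_add_left, ip_add_left, hx, hx']
  | h1 x ξ =>
    induction t using PreTensor.induction with
    | h0 => rw [map_zero, ip_zero_right, ip_zero_right]
    | h2 y y' hy hy' => rw [map_add, ip_add_right, ip_add_right, hy, hy']
    | h1 y η =>
      rw [PreTensor.mapₗ_tmul, PreTensor.mapₗ_tmul, PreTensor.ip_tmul, PreTensor.ip_tmul, h]

/-- An operator identity `T* T + R* R = c` survives tensoring with `1`. It serves to bound `T ⊗ 1`:
positivity of the second summand is automatic, so no order relation between matrices over `A` has to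
be pushed through `φ`. -/
theorem PreTensor.ip_mapₗ_add {T : E₁ →L[ℂ] F₁} {R : E₁ →L[ℂ] D₁} {c : ℂ}
    (h : ∀ x y : E₁, ip A (T x) (T y) + ip A (R x) (R y) = c • ip A x y) (s t : PreTensor E₁ φ) :
    ip B (PreTensor.mapₗ φ T s) (PreTensor.mapₗ φ T t) +
      ip B (PreTensor.mapₗ φ R s) (PreTensor.mapₗ φ R t) = c • ip B s t := by
  induction s using PreTensor.induction with
  | h0 => rw [map_zero, map_zero, ip_zero_left, ip_zero_left, ip_zero_left, smul_zero, zero_add]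
  | h2 x x' hx hx' =>
    rw [map_add, map_add, ip_add_left, ip_add_left, ip_add_left, smul_add, ← hx, ← hx']
    abel
  | h1 x ξ =>
    induction t using PreTensor.induction with
    | h0 => rw [map_zero, map_zero, ip_zero_right, ip_zero_right, ip_zero_right, smul_zero,
              zero_add]
    | h2 y y' hy hy' =>
      rw [map_add, map_add, ip_add_right, ip_add_right, ip_add_right, smul_add, ← hy, ← hy']
      abel
    | h1 y η =>
      rw [PreTensor.mapₗ_tmul, PreTensor.mapₗ_tmul, PreTensor.mapₗ_tmul,
        PreTensor.mapₗ_tmul, PreTensor.ip_tmul, PreTensor.ip_tmul, PreTensor.ip_tmul,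
        ← ip_smul_right, ← ip_add_right]
      congr 1
      have := congrArg (fun a => (φ a : E₂ →L[ℂ] E₂) η) (h x y)
      simp only [map_add, map_smul] at this
      exact this

/-- An adjointable operator `T` satisfies `⟨T x, T y⟩ + ⟨R x, R y⟩ = ‖T* T‖ ⟨x, y⟩` for some `R`. -/
theorem IsAdjointPair.exists_complement [CompleteSpace E₁] {T : E₁ →L[ℂ] F₁} {S : F₁ →L[ℂ] E₁}
    (h : IsAdjointPair A T S) : ∃ R : E₁ →L[ℂ] E₁, ∀ x y : E₁,
      ip A (T x) (T y) + ip A (R x) (R y) = ((‖S.comp T‖ : ℝ) : ℂ) • ip A x y := by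
  let _ := CStarAlgebra.spectralOrder (AdjAlg A E₁)
  have _ := CStarAlgebra.spectralOrderedRing (AdjAlg A E₁)
  have hST : IsAdjointPair A (S.comp T) (S.comp T) := h.comp h.symm
  let p : AdjAlg A E₁ := ⟨S.comp T, _, hST⟩
  have hp : IsSelfAdjoint p := AdjAlg.star_eq hST
  -- In the C*-algebra of adjointable operators `T* T ≤ ‖T* T‖`. The complement `R` is any `r` with
  -- `r* r = ‖T* T‖ - T* T`.
  obtain ⟨r, hr⟩ := CStarAlgebra.nonneg_iff_eq_star_mul_self.1
    (sub_nonneg.2 hp.le_algebraMap_norm_self)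
  refine ⟨r.1, fun x y => ?_⟩
  have h1 : ((star r * r).1 : E₁ →L[ℂ] E₁) y = ((‖S.comp T‖ : ℝ) : ℂ) • y - S (T y) := by
    rw [← hr]
    rfl
  have h2 : ip A (r.1 x) (r.1 y) = ip A x (((star r * r).1 : E₁ →L[ℂ] E₁) y) :=
    r.isAdjointPair x (r.1 y)
  rw [h2, h1, h, ip_sub_right, ip_smul_right]
  abel

/-- With the complement `R` of `T`, the vector `(T ⊗ 1) x` satisfies `⟨(T ⊗ 1) x, (T ⊗ 1) x⟩ ≤ ‖T*
T‖ ⟨x, x⟩`, since what is missing is `⟨(R ⊗ 1) x, (R ⊗ 1) x⟩`. -/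
theorem PreTensor.norm_mapₗ_le [CompleteSpace E₁] {T : E₁ →L[ℂ] F₁} {S : F₁ →L[ℂ] E₁}
    (h : IsAdjointPair A T S) (x : PreTensor E₁ φ) : ‖PreTensor.mapₗ φ T x‖ ≤ ‖T‖ * ‖x‖ := by
  let _ := CStarAlgebra.spectralOrder B
  have _ := CStarAlgebra.spectralOrderedRing B
  obtain ⟨R, hR⟩ := h.exists_complement
  have key := PreTensor.ip_mapₗ_add φ hR x x
  refine abs_le_of_sq_le_sq' ?_ (by positivity) |>.2
  rw [mul_pow, norm_sq_ip B, norm_sq_ip B x]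
  have h3 : ip B (PreTensor.mapₗ φ T x) (PreTensor.mapₗ φ T x) ≤
      ((‖S.comp T‖ : ℝ) : ℂ) • ip B x x := by
    rw [← key, le_add_iff_nonneg_right]
    exact CStarAlgebra.nonneg_iff_eq_star_mul_self.2 (ip_self_nonneg _)
  refine (CStarAlgebra.norm_le_norm_of_nonneg_of_le
    (CStarAlgebra.nonneg_iff_eq_star_mul_self.2 (ip_self_nonneg _)) h3).trans ?_
  rw [norm_smul, Complex.norm_real, norm_norm]
  gcongr
  calc ‖S.comp T‖ ≤ ‖S‖ * ‖T‖ := ContinuousLinearMap.opNorm_comp_le _ _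
    _ = _ := by rw [h.norm_eq, pow_two]

variable (E₁) in
/-- The canonical map from the algebraic tensor product with its seminorm to its completion. -/
def PreTensor.toInterior : PreTensor E₁ φ →ₗ[ℂ] InteriorTensor E₁ φ :=
  (Completion.toComplL (𝕜 := ℂ) (E := PreTensor E₁ φ)).toLinearMap

theorem PreTensor.ip_toInterior (s t : PreTensor E₁ φ) :
    ip B (PreTensor.toInterior E₁ φ s) (PreTensor.toInterior E₁ φ t) = ip B s t :=
  ip_coe (V := PreTensor E₁ φ) s t

theorem PreTensor.norm_toInterior (s : PreTensor E₁ φ) : ‖PreTensor.toInterior E₁ φ s‖ = ‖s‖ :=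
  Completion.norm_coe s

theorem PreTensor.denseRange_toInterior : DenseRange (PreTensor.toInterior E₁ φ) :=
  Completion.denseRange_coe (α := PreTensor E₁ φ)

theorem exists_tensorRight [CompleteSpace E₁] {T : E₁ →L[ℂ] F₁} {S : F₁ →L[ℂ] E₁}
    (h : IsAdjointPair A T S) :
    ∃ (T' : InteriorTensor E₁ φ →L[ℂ] InteriorTensor F₁ φ)
      (S' : InteriorTensor F₁ φ →L[ℂ] InteriorTensor E₁ φ), IsAdjointPair B T' S' ∧
      (∀ x ξ, T' (InteriorTensor.tmul φ x ξ) = InteriorTensor.tmul φ (T x) ξ) ∧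
      (∀ x ξ, S' (InteriorTensor.tmul φ x ξ) = InteriorTensor.tmul φ (S x) ξ) ∧ ‖T'‖ ≤ ‖T‖ := by
  obtain ⟨T', S', h1, h2, h3, h4⟩ := exists_isAdjointPair_extension (B := B)
    (PreTensor.toInterior E₁ φ) (PreTensor.toInterior F₁ φ)
    (PreTensor.denseRange_toInterior φ) (PreTensor.denseRange_toInterior φ)
    (PreTensor.toInterior F₁ φ ∘ₗ PreTensor.mapₗ φ T)
    (PreTensor.toInterior E₁ φ ∘ₗ PreTensor.mapₗ φ S)
    (norm_nonneg T)
    (fun x y => by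
      rw [LinearMap.comp_apply, LinearMap.comp_apply, PreTensor.ip_toInterior,
        PreTensor.ip_toInterior, PreTensor.ip_mapₗ_left φ h])
    (fun x => by
      rw [LinearMap.comp_apply, PreTensor.norm_toInterior, PreTensor.norm_toInterior]
      exact PreTensor.norm_mapₗ_le φ h x)
  exact ⟨T', S', h1, fun x ξ => h2 (PreTensor.tmul φ x ξ), fun x ξ => h3 (PreTensor.tmul φ x ξ), h4⟩

variable [CompleteSpace E₁]

open Classical in
/-- The operator `T ⊗ 1` on `E₁ ⊗_A E₂` for an adjointable operator `T` (and `0` for other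
operators). -/
def tensorRight (T : E₁ →L[ℂ] F₁) : InteriorTensor E₁ φ →L[ℂ] InteriorTensor F₁ φ :=
  if h : IsAdjointable A T then (exists_tensorRight φ h.isAdjointPair).choose else 0

variable {T T' : E₁ →L[ℂ] F₁}

theorem tensorRight_tmul (h : IsAdjointable A T) (x : E₁) (ξ : E₂) :
    tensorRight φ T (InteriorTensor.tmul φ x ξ) = InteriorTensor.tmul φ (T x) ξ := by
  rw [tensorRight, dif_pos h]
  exact (exists_tensorRight φ h.isAdjointPair).choose_spec.choose_spec.2.1 x ξ

theorem norm_tensorRight_le (h : IsAdjointable A T) : ‖tensorRight φ T‖ ≤ ‖T‖ := by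
  rw [tensorRight, dif_pos h]
  exact (exists_tensorRight φ h.isAdjointPair).choose_spec.choose_spec.2.2.2

theorem eq_tensorRight (h : IsAdjointable A T)
    {Q : InteriorTensor E₁ φ →L[ℂ] InteriorTensor F₁ φ}
    (hQ : ∀ x ξ, Q (InteriorTensor.tmul φ x ξ) = InteriorTensor.tmul φ (T x) ξ) :
    Q = tensorRight φ T :=
  ContinuousLinearMap.ext fun t => InteriorTensor.eq_of_tmul φ Q.continuous
    (tensorRight φ T).continuous (map_add _) (map_add _)
    (fun x ξ => by rw [hQ, tensorRight_tmul φ h]) t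

theorem tensorRight_add (h : IsAdjointable A T) (h' : IsAdjointable A T') :
    tensorRight φ (T + T') = tensorRight φ T + tensorRight φ T' :=
  (eq_tensorRight φ (h.isAdjointPair.add h'.isAdjointPair).isAdjointable fun x ξ => by
    rw [_root_.add_apply, tensorRight_tmul φ h, tensorRight_tmul φ h', _root_.add_apply,
      ← InteriorTensor.tmulL_apply, ← InteriorTensor.tmulL_apply, ← InteriorTensor.tmulL_apply,
      map_add, _root_.add_apply]).symm

theorem tensorRight_smul (c : ℂ) (h : IsAdjointable A T) :
    tensorRight φ (c • T) = c • tensorRight φ T :=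
  (eq_tensorRight φ (h.isAdjointPair.smul c).isAdjointable fun x ξ => by
    rw [_root_.smul_apply, tensorRight_tmul φ h, _root_.smul_apply,
      ← InteriorTensor.tmulL_apply, ← InteriorTensor.tmulL_apply,
      map_smul, _root_.smul_apply]).symm

theorem tensorRight_comp [CompleteSpace F₁] {S : F₁ →L[ℂ] D₁} (h : IsAdjointable A T)
    (h' : IsAdjointable A S) :
    tensorRight φ (S.comp T) = (tensorRight φ S).comp (tensorRight φ T) :=
  (eq_tensorRight φ (h.isAdjointPair.comp h'.isAdjointPair).isAdjointable fun x ξ => by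
    rw [ContinuousLinearMap.comp_apply, tensorRight_tmul φ h, tensorRight_tmul φ h',
      ContinuousLinearMap.comp_apply]).symm

theorem IsAdjointPair.tensorRight [CompleteSpace F₁] {S : F₁ →L[ℂ] E₁} (h : IsAdjointPair A T S) :
    IsAdjointPair B (tensorRight φ T) (tensorRight φ S) := by
  obtain ⟨T', S', h1, h2, h3, -⟩ := exists_tensorRight φ h
  rwa [← eq_tensorRight φ h.isAdjointable h2, ← eq_tensorRight φ h.symm.isAdjointable h3]

end TensorRight

/-! ### Boundedness on `C_c(G, E)` in the inductive limit sense. -/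

section CompactSupport

variable {G : Type*} [Group G] [TopologicalSpace G] [IsTopologicalGroup G] [T2Space G]
  [MeasurableSpace G] [BorelSpace G]
  {E X : Type*} [NormedAddCommGroup E] [NormedSpace ℂ E]
  [SeminormedAddCommGroup X] [NormedSpace ℂ X]

/-- `P` is bounded for the supremum norm on the functions supported in a given compact set. -/
def IndBdd (P : C_c(G, E) →ₗ[ℂ] X) : Prop :=
  ∀ S : Set G, IsCompact S → ∃ C : ℝ, 0 ≤ C ∧ ∀ (k : C_c(G, E)) (M : ℝ), (∀ g ∉ S, k g = 0) →
    (∀ g, ‖k g‖ ≤ M) → ‖P k‖ ≤ C * M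

theorem norm_integral_le_of_support {F : Type*} [NormedAddCommGroup F] [NormedSpace ℝ F]
    (μ : Measure G) [IsFiniteMeasureOnCompacts μ] {S : Set G} (hS : IsCompact S) {f : G → F} {M : ℝ}
    (h0 : ∀ g ∉ S, f g = 0) (hM : ∀ g, ‖f g‖ ≤ M) : ‖∫ g, f g ∂μ‖ ≤ M * μ.real S := by
  rw [← setIntegral_eq_integral_of_forall_compl_eq_zero h0]
  exact norm_setIntegral_le_of_norm_le_const hS.measure_lt_top fun g _ => hM g

theorem IndBdd.comp {Y : Type*} [SeminormedAddCommGroup Y] [NormedSpace ℂ Y]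
    {P : C_c(G, E) →ₗ[ℂ] X} (hP : IndBdd P) (T : X →L[ℂ] Y) :
    IndBdd (T.toLinearMap ∘ₗ P) := fun S hS => by
  obtain ⟨C, hC, h⟩ := hP S hS
  refine ⟨‖T‖ * C, by positivity, fun k M h0 hM => ?_⟩
  rw [mul_assoc]
  exact (T.le_opNorm _).trans (by gcongr; exact h k M h0 hM)

theorem IndBdd.comp_pointwise {D : Type*} [NormedAddCommGroup D] [NormedSpace ℂ D]
    {P : C_c(G, E) →ₗ[ℂ] X} (hP : IndBdd P) (Q : C_c(G, D) →ₗ[ℂ] C_c(G, E)) {c : ℝ}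
    (hQ : ∀ k g, ‖Q k g‖ ≤ c * ‖k g‖) : IndBdd (P ∘ₗ Q) := fun S hS => by
  obtain ⟨C, hC, h⟩ := hP S hS
  refine ⟨C * |c|, by positivity, fun k M h0 hM => ?_⟩
  rw [mul_assoc]
  refine h (Q k) _ (fun g hg => ?_) fun g => ?_
  · have := hQ k g
    rwa [h0 g hg, norm_zero, mul_zero, norm_le_zero_iff] at this
  · refine (hQ k g).trans (mul_le_mul (le_abs_self c) (hM g) (norm_nonneg _) (abs_nonneg c))

/-- The linear map `f ↦ ∫ f(g) dg` on `C_c(G, E)`. -/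
def ccIntegral (μ : Measure G) [IsFiniteMeasureOnCompacts μ] : C_c(G, E) →ₗ[ℂ] E where
  toFun f := ∫ g, f g ∂μ
  map_add' f k := integral_add (cc_integrable μ f) (cc_integrable μ k)
  map_smul' c _ := integral_smul c _

theorem indBdd_ccIntegral (μ : Measure G) [IsFiniteMeasureOnCompacts μ] :
    IndBdd (ccIntegral (E := E) μ) := fun S hS =>
  ⟨μ.real S, measureReal_nonneg, fun k M h0 hM => by
    rw [mul_comm]; exact norm_integral_le_of_support μ hS h0 hM⟩

/-- Joint continuity and compactness of `S` make `v x` converge to `v x₀` uniformly on `S`. As all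
functions near `x₀` are supported in `S`, one constant of `P` applies to the differences. -/
theorem IndBdd.continuousAt {P : C_c(G, E) →ₗ[ℂ] X} (hP : IndBdd P) {D : Type*}
    [TopologicalSpace D] {v : D → C_c(G, E)} (hv : Continuous fun p : D × G => v p.1 p.2) {x₀ : D}
    {S : Set G} (hS : IsCompact S) (h0 : ∀ᶠ x in 𝓝 x₀, ∀ g ∉ S, v x g = 0) :
    ContinuousAt (fun x => P (v x)) x₀ := by
  obtain ⟨C, hC, h⟩ := hP S hS
  refine Metric.tendsto_nhds.2 fun ε hε => ?_
  -- The summand `1` covers the case `C = 0` and makes the final inequality strict.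
  have hδ : 0 < ε / (C + 1) := by positivity
  have h1 : ∀ᶠ x in 𝓝 x₀, ∀ g ∈ S, ‖v x g - v x₀ g‖ < ε / (C + 1) := by
    refine hS.eventually_forall_of_forall_eventually fun g _ => ?_
    have hc : Continuous fun p : D × G => ‖v p.1 p.2 - v x₀ p.2‖ :=
      (hv.sub ((v x₀).continuous.comp continuous_snd)).norm
    have := hc.tendsto (x₀, g)
    simp only [sub_self, norm_zero] at this
    exact this.eventually_lt_const hδ
  filter_upwards [h1, h0] with x hx hx0
  have hx0' := h0.self_of_nhds
  rw [dist_eq_norm, ← map_sub]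
  have h2 : ‖P (v x - v x₀)‖ ≤ C * (ε / (C + 1)) := by
    refine h _ _ (fun g hg => ?_) fun g => ?_
    · rw [CompactlySupportedContinuousMap.sub_apply, hx0 g hg, hx0' g hg, sub_zero]
    · rw [CompactlySupportedContinuousMap.sub_apply]
      by_cases hg : g ∈ S
      · exact (hx g hg).le
      · rw [hx0 g hg, hx0' g hg, sub_zero, norm_zero]; exact hδ.le
  refine h2.trans_lt ?_
  rw [← mul_div_assoc, div_lt_iff₀ (by positivity)]
  nlinarith

variable {v : G → C_c(G, E)} (hv : Continuous fun p : G × G => v p.1 p.2)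
  (hs : HasCompactSupport fun p : G × G => v p.1 p.2)

include hv hs

theorem IndBdd.continuous {P : C_c(G, E) →ₗ[ℂ] X} (hP : IndBdd P) :
    Continuous fun h => P (v h) :=
  continuous_iff_continuousAt.2 fun _ => hP.continuousAt hv (hs.isCompact.image continuous_snd)
    (Eventually.of_forall fun x g hg => by
      by_contra h1
      exact hg ⟨(x, g), subset_tsupport _ h1, rfl⟩)

theorem hasCompactSupport_map (P : C_c(G, E) →ₗ[ℂ] X) : HasCompactSupport fun h => P (v h) :=
  HasCompactSupport.intro (hs.isCompact.image continuous_fst) fun h hh => by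
    have : v h = 0 := cc_ext fun g => by
      by_contra h1
      exact hh ⟨(h, g), subset_tsupport _ h1, rfl⟩
    rw [this, map_zero]

/-- The integral of the functions `v h` is only taken pointwise, since `C_c(G, E)` is not a Banach
space. After applying the separating family `l i`, both sides become double integrals over `G × G`
of a continuous compactly supported function, and Fubini's theorem applies. -/
theorem IndBdd.map_integral [CompleteSpace E] {X Y ι : Type*} [NormedAddCommGroup X]
    [NormedSpace ℂ X] [CompleteSpace X] [NormedAddCommGroup Y] [NormedSpace ℂ Y] [CompleteSpace Y]
    (μ : Measure G) [IsFiniteMeasureOnCompacts μ] {P : C_c(G, E) →ₗ[ℂ] X} (hP : IndBdd P)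
    (l : ι → X →L[ℂ] Y) (hl : ∀ x y : X, (∀ i, l i x = l i y) → x = y)
    (m : ι → G → E →L[ℂ] Y) (hm : ∀ i, Continuous fun p : G × E => m i p.1 p.2)
    (hlm : ∀ i k, l i (P k) = ∫ g, m i g (k g) ∂μ) {w : C_c(G, E)}
    (hw : ∀ g, w g = ∫ h, v h g ∂μ) : P w = ∫ h, P (v h) ∂μ := by
  refine hl _ _ fun i => ?_
  rw [← ContinuousLinearMap.integral_comp_comm (l i)
    ((hP.continuous hv hs).integrable_of_hasCompactSupport (hasCompactSupport_map hv hs P))]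
  simp only [hlm, hw]
  have hc : Continuous (Function.uncurry fun g h : G => m i g (v h g)) :=
    (hm i).comp (continuous_fst.prodMk (hv.comp (continuous_snd.prodMk continuous_fst)))
  have hcs : HasCompactSupport (Function.uncurry fun g h : G => m i g (v h g)) :=
    HasCompactSupport.intro (hs.isCompact.image continuous_swap) fun ⟨g, h⟩ hgh => by
      have : v h g = 0 := by
        by_contra h1
        exact hgh ⟨(h, g), subset_tsupport _ h1, rfl⟩
      change m i g (v h g) = 0
      rw [this, map_zero]
  rw [← integral_integral_swap_of_hasCompactSupport hc hcs]
  refine integral_congr_ae (Eventually.of_forall fun g => ?_)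
  refine (ContinuousLinearMap.integral_comp_comm (m i g) ?_).symm
  refine Continuous.integrable_of_hasCompactSupport
    (hv.comp (continuous_id.prodMk continuous_const)) ?_
  refine HasCompactSupport.intro (hs.isCompact.image continuous_fst) fun h hh => ?_
  by_contra h1
  exact hh ⟨(h, g), subset_tsupport _ h1, rfl⟩

end CompactSupport

/-! ### Cutoff functions converging to `1`. -/

section Cutoff

variable {G : Type*} [Group G] [TopologicalSpace G] [IsTopologicalGroup G] [T2Space G]
  [MeasurableSpace G] [BorelSpace G]

theorem exists_cutoff [LocallyCompactSpace G] {K : Set G} (hK : IsCompact K) :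
    ∃ χ : C_c(G, ℝ), (∀ g ∈ K, χ g = 1) ∧ ∀ g, 0 ≤ χ g ∧ χ g ≤ 1 := by
  obtain ⟨f, hf1, -, hf, hf01⟩ := exists_continuous_one_zero_of_isCompact hK isClosed_empty
    (Set.disjoint_empty K)
  exact ⟨⟨f, hf⟩, hf1, hf01⟩

/-- Urysohn functions `χ_K` equal to `1` on `K`, indexed by the directed set of compact sets,
converge to `1` uniformly on compact sets. Nontriviality of the filter makes limits along it unique.
-/
theorem cutoffFilter_neBot [LocallyCompactSpace G] : (cutoffFilter G).NeBot := by
  rw [cutoffFilter, inf_principal_neBot_iff]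
  rintro U ⟨V, hV, hVU⟩
  choose χ h1 h01 using fun K : TopologicalSpace.Compacts G => exists_cutoff K.isCompact
  have ht : Tendsto (fun K => (χ K).toContinuousMap) atTop (𝓝 (1 : C(G, ℝ))) := by
    refine ContinuousMap.tendsto_iff_forall_isCompact_tendstoUniformlyOn.2 fun K hK => ?_
    refine Metric.tendstoUniformlyOn_iff.2 fun ε hε => ?_
    filter_upwards [eventually_ge_atTop (⟨K, hK⟩ : TopologicalSpace.Compacts G)] with K' hK' g hg
    have : (χ K').toContinuousMap g = 1 := h1 K' g (hK' hg)
    rw [this]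
    simpa using hε
  obtain ⟨K, hK⟩ := (ht.eventually hV).exists
  exact ⟨χ K, hVU hK, h01 K⟩

theorem cutoffFilter_eventually_mem :
    ∀ᶠ χ in cutoffFilter G, ∀ g, 0 ≤ χ g ∧ χ g ≤ 1 :=
  (inf_le_right : cutoffFilter G ≤ _) (mem_principal_self _)

theorem cutoffFilter_eventually_lt {K : Set G} (hK : IsCompact K) {ε : ℝ} (hε : 0 < ε) :
    ∀ᶠ χ in cutoffFilter G, ∀ g ∈ K, ‖χ g - 1‖ < ε := by
  have ht : Tendsto (fun χ : C_c(G, ℝ) => χ.toContinuousMap) (cutoffFilter G)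
      (𝓝 (1 : C(G, ℝ))) := tendsto_comap.mono_left inf_le_left
  filter_upwards [Metric.tendstoUniformlyOn_iff.1
    (ContinuousMap.tendsto_iff_forall_isCompact_tendstoUniformlyOn.1 ht K hK) ε hε] with χ h g hg
  have := h g hg
  rwa [dist_comm, dist_eq_norm] at this

/-- Pointwise multiplication by `χ`. -/
def ccMul {E : Type*} [NormedAddCommGroup E] [NormedSpace ℂ E] (χ : C_c(G, ℝ)) :
    C_c(G, E) →ₗ[ℂ] C_c(G, E) where
  toFun f := ccMk (fun g => χ g • f g) (χ.continuous.smul f.continuous)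
    (hasCompactSupport_of_left f _ fun g h => by rw [h, smul_zero])
  map_add' f k := cc_ext fun g => smul_add (χ g) (f g) (k g)
  map_smul' c f := cc_ext fun g => smul_comm (χ g) c (f g)

theorem ccMul_apply {E : Type*} [NormedAddCommGroup E] [NormedSpace ℂ E] (χ : C_c(G, ℝ))
    (f : C_c(G, E)) (g : G) : ccMul χ f g = χ g • f g := rfl

/-- All `χ f` are supported in the support of `f`, and there `χ` tends to `1` uniformly; hence `χ f`
tends to `f` in the inductive limit sense. -/
theorem IndBdd.tendsto_ccMul {E X : Type*} [NormedAddCommGroup E] [NormedSpace ℂ E]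
    [SeminormedAddCommGroup X] [NormedSpace ℂ X] {P : C_c(G, E) →ₗ[ℂ] X} (hP : IndBdd P)
    (f : C_c(G, E)) : Tendsto (fun χ => P (ccMul χ f)) (cutoffFilter G) (𝓝 (P f)) := by
  obtain ⟨C, hC, h⟩ := hP (tsupport f) f.hasCompactSupport
  obtain ⟨M, hM⟩ := f.continuous.bounded_above_of_compact_support f.hasCompactSupport
  have hM0 : 0 ≤ M := (norm_nonneg _).trans (hM 1)
  refine Metric.tendsto_nhds.2 fun ε hε => ?_
  filter_upwards [cutoffFilter_eventually_lt f.hasCompactSupport.isCompact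
    (show 0 < ε / (C * M + 1) by positivity)] with χ hχ
  rw [dist_eq_norm, ← map_sub]
  have h2 : ‖P (ccMul χ f - f)‖ ≤ C * (ε / (C * M + 1) * M) := by
    refine h _ _ (fun g hg => ?_) fun g => ?_
    · rw [CompactlySupportedContinuousMap.sub_apply, ccMul_apply, cc_apply_eq_zero f hg, smul_zero,
        sub_zero]
    · rw [CompactlySupportedContinuousMap.sub_apply, ccMul_apply]
      by_cases hg : g ∈ tsupport f
      · have : χ g • f g - f g = (χ g - 1) • f g := by rw [sub_smul, one_smul]
        rw [this, norm_smul]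
        gcongr
        · exact (hχ g hg).le
        · exact hM g
      · rw [cc_apply_eq_zero f hg, smul_zero, sub_zero, norm_zero]; positivity
  refine h2.trans_lt ?_
  have : C * (ε / (C * M + 1) * M) = ε * (C * M) / (C * M + 1) := by ring
  rw [this, div_lt_iff₀ (by positivity)]
  nlinarith

variable (μ : Measure G) [μ.IsHaarMeasure] {B : Type*} [NonUnitalCStarAlgebra B]

theorem indBdd_toL2 : IndBdd (toL2 (B := B) μ) := fun S hS => by
  refine ⟨√(μ.real S), Real.sqrt_nonneg _, fun k M h0 hM => ?_⟩
  have hM0 : 0 ≤ M := (norm_nonneg _).trans (hM 1)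
  refine abs_le_of_sq_le_sq' ?_ (by positivity) |>.2
  rw [mul_pow, Real.sq_sqrt measureReal_nonneg, norm_sq_ip B, ip_toL2, mul_comm]
  refine norm_integral_le_of_support μ hS (fun g hg => by rw [h0 g hg, mul_zero]) fun g => ?_
  rw [CStarRing.norm_star_mul_self, pow_two]
  gcongr <;> exact hM g

theorem ip_ccMul (χ : C_c(G, ℝ)) (f k : C_c(G, B)) :
    ip B (toL2 μ (ccMul χ f)) (toL2 μ k) = ip B (toL2 μ f) (toL2 μ (ccMul χ k)) := by
  rw [ip_toL2, ip_toL2]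
  refine integral_congr_ae (Eventually.of_forall fun g => ?_)
  change star (χ g • f g) * k g = star (f g) * (χ g • k g)
  rw [star_smul, star_trivial, smul_mul_assoc, mul_smul_comm]

theorem norm_ccMul_le (χ : C_c(G, ℝ)) (hχ : ∀ g, 0 ≤ χ g ∧ χ g ≤ 1) (f : C_c(G, B)) :
    ‖toL2 μ (ccMul χ f)‖ ≤ 1 * ‖toL2 μ f‖ := by
  let _ := CStarAlgebra.spectralOrder B
  have _ := CStarAlgebra.spectralOrderedRing B
  rw [one_mul]
  refine abs_le_of_sq_le_sq' ?_ (norm_nonneg _) |>.2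
  rw [norm_sq_ip B, norm_sq_ip B (toL2 μ f), ip_toL2, ip_toL2]
  refine CStarAlgebra.norm_le_norm_of_nonneg_of_le
    (integral_nonneg fun g => star_mul_self_nonneg _)
    (integral_mono (cc_integrable μ (ccStarMul (ccMul χ f) (ccMul χ f)))
      (cc_integrable μ (ccStarMul f f)) fun g => ?_)
  change star (χ g • f g) * (χ g • f g) ≤ star (f g) * f g
  rw [star_smul, star_trivial, smul_mul_assoc, mul_smul_comm, smul_smul]
  refine (smul_le_smul_of_nonneg_right (a₁ := χ g * χ g) (a₂ := 1) ?_
    (star_mul_self_nonneg (f g))).trans_eq (one_smul _ _)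
  nlinarith [hχ g]

/-- Multiplication by a cutoff function is a self-adjoint contraction on `L²(G, B)`. The uniform
bound `1` is what allows passing to the limit `χ → 1` on the whole completion. -/
theorem exists_mulL2 (χ : C_c(G, ℝ)) (hχ : ∀ g, 0 ≤ χ g ∧ χ g ≤ 1) :
    ∃ T : L2 μ B →L[ℂ] L2 μ B, IsAdjointPair B T T ∧
      (∀ f, T (toL2 μ f) = toL2 μ (ccMul χ f)) ∧ ‖T‖ ≤ 1 := by
  obtain ⟨T, S, h1, h2, h3, h4⟩ := exists_isAdjointPair_extension (B := B) (toL2 (B := B) μ)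
    (toL2 (B := B) μ) (denseRange_toL2 μ) (denseRange_toL2 μ) (toL2 (B := B) μ ∘ₗ ccMul χ)
    (toL2 (B := B) μ ∘ₗ ccMul χ) zero_le_one (ip_ccMul μ χ) (norm_ccMul_le μ χ hχ)
  refine ⟨T, ?_, h2, h4⟩
  have : S = T := ContinuousLinearMap.ext fun x => by
    induction x using (denseRange_toL2 μ).induction_on with
    | hp => exact isClosed_eq S.continuous T.continuous
    | ih f => rw [h2, h3]
  rwa [this] at h1

end Cutoff

/-! ### Square-integrability and the existence of the operators `|ξ⟩⟩`. -/

section Kets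

variable {G : Type*} [Group G] [TopologicalSpace G] [IsTopologicalGroup G] [T2Space G]
  [MeasurableSpace G] [BorelSpace G] (μ : Measure G) [μ.IsHaarMeasure]
  {B : Type*} [NonUnitalCStarAlgebra B] [GCStarAlgebra G B]
  {E : Type*} [NormedAddCommGroup E] [NormedSpace ℂ E] [CompleteSpace E] [InnerModule B E]
  [GInnerModule G B E]

variable (B) in
-- Each group element acts isometrically, so strong continuity improves to joint continuity.
theorem continuous_actE_uncurry : Continuous fun p : G × E => actE B p.1 p.2 := by
  refine continuous_iff_continuousAt.2 fun ⟨g, x⟩ => tendsto_iff_norm_sub_tendsto_zero.2 ?_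
  have h1 : Tendsto (fun p : G × E => ‖p.2 - x‖ + ‖actE B p.1 x - actE B g x‖) (𝓝 (g, x))
      (𝓝 0) := by
    have hc : Continuous fun p : G × E => ‖p.2 - x‖ + ‖actE B p.1 x - actE B g x‖ :=
      (continuous_snd.sub continuous_const).norm.add
        ((((GInnerModule.continuous_act (B := B) x).comp continuous_fst).sub
          continuous_const).norm)
    simpa using hc.tendsto (g, x)
  refine squeeze_zero (fun _ => norm_nonneg _) (fun p => ?_) h1
  calc ‖actE B p.1 p.2 - actE B g x‖ = ‖actE B p.1 (p.2 - x) + (actE B p.1 x - actE B g x)‖ := by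
        rw [map_sub]; congr 1; abel
    _ ≤ _ := (norm_add_le _ _).trans_eq (by rw [norm_actE])

theorem Continuous.actE {α : Type*} [TopologicalSpace α] {f : α → G} {u : α → E}
    (hf : Continuous f) (hu : Continuous u) : Continuous fun a => actE B (f a) (u a) :=
  (continuous_actE_uncurry B).comp (hf.prodMk hu)

theorem rs_zero (x : E) : rs x (0 : B) = 0 := by
  rw [← zero_smul ℂ (0 : B), rs_smul, zero_smul]

/-- The function `g ↦ γ_g(ξ) f(g)` for `f` in `C_c(G, B)`. -/
def ccKet (ξ : E) : C_c(G, B) →ₗ[ℂ] C_c(G, E) where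
  toFun f := ccMk (fun g => rs (actE B g ξ) (f g))
    (by
      have h1 : Continuous fun g : G => actE B g ξ := GInnerModule.continuous_act (B := B) ξ
      have h2 : Continuous fun g : G => f g := f.continuous
      exact Continuous.rs (E := E) h1 h2)
    (HasCompactSupport.intro f.hasCompactSupport fun g hg => by
      rw [cc_apply_eq_zero f hg, rs_zero])
  map_add' f k := cc_ext fun g => rs_add (actE B g ξ) (f g) (k g)
  map_smul' c f := cc_ext fun g => rs_smul c (actE B g ξ) (f g)

theorem ccKet_apply (ξ : E) (f : C_c(G, B)) (g : G) : ccKet ξ f g = rs (actE B g ξ) (f g) := rfl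

theorem ip_integral_right (x : E) (f : C_c(G, E)) :
    ip B x (∫ g, f g ∂μ) = ∫ g, ip B x (f g) ∂μ :=
  ((ipSL B E x).integral_comp_comm (cc_integrable μ f)).symm

theorem ip_ketFun_right (ξ η : E) (f : C_c(G, B)) :
    ip B η (ketFun μ ξ f) = ∫ g, ip B η (actE B g ξ) * f g ∂μ := by
  refine (ip_integral_right μ η (ccKet ξ f)).trans ?_
  refine integral_congr_ae (Eventually.of_forall fun g => ?_)
  exact ip_rs_right _ _ _

theorem ip_ketFun_left (ξ η : E) (f : C_c(G, B)) :
    ip B (ketFun μ ξ f) η = ∫ g, star (f g) * ip B (actE B g ξ) η ∂μ := by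
  rw [← ip_star, ip_ketFun_right]
  refine Eq.trans ((starL' ℝ (A := B)).integral_comp_comm _).symm ?_
  refine integral_congr_ae (Eventually.of_forall fun g => ?_)
  change star (ip B η (actE B g ξ) * f g) = _
  rw [star_mul, ip_star]

theorem ketFun_eq (ξ : E) (f : C_c(G, B)) : ketFun μ ξ f = ∫ g, ccKet ξ f g ∂μ := rfl

/-- Before square-integrability is used, `f ↦ ∫ γ_g(ξ) f(g) dg` is only controlled by the supremum
norm on each compact set. This suffices to pass to the limit in `∫ γ_g(ξ) χ(g) f(g) dg`. -/
theorem indBdd_ketFun (ξ : E) :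
    IndBdd (ccIntegral μ ∘ₗ (ccKet ξ : C_c(G, B) →ₗ[ℂ] C_c(G, E))) :=
  IndBdd.comp_pointwise (E := E) (D := B) (indBdd_ccIntegral μ) (ccKet ξ) (c := ‖ξ‖) fun f g => by
    rw [ccKet_apply, ← norm_actE (B := B) g ξ]
    exact norm_rs_le _ _

theorem ketFun_add (ξ ξ' : E) (f : C_c(G, B)) :
    ketFun μ (ξ + ξ') f = ketFun μ ξ f + ketFun μ ξ' f := by
  rw [ketFun_eq, ketFun_eq, ketFun_eq, ← integral_add (cc_integrable μ _) (cc_integrable μ _)]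
  refine integral_congr_ae (Eventually.of_forall fun g => ?_)
  change rs (actE B g (ξ + ξ')) (f g) = _
  rw [map_add, add_rs]; rfl

variable {μ} in
theorem IsKet.add {ξ ξ' : E} {T T' : L2 μ B →L[ℂ] E} (h : IsKet μ ξ T) (h' : IsKet μ ξ' T') :
    IsKet μ (ξ + ξ') (T + T') :=
  ⟨(h.1.isAdjointPair.add h'.1.isAdjointPair).isAdjointable, fun f => by
    rw [_root_.add_apply, h.2, h'.2, ketFun_add]⟩

variable {μ} in
theorem IsKet.unique {ξ : E} {T T' : L2 μ B →L[ℂ] E} (h : IsKet μ ξ T) (h' : IsKet μ ξ T') :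
    T = T' :=
  ContinuousLinearMap.ext fun x => by
    induction x using (denseRange_toL2 μ).induction_on with
    | hp => exact isClosed_eq T.continuous T'.continuous
    | ih f => rw [h.2, h'.2]

variable {μ} in
theorem IsKet.ket_eq {ξ : E} {T : L2 μ B →L[ℂ] E} (h : IsKet μ ξ T) : ket μ B ξ = T := by
  have h1 : ∃ T, IsKet μ ξ T := ⟨T, h⟩
  rw [ket, dif_pos h1]
  exact h1.choose_spec.unique h

variable {μ} in
/-- If the operator `|ξ⟩⟩` exists, then `ξ` is square-integrable. -/
theorem IsKet.squareIntegrable {ξ : E} {T : L2 μ B →L[ℂ] E} (h : IsKet μ ξ T) :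
    SquareIntegrable μ B ξ := by
  intro η
  obtain ⟨S, hS⟩ := h.1
  choose! m hm1 hm2 hm3 using exists_mulL2 (B := B) μ
  -- The truncation of `g ↦ ⟨γ_g(ξ), η⟩` by `χ` is the multiplication operator of `χ` applied to `T*
  -- η`. So the limit has to be `T* η`.
  have h1 : ∀ χ : C_c(G, ℝ), (∀ g, 0 ≤ χ g ∧ χ g ≤ 1) →
      toL2 μ (braTrunc ξ η χ) = m χ (S η) := fun χ hχ => by
    refine eq_of_forall_ip_toL2 μ fun k => ?_
    rw [← hm1 χ hχ, hm2 χ hχ, ← hS, h.2, ip_ketFun_left, ip_toL2]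
    refine integral_congr_ae (Eventually.of_forall fun g => ?_)
    change star (k g) * (χ g • ip B (actE B g ξ) η) = star (χ g • k g) * ip B (actE B g ξ) η
    rw [star_smul, star_trivial (χ g), smul_mul_assoc, mul_smul_comm]
  refine ⟨S η, Metric.tendsto_nhds.2 fun ε hε => ?_⟩
  -- Convergence `χ f → f` is known for `f` in `C_c(G, B)`. It passes to `T* η` by an `ε/3` argument
  -- because the multiplication operators are contractions.
  obtain ⟨f, hf⟩ := (denseRange_toL2 (B := B) μ).exists_dist_lt (S η) (show 0 < ε / 3 by positivity)
  filter_upwards [cutoffFilter_eventually_mem, Metric.tendsto_nhds.1 ((indBdd_toL2 μ).tendsto_ccMul f) (ε / 3)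
    (by positivity)] with χ hχ h2
  rw [h1 χ hχ]
  have h3 : dist (m χ (S η)) (m χ (toL2 μ f)) ≤ dist (S η) (toL2 μ f) := by
    rw [dist_eq_norm, ← map_sub, dist_eq_norm]
    simpa using (m χ).le_of_opNorm_le (hm3 χ hχ) (S η - toL2 μ f)
  rw [hm2 χ hχ] at h3
  have h4 := dist_triangle4 (m χ (S η)) (toL2 μ (ccMul χ f)) (toL2 μ f) (S η)
  rw [dist_comm (toL2 μ f)] at h4
  linarith

variable {μ} in
/-- If `ξ` is square-integrable, then the operator `|ξ⟩⟩` exists. -/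
theorem SquareIntegrable.exists_isKet [LocallyCompactSpace G] {ξ : E}
    (h : SquareIntegrable μ B ξ) : ∃ T : L2 μ B →L[ℂ] E, IsKet μ ξ T := by
  have _ : (cutoffFilter G).NeBot := cutoffFilter_neBot
  choose F hF using h
  -- The limits `F η` form the formal adjoint of `f ↦ ∫ γ_g(ξ) f(g) dg`: in the pairing with `f`,
  -- the cutoff can be moved to `f`, where it disappears in the limit.
  have hip : ∀ η (f : C_c(G, B)), ip B (toL2 μ f) (F η) = ip B (ketFun μ ξ f) η := by
    intro η f
    have h1 : Tendsto (fun χ => ip B (toL2 μ f) (toL2 μ (braTrunc ξ η χ))) (cutoffFilter G)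
        (𝓝 (ip B (toL2 μ f) (F η))) :=
      (((continuous_const (y := toL2 μ f)).ip (B := B) continuous_id).tendsto _).comp (hF η)
    have h2 : Tendsto (fun χ => ip B (toL2 μ f) (toL2 μ (braTrunc ξ η χ))) (cutoffFilter G)
        (𝓝 (ip B (ketFun μ ξ f) η)) := by
      have h3 : ∀ χ, ip B (toL2 μ f) (toL2 μ (braTrunc ξ η χ)) =
          ∫ g, star (ccMul χ f g) * ip B (actE B g ξ) η ∂μ := fun χ => by
        rw [ip_toL2]
        refine integral_congr_ae (Eventually.of_forall fun g => ?_)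
        change star (f g) * (χ g • ip B (actE B g ξ) η) = star (χ g • f g) * ip B (actE B g ξ) η
        rw [star_smul, star_trivial (χ g), smul_mul_assoc, mul_smul_comm]
      simp only [h3, ← ip_ketFun_left]
      have h4 : Tendsto (fun χ => ketFun μ ξ (ccMul χ f)) (cutoffFilter G)
          (𝓝 (ketFun μ ξ f)) := (indBdd_ketFun μ ξ).tendsto_ccMul f
      exact ((continuous_id.ip (B := B) (continuous_const (y := η))).tendsto _).comp h4
    exact tendsto_nhds_unique h1 h2
  let S : E →ₗ[ℂ] L2 μ B :=
    { toFun := F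
      map_add' := fun η η' => eq_of_forall_ip_toL2 μ fun f => by
        rw [ip_add_right, hip, hip, hip, ip_add_right]
      map_smul' := fun c η => eq_of_forall_ip_toL2 μ fun f => by
        rw [RingHom.id_apply, ip_smul_right, hip, hip, ip_smul_right] }
  -- Boundedness of `η ↦ F η` comes from the closed graph theorem; the pairing with `C_c(G, B)`
  -- determines elements of `L²(G, B)`, and this closes the graph.
  have hSc : Continuous S := by
    refine S.continuous_of_seq_closed_graph fun u x y hu hy => ?_
    refine eq_of_forall_ip_toL2 μ fun f => ?_
    refine Eq.trans ?_ (hip x f).symm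
    have h1 : Tendsto (fun n => ip B (toL2 μ f) (S (u n))) atTop (𝓝 (ip B (toL2 μ f) y)) :=
      (((continuous_const (y := toL2 μ f)).ip (B := B) continuous_id).tendsto _).comp hy
    have h2 : Tendsto (fun n => ip B (ketFun μ ξ f) (u n)) atTop (𝓝 (ip B (ketFun μ ξ f) x)) :=
      (((continuous_const (y := ketFun μ ξ f)).ip (B := B) continuous_id).tendsto _).comp hu
    exact tendsto_nhds_unique h1 (h2.congr fun n => (hip (u n) f).symm)
  let S' : E →L[ℂ] L2 μ B := ⟨S, hSc⟩
  -- The bounded map is `S`, defined on all of `E`, so the dense map into `E` is the identity. The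
  -- ket operator arises as the extension of the formal adjoint, whose boundedness is automatic.
  obtain ⟨S₂, T, h1, h2, h3, -⟩ := exists_isAdjointPair_extension (B := B)
    (LinearMap.id : E →ₗ[ℂ] E) (toL2 (B := B) μ) (denseRange_id) (denseRange_toL2 μ) S
    (ccIntegral μ ∘ₗ ccKet ξ) (norm_nonneg S') (fun x f => by
      have := congrArg star (hip x f)
      rwa [ip_star, ip_star] at this) (fun x => S'.le_opNorm x)
  exact ⟨T, h1.symm.isAdjointable, h3⟩

end Kets

/-! ### The Hilbert module `L²(G, E)`. -/

section L2E

open UniformSpace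

variable {G : Type*} [Group G] [TopologicalSpace G] [IsTopologicalGroup G] [T2Space G]
  [MeasurableSpace G] [BorelSpace G]

/-- The space `C_c(G, E)`, to be equipped with the `B`-valued inner product given by the measure
`μ`. -/
def PreL2E (_μ : Measure G) (_B E : Type*) [NormedAddCommGroup E] : Type _ := C_c(G, E)

variable (μ : Measure G) (B E : Type*) [NonUnitalCStarAlgebra B]
  [NormedAddCommGroup E] [NormedSpace ℂ E] [InnerModule B E]

instance : AddCommGroup (PreL2E μ B E) := inferInstanceAs (AddCommGroup C_c(G, E))
instance : Module ℂ (PreL2E μ B E) := inferInstanceAs (Module ℂ C_c(G, E))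

variable {E} in
/-- The pointwise inner product of functions in `C_c(G, E)`. -/
def ccIp (f k : C_c(G, E)) : C_c(G, B) :=
  ccMk (fun g => ip B (f g) (k g))
    (by
      have hf : Continuous fun g => f g := f.continuous
      have hk : Continuous fun g => k g := k.continuous
      exact Continuous.ip (E := E) hf hk)
    (HasCompactSupport.intro f.hasCompactSupport fun g hg => by
      rw [cc_apply_eq_zero f hg, ip_zero_left])

variable {B E} in
/-- The pointwise right action of `b` on `C_c(G, E)`. -/
def ccRsE (f : C_c(G, E)) (b : B) : C_c(G, E) :=
  ccMk (fun g => rs (f g) b)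
    (by
      have hf : Continuous fun g => f g := f.continuous
      exact Continuous.rs (E := E) hf continuous_const)
    (hasCompactSupport_of_left f _ fun g h => by
      rw [h, ← rsL_apply, map_zero])

variable [μ.IsHaarMeasure]

/-- The space `C_c(G, E)` with `⟨f, k⟩ = ∫ ⟨f(g), k(g)⟩ dg` and `(f · b)(g) = f(g) b`. -/
instance PreL2E.semiInnerModule : SemiInnerModule B (PreL2E μ B E) where
  inner (f k : C_c(G, E)) := ∫ g, ccIp B f k g ∂μ
  rsmul (f : C_c(G, E)) b := (ccRsE f b : C_c(G, E))
  add_rsmul f k b := cc_ext (f := (_ : C_c(G, E))) (k := (_ : C_c(G, E)))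
    fun g => add_rs (V := E) _ _ _
  smul_rsmul c f b := cc_ext (f := (_ : C_c(G, E))) (k := (_ : C_c(G, E)))
    fun g => smul_rs (V := E) _ _ _
  rsmul_add f b b' := cc_ext (f := (_ : C_c(G, E))) (k := (_ : C_c(G, E)))
    fun g => rs_add (V := E) _ _ _
  rsmul_smul c f b := cc_ext (f := (_ : C_c(G, E))) (k := (_ : C_c(G, E)))
    fun g => rs_smul (V := E) _ _ _
  rsmul_mul f b b' := cc_ext (f := (_ : C_c(G, E))) (k := (_ : C_c(G, E)))
    fun g => rs_mul (V := E) _ _ _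
  inner_add_right (f k l : C_c(G, E)) := by
    refine Eq.trans ?_ (integral_add (cc_integrable μ _) (cc_integrable μ _))
    exact integral_congr_ae (Eventually.of_forall fun g => ip_add_right (V := E) _ _ _)
  inner_smul_right c (f k : C_c(G, E)) := by
    refine Eq.trans ?_ (integral_smul c _)
    exact integral_congr_ae (Eventually.of_forall fun g => ip_smul_right (V := E) _ _ _)
  inner_rsmul_right (f k : C_c(G, E)) b := by
    refine Eq.trans ?_ (((ContinuousLinearMap.mul ℂ B).flip b).integral_comp_comm
      (cc_integrable μ (ccIp B f k)))
    exact integral_congr_ae (Eventually.of_forall fun g => ip_rs_right (V := E) _ _ _)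
  star_inner (f k : C_c(G, E)) := by
    refine Eq.trans ((starL' ℝ (A := B)).integral_comp_comm _).symm ?_
    exact integral_congr_ae (Eventually.of_forall fun g => ip_star (V := E) _ _)
  inner_self_nonneg (f : C_c(G, E)) := by
    let _ := CStarAlgebra.spectralOrder B
    have _ := CStarAlgebra.spectralOrderedRing B
    refine CStarAlgebra.nonneg_iff_eq_star_mul_self.1 (integral_nonneg fun g => ?_)
    exact CStarAlgebra.nonneg_iff_eq_star_mul_self.2 (ip_self_nonneg (f g))

instance : SeminormedAddCommGroup (PreL2E μ B E) :=
  SemiInnerModule.toSeminormedAddCommGroup B (PreL2E μ B E)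
instance : NormedSpace ℂ (PreL2E μ B E) := SemiInnerModule.toNormedSpace B (PreL2E μ B E)
instance : InnerModule B (PreL2E μ B E) := SemiInnerModule.toInnerModule B (PreL2E μ B E)

/-- The Hilbert `B`-module `L²(G, E)`: the completion of `C_c(G, E)` with respect to the inner
product `⟨f, k⟩ = ∫ ⟨f(g), k(g)⟩ dg`. -/
abbrev L2E : Type _ := Completion (PreL2E μ B E)

/-- The canonical map `C_c(G, E) → L²(G, E)`. -/
def toL2E : C_c(G, E) →ₗ[ℂ] L2E μ B E :=
  (Completion.toComplL (𝕜 := ℂ) (E := PreL2E μ B E) : PreL2E μ B E →ₗ[ℂ] L2E μ B E)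

variable {B E}

theorem ip_toL2E (f k : C_c(G, E)) :
    ip B (toL2E μ B E f) (toL2E μ B E k) = ∫ g, ip B (f g) (k g) ∂μ :=
  ip_coe (V := PreL2E μ B E) f k

theorem denseRange_toL2E : DenseRange (toL2E μ B E : C_c(G, E) → L2E μ B E) :=
  Completion.denseRange_coe (α := PreL2E μ B E)

theorem eq_of_forall_ip_toL2E {x y : L2E μ B E}
    (h : ∀ k : C_c(G, E), ip B (toL2E μ B E k) x = ip B (toL2E μ B E k) y) : x = y := by
  refine eq_of_forall_ip B fun z => ?_
  induction z using (denseRange_toL2E μ).induction_on with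
  | hp => exact isClosed_eq (continuous_id.ip continuous_const) (continuous_id.ip continuous_const)
  | ih k => exact h k

theorem indBdd_toL2E : IndBdd (toL2E (G := G) μ B E) := fun S hS => by
  refine ⟨√(μ.real S), Real.sqrt_nonneg _, fun k M h0 hM => ?_⟩
  have hM0 : 0 ≤ M := (norm_nonneg _).trans (hM 1)
  refine abs_le_of_sq_le_sq' ?_ (by positivity) |>.2
  rw [mul_pow, Real.sq_sqrt measureReal_nonneg, norm_sq_ip B, ip_toL2E, mul_comm]
  refine norm_integral_le_of_support μ hS (fun g hg => by rw [h0 g hg, ip_zero_right]) fun g => ?_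
  refine (norm_ip_le _ _).trans ?_
  rw [pow_two]
  gcongr <;> exact hM g

/-- Pairings with functions `l` in `C_c(G, E)` separate points of `L²(G, E)` and are themselves
integrals over `G`, so a pointwise integral of functions agrees with the Bochner integral in `L²(G,
E)`. -/
theorem toL2E_integral [CompleteSpace E] {v : G → C_c(G, E)}
    (hv : Continuous fun p : G × G => v p.1 p.2)
    (hs : HasCompactSupport fun p : G × G => v p.1 p.2) {w : C_c(G, E)}
    (hw : ∀ g, w g = ∫ h, v h g ∂μ) : toL2E μ B E w = ∫ h, toL2E μ B E (v h) ∂μ :=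
  (indBdd_toL2E μ).map_integral hv hs μ (fun l => ipSL B (L2E μ B E) (toL2E μ B E l))
    (fun _ _ h => eq_of_forall_ip_toL2E μ h) (fun l g => ipSL B E (l g))
    (fun l => by
      have h1 : Continuous fun p : G × E => l p.1 := l.continuous.comp continuous_fst
      exact Continuous.ip (E := E) h1 continuous_snd)
    (fun l k => ip_toL2E μ l k) hw

theorem toL2_integral {v : G → C_c(G, B)}
    (hv : Continuous fun p : G × G => v p.1 p.2)
    (hs : HasCompactSupport fun p : G × G => v p.1 p.2) {w : C_c(G, B)}
    (hw : ∀ g, w g = ∫ h, v h g ∂μ) : toL2 μ w = ∫ h, toL2 μ (v h) ∂μ :=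
  (indBdd_toL2 μ).map_integral hv hs μ (fun l => ipSL B (L2 μ B) (toL2 μ l))
    (fun _ _ h => eq_of_forall_ip_toL2 μ h) (fun l g => ContinuousLinearMap.mul ℂ B (star (l g)))
    (fun l => by
      have h1 : Continuous fun p : G × B => l p.1 := l.continuous.comp continuous_fst
      exact h1.star.mul continuous_snd)
    (fun l k => ip_toL2 μ l k) hw

theorem L2.ext_toL2 {X : Type*} [NormedAddCommGroup X] [NormedSpace ℂ X] {T S : L2 μ B →L[ℂ] X}
    (h : ∀ f, T (toL2 μ f) = S (toL2 μ f)) : T = S :=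
  ContinuousLinearMap.ext fun x => by
    induction x using (denseRange_toL2 μ).induction_on with
    | hp => exact isClosed_eq T.continuous S.continuous
    | ih f => exact h f

end L2E

/-! ### The operators `|ξ⟩` from `L²(G, B)` to `L²(G, E)`. -/

section KetOperators

variable {G : Type*} [Group G] [TopologicalSpace G] [IsTopologicalGroup G] [T2Space G]
  [MeasurableSpace G] [BorelSpace G] (μ : Measure G) [μ.IsHaarMeasure]
  {B : Type*} [NonUnitalCStarAlgebra B] [GCStarAlgebra G B]
  {E : Type*} [NormedAddCommGroup E] [NormedSpace ℂ E] [CompleteSpace E] [InnerModule B E]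
  [GInnerModule G B E]

/-- The function `g ↦ ⟨γ_g(ξ), k(g)⟩` for `k` in `C_c(G, E)`. -/
def ccBra (ξ : E) : C_c(G, E) →ₗ[ℂ] C_c(G, B) where
  toFun k := ccMk (fun g => ip B (actE B g ξ) (k g))
    (by
      have h1 : Continuous fun g : G => actE B g ξ := GInnerModule.continuous_act (B := B) ξ
      have h2 : Continuous fun g : G => k g := k.continuous
      exact Continuous.ip (E := E) h1 h2)
    (HasCompactSupport.intro k.hasCompactSupport fun g hg => by
      rw [cc_apply_eq_zero k hg, ip_zero_right])
  map_add' f k := cc_ext fun g => ip_add_right (actE B g ξ) (f g) (k g)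
  map_smul' c f := cc_ext fun g => ip_smul_right c (actE B g ξ) (f g)

theorem ccBra_apply (ξ : E) (k : C_c(G, E)) (g : G) :
    ccBra (B := B) ξ k g = ip B (actE B g ξ) (k g) := rfl

theorem ip_ccKet (ξ : E) (f : C_c(G, B)) (k : C_c(G, E)) :
    ip B (toL2E μ B E (ccKet ξ f)) (toL2E μ B E k) = ip B (toL2 μ f) (toL2 μ (ccBra ξ k)) := by
  rw [ip_toL2E, ip_toL2]
  exact integral_congr_ae (Eventually.of_forall fun g => ip_rs_left _ _ _)

/-- Equivariance of the inner product, `⟨γ_g(ξ), γ_g(η)⟩ = β_g(⟨ξ, η⟩)`, is exactly what turns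
`⟨ξ|η⟩` into the multiplier `ρ_b` with `b = ⟨ξ, η⟩`. -/
theorem ccBra_ccKet (ξ η : E) (f : C_c(G, B)) : ccBra ξ (ccKet η f) = ccRhoB (ip B ξ η) f :=
  cc_ext fun g => by
    rw [ccBra_apply, ccKet_apply, ip_rs_right, GInnerModule.inner_act, ccRhoB_apply]

theorem norm_ccKet_le (ξ : E) (f : C_c(G, B)) :
    ‖toL2E μ B E (ccKet ξ f)‖ ≤ ‖ξ‖ * ‖toL2 μ f‖ := by
  refine abs_le_of_sq_le_sq' ?_ (by positivity) |>.2
  rw [norm_sq_ip B, ip_ccKet, ccBra_ccKet]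
  refine (norm_ip_le _ _).trans ?_
  refine (mul_le_mul_of_nonneg_left (norm_ccRhoB_le μ (ip B ξ ξ) f) (norm_nonneg _)).trans_eq ?_
  rw [← norm_sq_ip B]
  ring

variable (B) in
theorem exists_ketL (ξ : E) : ∃ (T : L2 μ B →L[ℂ] L2E μ B E) (S : L2E μ B E →L[ℂ] L2 μ B),
    IsAdjointPair B T S ∧ (∀ f, T (toL2 μ f) = toL2E μ B E (ccKet ξ f)) ∧
      (∀ k, S (toL2E μ B E k) = toL2 μ (ccBra ξ k)) ∧ ‖T‖ ≤ ‖ξ‖ := by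
  obtain ⟨T, S, h1, h2, h3, h4⟩ := exists_isAdjointPair_extension (B := B) (toL2 (B := B) μ)
    (toL2E μ B E) (denseRange_toL2 μ) (denseRange_toL2E μ)
    (toL2E μ B E ∘ₗ (ccKet ξ : C_c(G, B) →ₗ[ℂ] C_c(G, E)))
    (toL2 (B := B) μ ∘ₗ ccBra ξ) (norm_nonneg ξ) (ip_ccKet μ ξ) (norm_ccKet_le μ ξ)
  exact ⟨T, S, h1, h2, h3, h4⟩

variable (B) in
/-- The operator `|ξ⟩ : L²(G, B) → L²(G, E)`, `f ↦ (g ↦ γ_g(ξ) f(g))`. -/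
def ketL (ξ : E) : L2 μ B →L[ℂ] L2E μ B E := (exists_ketL μ B ξ).choose

variable (B) in
/-- The adjoint `k ↦ (g ↦ ⟨γ_g(ξ), k(g)⟩)` of `|ξ⟩`. -/
def braL (ξ : E) : L2E μ B E →L[ℂ] L2 μ B := (exists_ketL μ B ξ).choose_spec.choose

theorem isAdjointPair_ketL (ξ : E) : IsAdjointPair B (ketL μ B ξ) (braL μ B ξ) :=
  (exists_ketL μ B ξ).choose_spec.choose_spec.1

theorem ketL_toL2 (ξ : E) (f : C_c(G, B)) : ketL μ B ξ (toL2 μ f) = toL2E μ B E (ccKet ξ f) :=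
  (exists_ketL μ B ξ).choose_spec.choose_spec.2.1 f

theorem braL_toL2E (ξ : E) (k : C_c(G, E)) : braL μ B ξ (toL2E μ B E k) = toL2 μ (ccBra ξ k) :=
  (exists_ketL μ B ξ).choose_spec.choose_spec.2.2.1 k

theorem ketL_add (ξ ξ' : E) : ketL μ B (ξ + ξ') = ketL μ B ξ + ketL μ B ξ' :=
  L2.ext_toL2 μ fun f => by
    rw [_root_.add_apply, ketL_toL2, ketL_toL2, ketL_toL2, ← map_add]
    congr 1
    refine cc_ext fun g => ?_
    change rs (actE B g (ξ + ξ')) (f g) = rs (actE B g ξ) (f g) + rs (actE B g ξ') (f g)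
    rw [map_add, add_rs]

theorem ketL_smul (c : ℂ) (ξ : E) : ketL μ B (c • ξ) = c • ketL μ B ξ :=
  L2.ext_toL2 μ fun f => by
    rw [_root_.smul_apply, ketL_toL2, ketL_toL2, ← map_smul]
    congr 1
    refine cc_ext fun g => ?_
    change rs (actE B g (c • ξ)) (f g) = c • rs (actE B g ξ) (f g)
    rw [map_smul, smul_rs]

/-- This is why `η ⊗ x ↦ |η⟩ x` respects inner products: the inner product of `E ⊗_B C*_r(G, B)` is
built from the same multipliers `ρ_b`. -/
theorem ip_ketL (ξ η : E) (f k : L2 μ B) :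
    ip B (ketL μ B ξ f) (ketL μ B η k) = ip B f ((rhoB μ (ip B ξ η)).1 k) := by
  rw [isAdjointPair_ketL]
  congr 1
  have : (braL μ B ξ).comp (ketL μ B η) = (rhoB μ (ip B ξ η)).1 := L2.ext_toL2 μ fun f => by
    rw [ContinuousLinearMap.comp_apply, ketL_toL2, braL_toL2E, ccBra_ccKet, rhoB_toL2]
  exact DFunLike.congr_fun this k

end KetOperators

/-! ### Unitaries out of interior tensor products. -/

section Representation

variable {A B E₂ : Type*} [NonUnitalCStarAlgebra A] [NonUnitalCStarAlgebra B]
  [NormedAddCommGroup E₂] [NormedSpace ℂ E₂] [CompleteSpace E₂] [InnerModule B E₂]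
  (φ : A →⋆ₙₐ[ℂ] AdjAlg B E₂)

/-- A *-homomorphism `φ : A → AdjAlg B E₂` as a continuous linear map. -/
def reprL : A →L[ℂ] (E₂ →L[ℂ] E₂) :=
  LinearMap.mkContinuous
    { toFun := fun a => (φ a : E₂ →L[ℂ] E₂)
      map_add' := fun a b => by rw [map_add]; rfl
      map_smul' := fun c a => by rw [map_smul]; rfl } 1 fun a => by
    rw [one_mul]; exact NonUnitalStarAlgHom.norm_apply_le φ a

theorem reprL_apply (a : A) : reprL φ a = (φ a : E₂ →L[ℂ] E₂) := rfl

theorem norm_repr_apply_le (a : A) (x : E₂) : ‖(φ a : E₂ →L[ℂ] E₂) x‖ ≤ ‖a‖ * ‖x‖ :=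
  ((φ a : E₂ →L[ℂ] E₂).le_opNorm x).trans
    (mul_le_mul_of_nonneg_right (NonUnitalStarAlgHom.norm_apply_le φ a) (norm_nonneg x))

theorem Continuous.repr {α : Type*} [TopologicalSpace α] {f : α → A} {u : α → E₂}
    (hf : Continuous f) (hu : Continuous u) :
    Continuous fun x => (φ (f x) : E₂ →L[ℂ] E₂) (u x) := by
  simp only [← reprL_apply]
  fun_prop

/-- A map on the algebraic tensor product that preserves the inner products and has dense range
extends to a unitary operator. -/
theorem exists_unitary_of_ip {E₁ F : Type*} [NormedAddCommGroup E₁] [NormedSpace ℂ E₁]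
    [InnerModule A E₁] [NormedAddCommGroup F] [NormedSpace ℂ F] [CompleteSpace F] [InnerModule B F]
    (t : PreTensor E₁ φ →ₗ[ℂ] F) (ht : DenseRange t)
    (h : ∀ x ξ y η, ip B (t (PreTensor.tmul φ x ξ)) (t (PreTensor.tmul φ y η)) =
      ip B ξ ((φ (ip A x y) : E₂ →L[ℂ] E₂) η)) :
    ∃ (U : InteriorTensor E₁ φ →L[ℂ] F) (V : F →L[ℂ] InteriorTensor E₁ φ), IsAdjointPair B U V ∧
      U.comp V = .id ℂ F ∧ V.comp U = .id ℂ _ ∧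
      ∀ x ξ, U (InteriorTensor.tmul φ x ξ) = t (PreTensor.tmul φ x ξ) := by
  have h1 : ∀ x y : PreTensor E₁ φ, ip B (t x) (t y) = ip B x y := fun x y => by
    induction x using PreTensor.induction with
    | h0 => rw [map_zero, ip_zero_left, ip_zero_left]
    | h2 x x' hx hx' => rw [map_add, ip_add_left, ip_add_left, hx, hx']
    | h1 x ξ =>
      induction y using PreTensor.induction with
      | h0 => rw [map_zero, ip_zero_right, ip_zero_right]
      | h2 y y' hy hy' => rw [map_add, ip_add_right, ip_add_right, hy, hy']
      | h1 y η => rw [h, PreTensor.ip_tmul]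
  -- The map `t` is both the map to be extended and the dense map into `F`. Its formal adjoint
  -- therefore sends `t x` back to `x`, and the adjoint of the extension is its inverse.
  obtain ⟨U, V, h2, h3, h4, -⟩ := exists_isAdjointPair_extension (B := B)
    (PreTensor.toInterior E₁ φ) t (PreTensor.denseRange_toInterior φ) ht t
    (PreTensor.toInterior E₁ φ) zero_le_one
    (fun x y => by rw [h1, PreTensor.ip_toInterior])
    (fun x => by
      rw [one_mul, PreTensor.norm_toInterior, InnerModule.norm_eq_sqrt (B := B), h1,
        ← InnerModule.norm_eq_sqrt])
  refine ⟨U, V, h2, ContinuousLinearMap.ext fun y => ?_, ContinuousLinearMap.ext fun x => ?_,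
    fun x ξ => h3 _⟩
  · induction y using ht.induction_on with
    | hp => exact isClosed_eq (ContinuousLinearMap.continuous _) (ContinuousLinearMap.continuous _)
    | ih y => rw [ContinuousLinearMap.comp_apply, h4, h3]; rfl
  · induction x using (PreTensor.denseRange_toInterior φ).induction_on with
    | hp => exact isClosed_eq (ContinuousLinearMap.continuous _) (ContinuousLinearMap.continuous _)
    | ih x => rw [ContinuousLinearMap.comp_apply, h3, h4]; rfl

theorem exists_extension {V X Y : Type*} [AddCommGroup V] [Module ℂ V] [NormedAddCommGroup X]
    [NormedSpace ℂ X] [NormedAddCommGroup Y] [NormedSpace ℂ Y] [CompleteSpace Y]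
    (e : V →ₗ[ℂ] X) (he : DenseRange e) (t : V →ₗ[ℂ] Y) {c : ℝ} (h : ∀ x, ‖t x‖ ≤ c * ‖e x‖) :
    ∃ T : X →L[ℂ] Y, ∀ x, T (e x) = t x :=
  ⟨t.extendOfNorm e, LinearMap.extendOfNorm_eq he ⟨c, h⟩⟩

end Representation

/-! ### The unitary from `L²(G, A) ⊗_A E₂` to `L²(G, E₂)`. -/

section Amplification

variable {G : Type*} [Group G] [TopologicalSpace G] [IsTopologicalGroup G] [T2Space G]
  [MeasurableSpace G] [BorelSpace G] (μ : Measure G) [μ.IsHaarMeasure]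
  {A B E₂ : Type*} [NonUnitalCStarAlgebra A] [NonUnitalCStarAlgebra B]
  [NormedAddCommGroup E₂] [NormedSpace ℂ E₂] [CompleteSpace E₂] [InnerModule B E₂]
  (φ : A →⋆ₙₐ[ℂ] AdjAlg B E₂)

/-- The function `g ↦ φ(f(g)) ζ` for `f` in `C_c(G, A)`. -/
def ccAmp (ζ : E₂) : C_c(G, A) →ₗ[ℂ] C_c(G, E₂) where
  toFun f := ccMk (fun g => (φ (f g) : E₂ →L[ℂ] E₂) ζ)
    (Continuous.repr φ f.continuous continuous_const)
    (HasCompactSupport.intro f.hasCompactSupport fun g hg => by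
      rw [cc_apply_eq_zero f hg, map_zero]; rfl)
  map_add' f k := cc_ext fun g => by
    change (φ (f g + k g) : E₂ →L[ℂ] E₂) ζ = _
    rw [map_add]; rfl
  map_smul' c f := cc_ext fun g => by
    change (φ (c • f g) : E₂ →L[ℂ] E₂) ζ = _
    rw [map_smul]; rfl

theorem ccAmp_apply (ζ : E₂) (f : C_c(G, A)) (g : G) :
    ccAmp φ ζ f g = (φ (f g) : E₂ →L[ℂ] E₂) ζ := rfl

/-- Pulling the bounded linear map `a ↦ ⟨ζ, φ(a) ζ'⟩` out of `∫ f(g)* k(g) dg` shows that `f ⊗ ζ ↦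
φ(f) ζ` preserves inner products. The group action plays no role here. -/
theorem ip_ccAmp (ζ ζ' : E₂) (f k : C_c(G, A)) :
    ip B (toL2E μ B E₂ (ccAmp φ ζ f)) (toL2E μ B E₂ (ccAmp φ ζ' k)) =
      ip B ζ ((φ (ip A (toL2 μ f) (toL2 μ k)) : E₂ →L[ℂ] E₂) ζ') := by
  rw [ip_toL2E, ip_toL2]
  refine Eq.trans ?_ (((ipSL B E₂ ζ).comp ((reprL φ).flip ζ')).integral_comp_comm
    (cc_integrable μ (ccStarMul f k)))
  refine integral_congr_ae (Eventually.of_forall fun g => ?_)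
  change ip B ((φ (f g) : E₂ →L[ℂ] E₂) ζ) ((φ (k g) : E₂ →L[ℂ] E₂) ζ') =
    ip B ζ ((φ (star (f g) * k g) : E₂ →L[ℂ] E₂) ζ')
  rw [(φ (f g)).isAdjointPair, map_mul, map_star]
  rfl

theorem norm_ccAmp_le (ζ : E₂) (f : C_c(G, A)) :
    ‖toL2E μ B E₂ (ccAmp φ ζ f)‖ ≤ ‖ζ‖ * ‖toL2 μ f‖ := by
  refine abs_le_of_sq_le_sq' ?_ (by positivity) |>.2
  rw [norm_sq_ip B, ip_ccAmp]
  refine (norm_ip_le _ _).trans ?_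
  refine (mul_le_mul_of_nonneg_left (norm_repr_apply_le φ _ ζ) (norm_nonneg _)).trans_eq ?_
  rw [← norm_sq_ip A]
  ring

theorem exists_ampL (ζ : E₂) : ∃ T : L2 μ A →L[ℂ] L2E μ B E₂,
    ∀ f, T (toL2 μ f) = toL2E μ B E₂ (ccAmp φ ζ f) := by
  obtain ⟨T, hT⟩ := exists_extension (toL2 (B := A) μ) (denseRange_toL2 μ)
    (toL2E μ B E₂ ∘ₗ (ccAmp φ ζ : C_c(G, A) →ₗ[ℂ] C_c(G, E₂))) (norm_ccAmp_le μ φ ζ)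
  exact ⟨T, hT⟩

/-- The operator `f ↦ φ(f) ζ` from `L²(G, A)` to `L²(G, E₂)`. -/
def ampL (ζ : E₂) : L2 μ A →L[ℂ] L2E μ B E₂ := (exists_ampL μ φ ζ).choose

theorem ampL_toL2 (ζ : E₂) (f : C_c(G, A)) :
    ampL μ φ ζ (toL2 μ f) = toL2E μ B E₂ (ccAmp φ ζ f) :=
  (exists_ampL μ φ ζ).choose_spec f

theorem ampL_add (ζ ζ' : E₂) : ampL μ φ (ζ + ζ') = ampL μ φ ζ + ampL μ φ ζ' :=
  L2.ext_toL2 μ fun f => by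
    rw [_root_.add_apply, ampL_toL2, ampL_toL2, ampL_toL2, ← map_add]
    congr 1
    exact cc_ext fun g => map_add (φ (f g) : E₂ →L[ℂ] E₂) ζ ζ'

theorem ampL_smul (c : ℂ) (ζ : E₂) : ampL μ φ (c • ζ) = c • ampL μ φ ζ :=
  L2.ext_toL2 μ fun f => by
    rw [_root_.smul_apply, ampL_toL2, ampL_toL2, ← map_smul]
    congr 1
    exact cc_ext fun g => map_smul (φ (f g) : E₂ →L[ℂ] E₂) c ζ

theorem ip_ampL (ζ ζ' : E₂) (f k : L2 μ A) :
    ip B (ampL μ φ ζ f) (ampL μ φ ζ' k) = ip B ζ ((φ (ip A f k) : E₂ →L[ℂ] E₂) ζ') := by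
  induction f using (denseRange_toL2 μ).induction_on with
  | hp =>
    exact isClosed_eq ((ampL μ φ ζ).continuous.ip continuous_const)
      (continuous_const.ip (Continuous.repr φ (continuous_id.ip continuous_const) continuous_const))
  | ih f =>
    induction k using (denseRange_toL2 μ).induction_on with
    | hp =>
      exact isClosed_eq (continuous_const.ip (ampL μ φ ζ').continuous)
        (continuous_const.ip (Continuous.repr φ (continuous_const.ip continuous_id)
          continuous_const))
    | ih k => rw [ampL_toL2, ampL_toL2, ip_ccAmp]

/-- The map `f ⊗ ζ ↦ φ(f) ζ` from the algebraic tensor product to `L²(G, E₂)`. -/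
def ampPre : PreTensor (L2 μ A) φ →ₗ[ℂ] L2E μ B E₂ :=
  TensorProduct.lift (LinearMap.mk₂ ℂ (fun f ζ => ampL μ φ ζ f)
    (fun f f' ζ => map_add _ _ _) (fun c f ζ => map_smul _ _ _)
    (fun f ζ ζ' => by rw [ampL_add]; rfl) (fun c f ζ => by rw [ampL_smul]; rfl))

theorem ampPre_tmul (f : L2 μ A) (ζ : E₂) :
    ampPre μ φ (PreTensor.tmul φ f ζ) = ampL μ φ ζ f := rfl

/-- The function `g ↦ χ(g) x`. -/
def ccTensor (χ : C_c(G, ℝ)) : E₂ →ₗ[ℂ] C_c(G, E₂) where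
  toFun x := ccMk (fun g => χ g • x) (χ.continuous.smul continuous_const)
    (HasCompactSupport.intro χ.hasCompactSupport fun g hg => by
      rw [cc_apply_eq_zero χ hg, zero_smul])
  map_add' x y := cc_ext fun g => smul_add (χ g) x y
  map_smul' c x := cc_ext fun g => smul_comm (χ g) c x

theorem ccTensor_apply (χ : C_c(G, ℝ)) (x : E₂) (g : G) : ccTensor χ x g = χ g • x := rfl

variable (G) in
/-- The span of the functions `g ↦ φ(f(g)) ζ`. -/
def ampSpan : Submodule ℂ C_c(G, E₂) :=
  Submodule.span ℂ {k | ∃ (ζ : E₂) (f : C_c(G, A)), k = ccAmp φ ζ f}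

/-- The function `g ↦ χ(g) φ(a) x` equals `g ↦ φ(χ(g) a) x`, so it has the required form with `f = χ
a`. -/
theorem ccTensor_mem_ampSpan (χ : C_c(G, ℝ)) {y : E₂}
    (hy : y ∈ Submodule.span ℂ {y : E₂ | ∃ (a : A) (x : E₂), y = (φ a : E₂ →L[ℂ] E₂) x}) :
    ccTensor χ y ∈ ampSpan G φ := by
  have : Submodule.span ℂ {y : E₂ | ∃ (a : A) (x : E₂), y = (φ a : E₂ →L[ℂ] E₂) x} ≤
      (ampSpan G φ).comap (ccTensor χ) := by
    refine Submodule.span_le.2 ?_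
    rintro _ ⟨a, x, rfl⟩
    refine Submodule.subset_span ⟨x, ccTensor χ a, cc_ext fun g => ?_⟩
    rw [ccAmp_apply, ccTensor_apply, ccTensor_apply, ← reprL_apply, ← reprL_apply,
      ← Complex.coe_smul, ← Complex.coe_smul, map_smul]
    rfl
  exact this hy

variable [LocallyCompactSpace G]

/-- If `φ` is essential, then functions in `C_c(G, E₂)` are uniform limits of functions in the span
of the functions `g ↦ φ(f(g)) ζ`, with uniformly bounded supports. -/
theorem exists_mem_ampSpan_norm_sub_le (hφ : IsEssential φ) (k : C_c(G, E₂)) :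
    ∃ S : Set G, IsCompact S ∧ ∀ ε : ℝ, 0 < ε → ∃ k' ∈ ampSpan G φ,
      (∀ g ∉ S, (k - k') g = 0) ∧ ∀ g, ‖(k - k') g‖ ≤ ε := by
  obtain ⟨χ, hχ1, hχ01⟩ := exists_cutoff k.hasCompactSupport.isCompact
  -- The compact set depends on `k` only, not on `ε`. This uniformity lets one constant of an
  -- inductively bounded map serve for all approximations.
  refine ⟨tsupport χ, χ.hasCompactSupport, fun ε hε => ?_⟩
  set D := Submodule.span ℂ {y : E₂ | ∃ (a : A) (x : E₂), y = (φ a : E₂ →L[ℂ] E₂) x} with hD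
  have hD' : Dense (D : Set E₂) := hφ
  have hkc : Continuous fun g => k g := k.continuous
  -- Essentiality enters here: the span `D` of `φ(A) E₂` is dense, so the sets where `k` is
  -- `ε`-close to a point of `D` cover the support of `χ`.
  obtain ⟨t, ht⟩ := χ.hasCompactSupport.isCompact.elim_finite_subcover
    (fun y : D => {g | ‖k g - y‖ < ε})
    (fun y => isOpen_lt (hkc.sub continuous_const).norm continuous_const)
    (fun g _ => by
      obtain ⟨y, hyD, hy⟩ := hD'.exists_dist_lt (k g) hε
      exact Set.mem_iUnion.2 ⟨⟨y, hyD⟩, (dist_eq_norm (k g) y ▸ hy :)⟩)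
  have ht' : tsupport χ ⊆ ⋃ i : Fin t.card, {g | ‖k g - (t.equivFin.symm i).1.1‖ < ε} := by
    intro g hg
    obtain ⟨y, hy, hgy⟩ := Set.mem_iUnion₂.1 (ht hg)
    refine Set.mem_iUnion.2 ⟨t.equivFin ⟨y, hy⟩, ?_⟩
    simpa using hgy
  obtain ⟨f, hf1, hf2, hf3, -⟩ := exists_continuous_sum_one_of_isOpen_isCompact
    (fun i => isOpen_lt (hkc.sub continuous_const).norm continuous_const)
    χ.hasCompactSupport.isCompact ht'
  let ψ : Fin t.card → C_c(G, ℝ) := fun i => ccMk (fun g => χ g * f i g)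
    (χ.continuous.mul (f i).continuous) (hasCompactSupport_of_left χ _ fun g h => by
      rw [h, zero_mul])
  -- On the support of `χ` the partition of unity sums to `1`, and `χ k = k`. The error is thus `χ`
  -- times a convex combination of vectors of norm less than `ε`.
  have key : ∀ g, (k - ∑ i, ccTensor (ψ i) (t.equivFin.symm i).1.1) g =
      χ g • ∑ i, f i g • (k g - (t.equivFin.symm i).1.1) := by
    intro g
    have h1 : (∑ i, ccTensor (ψ i) (t.equivFin.symm i).1.1) g =
        ∑ i, (χ g * f i g) • (t.equivFin.symm i).1.1 := by
      rw [CompactlySupportedContinuousMap.sum_apply]; rfl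
    rw [CompactlySupportedContinuousMap.sub_apply, h1]
    by_cases hg : g ∈ tsupport χ
    · have h2 : ∑ i, f i g = 1 := by simpa using hf2 hg
      have h3 : k g = χ g • k g := by
        by_cases hk : g ∈ tsupport k
        · rw [hχ1 g hk, one_smul]
        · rw [cc_apply_eq_zero k hk, smul_zero]
      simp only [smul_sub, Finset.sum_sub_distrib]
      rw [← Finset.sum_smul, h2, one_smul, ← h3, Finset.smul_sum]
      simp only [mul_smul]
    · have h4 : χ g = 0 := cc_apply_eq_zero χ hg
      have h5 : k g = 0 := cc_apply_eq_zero k fun h => by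
        rw [hχ1 g h] at h4; exact one_ne_zero h4
      simp [h4, h5]
  refine ⟨∑ i, ccTensor (ψ i) (t.equivFin.symm i).1.1, Submodule.sum_mem _ fun i _ =>
    ccTensor_mem_ampSpan φ (ψ i) (t.equivFin.symm i).1.2, fun g hg => ?_, fun g => ?_⟩
  · rw [key, cc_apply_eq_zero χ hg, zero_smul]
  · rw [key]
    by_cases hg : g ∈ tsupport χ
    · have h2 : ∑ i, f i g = 1 := by simpa using hf2 hg
      rw [norm_smul, Real.norm_of_nonneg (hχ01 g).1]
      calc χ g * ‖∑ i, f i g • (k g - (t.equivFin.symm i).1.1)‖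
          ≤ 1 * ∑ i, f i g * ε := by
            refine mul_le_mul (hχ01 g).2 (norm_sum_le_of_le _ fun i _ => ?_) (norm_nonneg _)
              zero_le_one
            rw [norm_smul, Real.norm_of_nonneg (hf3 i g).1]
            by_cases hi : f i g = 0
            · rw [hi, zero_mul, zero_mul]
            · exact mul_le_mul_of_nonneg_left
                (hf1 i (subset_tsupport _ hi) : ‖k g - (t.equivFin.symm i).1.1‖ < ε).le (hf3 i g).1
        _ = ε := by rw [← Finset.sum_mul, h2]; ring
    · rw [cc_apply_eq_zero χ hg, zero_smul, norm_zero]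
      exact hε.le

/-- Two maps on `C_c(G, E₂)` are equal if they agree on the functions `g ↦ φ(f(g)) ζ`. -/
theorem IndBdd.ext_ccAmp (hφ : IsEssential φ) {X : Type*} [NormedAddCommGroup X] [NormedSpace ℂ X]
    {P Q : C_c(G, E₂) →ₗ[ℂ] X} (hP : IndBdd P) (hQ : IndBdd Q)
    (h : ∀ ζ f, P (ccAmp φ ζ f) = Q (ccAmp φ ζ f)) : P = Q := by
  refine LinearMap.ext fun k => ?_
  obtain ⟨S, hS, hk⟩ := exists_mem_ampSpan_norm_sub_le φ hφ k
  obtain ⟨C, hC, hCk⟩ := hP S hS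
  obtain ⟨C', hC', hCk'⟩ := hQ S hS
  have h1 : ampSpan G φ ≤ LinearMap.eqLocus P Q := Submodule.span_le.2 <| by
    rintro _ ⟨ζ, f, rfl⟩
    exact h ζ f
  refine eq_of_forall_dist_le fun ε hε => ?_
  obtain ⟨k', hk', h0, hle⟩ := hk (ε / (C + C' + 1)) (by positivity)
  have h2 : P k' = Q k' := h1 hk'
  have h3 := hCk _ _ h0 hle
  have h4 := hCk' _ _ h0 hle
  have h5 : P k - Q k = P (k - k') - Q (k - k') := by rw [map_sub, map_sub, h2]; abel
  rw [dist_eq_norm, h5]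
  refine (norm_sub_le _ _).trans ((add_le_add h3 h4).trans ?_)
  rw [← add_mul, mul_div_assoc', div_le_iff₀ (by positivity)]
  nlinarith

/-- Uniform approximation with common compact support implies approximation in `L²(G, E₂)`; this is
surjectivity of the unitary. -/
theorem denseRange_ampPre (hφ : IsEssential φ) : DenseRange (ampPre μ φ) := by
  intro x
  have hx : x ∈ closure (Set.range (toL2E (G := G) μ B E₂)) := denseRange_toL2E μ x
  refine closure_minimal ?_ isClosed_closure hx
  rintro _ ⟨k, rfl⟩
  obtain ⟨S, hS, hk⟩ := exists_mem_ampSpan_norm_sub_le φ hφ k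
  obtain ⟨C, hC, hCk⟩ := indBdd_toL2E (B := B) (E := E₂) μ S hS
  refine Metric.mem_closure_iff.2 fun ε hε => ?_
  obtain ⟨k', hk', h0, hle⟩ := hk (ε / (C + 1)) (by positivity)
  have h1 : ampSpan G φ ≤ (LinearMap.range (ampPre μ φ)).comap (toL2E μ B E₂) :=
    Submodule.span_le.2 <| by
      rintro _ ⟨ζ, f, rfl⟩
      exact ⟨PreTensor.tmul φ (toL2 μ f) ζ, by rw [ampPre_tmul, ampL_toL2]⟩
  refine ⟨_, h1 hk', ?_⟩
  rw [dist_eq_norm, ← map_sub]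
  refine (hCk _ _ h0 hle).trans_lt ?_
  rw [mul_div_assoc', div_lt_iff₀ (by positivity)]
  nlinarith

theorem exists_ampU (hφ : IsEssential φ) :
    ∃ (U : InteriorTensor (L2 μ A) φ →L[ℂ] L2E μ B E₂)
      (V : L2E μ B E₂ →L[ℂ] InteriorTensor (L2 μ A) φ), IsAdjointPair B U V ∧
      U.comp V = .id ℂ _ ∧ V.comp U = .id ℂ _ ∧
      ∀ f ζ, U (InteriorTensor.tmul φ f ζ) = ampL μ φ ζ f :=
  exists_unitary_of_ip φ (ampPre μ φ) (denseRange_ampPre μ φ hφ) fun f ζ k η =>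
    ip_ampL μ φ ζ η f k

variable {φ} (hφ : IsEssential φ)

/-- The unitary `L²(G, A) ⊗_A E₂ → L²(G, E₂)`, `f ⊗ ζ ↦ φ(f) ζ`. -/
def ampU : InteriorTensor (L2 μ A) φ →L[ℂ] L2E μ B E₂ := (exists_ampU μ φ hφ).choose

/-- The inverse of `ampU`. -/
def ampV : L2E μ B E₂ →L[ℂ] InteriorTensor (L2 μ A) φ := (exists_ampU μ φ hφ).choose_spec.choose

theorem isAdjointPair_ampU : IsAdjointPair B (ampU μ hφ) (ampV μ hφ) :=
  (exists_ampU μ φ hφ).choose_spec.choose_spec.1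

theorem ampU_ampV (x : L2E μ B E₂) : ampU μ hφ (ampV μ hφ x) = x :=
  DFunLike.congr_fun (exists_ampU μ φ hφ).choose_spec.choose_spec.2.1 x

theorem ampV_ampU (x : InteriorTensor (L2 μ A) φ) : ampV μ hφ (ampU μ hφ x) = x :=
  DFunLike.congr_fun (exists_ampU μ φ hφ).choose_spec.choose_spec.2.2.1 x

theorem ampU_tmul (f : C_c(G, A)) (ζ : E₂) :
    ampU μ hφ (InteriorTensor.tmul φ (toL2 μ f) ζ) = toL2E μ B E₂ (ccAmp φ ζ f) :=
  ((exists_ampU μ φ hφ).choose_spec.choose_spec.2.2.2 _ ζ).trans (ampL_toL2 μ φ ζ f)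

theorem ampV_ccAmp (f : C_c(G, A)) (ζ : E₂) :
    ampV μ hφ (toL2E μ B E₂ (ccAmp φ ζ f)) = InteriorTensor.tmul φ (toL2 μ f) ζ := by
  rw [← ampU_tmul μ hφ, ampV_ampU]

end Amplification

/-! ### The calculus of the operators `T ⊗ 1` on `L²(G, E₂)`. -/

section Lift

variable {G : Type*} [Group G] [TopologicalSpace G] [IsTopologicalGroup G] [T2Space G]
  [LocallyCompactSpace G] [MeasurableSpace G] [BorelSpace G] (μ : Measure G) [μ.IsHaarMeasure]
  {A B E₁ F₁ E₂ : Type*} [NonUnitalCStarAlgebra A] [NonUnitalCStarAlgebra B]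
  [NormedAddCommGroup E₁] [NormedSpace ℂ E₁] [InnerModule A E₁] [CompleteSpace E₁]
  [NormedAddCommGroup F₁] [NormedSpace ℂ F₁] [InnerModule A F₁] [CompleteSpace F₁]
  [NormedAddCommGroup E₂] [NormedSpace ℂ E₂] [CompleteSpace E₂] [InnerModule B E₂]
  {φ : A →⋆ₙₐ[ℂ] AdjAlg B E₂} (hφ : IsEssential φ)

/-- The operator `L²(G, E₂) ≅ L²(G, A) ⊗_A E₂ → E₁ ⊗_A E₂` given by `T ⊗ 1`. -/
def liftL (T : L2 μ A →L[ℂ] E₁) : L2E μ B E₂ →L[ℂ] InteriorTensor E₁ φ :=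
  (tensorRight φ T).comp (ampV μ hφ)

/-- The operator on `L²(G, E₂) ≅ L²(G, A) ⊗_A E₂` given by `T ⊗ 1`. -/
def hatL (T : L2 μ A →L[ℂ] L2 μ A) : L2E μ B E₂ →L[ℂ] L2E μ B E₂ :=
  (ampU μ hφ).comp (liftL μ hφ T)

theorem norm_ampV (x : L2E μ B E₂) : ‖ampV μ hφ x‖ = ‖x‖ := by
  rw [InnerModule.norm_eq_sqrt (B := B), (isAdjointPair_ampU μ hφ).symm, ampU_ampV,
    ← InnerModule.norm_eq_sqrt]

theorem norm_ampU (x : InteriorTensor (L2 μ A) φ) : ‖ampU μ hφ x‖ = ‖x‖ := by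
  rw [← norm_ampV μ hφ, ampV_ampU]

variable {T T' : L2 μ A →L[ℂ] E₁}

theorem liftL_ccAmp (h : IsAdjointable A T) (f : C_c(G, A)) (ζ : E₂) :
    liftL μ hφ T (toL2E μ B E₂ (ccAmp φ ζ f)) = InteriorTensor.tmul φ (T (toL2 μ f)) ζ := by
  rw [liftL, ContinuousLinearMap.comp_apply, ampV_ccAmp, tensorRight_tmul φ h]

theorem norm_liftL_le (h : IsAdjointable A T) : ‖liftL (B := B) μ hφ T‖ ≤ ‖T‖ :=
  ContinuousLinearMap.opNorm_le_bound _ (norm_nonneg T) fun x => by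
    rw [liftL, ContinuousLinearMap.comp_apply]
    refine ((tensorRight φ T).le_of_opNorm_le (norm_tensorRight_le φ h) _).trans_eq ?_
    rw [norm_ampV]

theorem liftL_add (h : IsAdjointable A T) (h' : IsAdjointable A T') :
    liftL (B := B) μ hφ (T + T') = liftL μ hφ T + liftL μ hφ T' := by
  rw [liftL, tensorRight_add φ h h', ContinuousLinearMap.add_comp]; rfl

theorem liftL_smul (c : ℂ) (h : IsAdjointable A T) :
    liftL (B := B) μ hφ (c • T) = c • liftL μ hφ T := by
  rw [liftL, tensorRight_smul φ c h, ContinuousLinearMap.smul_comp]; rfl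

/-- The unitary and its inverse cancel in the middle. It lets a factor from `C*_r(G, A)` be moved
from the right of an operator in `F(E₁, R₁)` to the left of `L²(G, E₂)`. -/
theorem liftL_comp_hatL {S : L2 μ A →L[ℂ] L2 μ A} (hS : IsAdjointable A S)
    (hT : IsAdjointable A T) :
    (liftL (B := B) μ hφ T).comp (hatL μ hφ S) = liftL μ hφ (T.comp S) :=
  ContinuousLinearMap.ext fun x => by
    simp only [liftL, hatL, ContinuousLinearMap.comp_apply, ampV_ampU]
    rw [tensorRight_comp φ hS hT]; rfl

theorem isAdjointPair_liftL {S : E₁ →L[ℂ] L2 μ A} (h : IsAdjointPair A T S) :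
    IsAdjointPair B (liftL μ hφ T) ((ampU μ hφ).comp (tensorRight φ S)) :=
  (isAdjointPair_ampU μ hφ).symm.comp (h.tensorRight φ)

/-- Taking adjoints gives `(T ⊗ 1)* (T' ⊗ 1) = T* T' ⊗ 1`, so the inner product `⟨T, T'⟩ = T* T'` of
`F(E₁, R₁)` appears as an operator on `L²(G, E₂)`. -/
theorem ip_liftL (h : IsAdjointable A T) (h' : IsAdjointable A T') (x y : L2E μ B E₂) :
    ip B (liftL μ hφ T x) (liftL μ hφ T' y) = ip B x (hatL μ hφ ((adj A T).comp T') y) := by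
  rw [isAdjointPair_liftL μ hφ h.isAdjointPair]
  simp only [liftL, hatL, ContinuousLinearMap.comp_apply]
  rw [tensorRight_comp φ h' h.isAdjointPair.symm.isAdjointable]; rfl

variable {S S' : L2 μ A →L[ℂ] L2 μ A}

theorem hatL_add (h : IsAdjointable A S) (h' : IsAdjointable A S') :
    hatL (B := B) μ hφ (S + S') = hatL μ hφ S + hatL μ hφ S' := by
  rw [hatL, liftL_add μ hφ h h', ContinuousLinearMap.comp_add]; rfl

theorem hatL_smul (c : ℂ) (h : IsAdjointable A S) :
    hatL (B := B) μ hφ (c • S) = c • hatL μ hφ S := by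
  rw [hatL, liftL_smul μ hφ c h, ContinuousLinearMap.comp_smul]; rfl

theorem norm_hatL_le (h : IsAdjointable A S) : ‖hatL (B := B) μ hφ S‖ ≤ ‖S‖ :=
  ContinuousLinearMap.opNorm_le_bound _ (norm_nonneg S) fun x => by
    rw [hatL, ContinuousLinearMap.comp_apply, norm_ampU]
    exact (liftL μ hφ S).le_of_opNorm_le (norm_liftL_le μ hφ h) x

theorem hatL_comp (h : IsAdjointable A S) (h' : IsAdjointable A S') :
    hatL (B := B) μ hφ (S'.comp S) = (hatL μ hφ S').comp (hatL μ hφ S) := by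
  rw [hatL, ← liftL_comp_hatL μ hφ h h']; rfl

theorem isAdjointPair_hatL (h : IsAdjointPair A S S') :
    IsAdjointPair B (hatL μ hφ S) (hatL μ hφ S') := by
  have := (isAdjointPair_liftL μ hφ h).comp (isAdjointPair_ampU μ hφ)
  exact this

theorem hatL_ccAmp (h : IsAdjointable A S) {f k : C_c(G, A)} (hf : S (toL2 μ f) = toL2 μ k)
    (ζ : E₂) : hatL μ hφ S (toL2E μ B E₂ (ccAmp φ ζ f)) = toL2E μ B E₂ (ccAmp φ ζ k) := by
  rw [hatL, ContinuousLinearMap.comp_apply, liftL_ccAmp μ hφ h, hf, ampU_tmul]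

end Lift

/-! ### The identity `|ξ ⊗ η⟩⟩ = (|ξ⟩⟩ ⊗ 1) |η⟩`. -/

section LiftKet

variable {G : Type*} [Group G] [TopologicalSpace G] [IsTopologicalGroup G] [T2Space G]
  [LocallyCompactSpace G] [MeasurableSpace G] [BorelSpace G] (μ : Measure G) [μ.IsHaarMeasure]
  {A B E₁ E₂ : Type*} [NonUnitalCStarAlgebra A] [GCStarAlgebra G A]
  [NonUnitalCStarAlgebra B] [GCStarAlgebra G B]
  [NormedAddCommGroup E₁] [NormedSpace ℂ E₁] [InnerModule A E₁] [CompleteSpace E₁]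
  [GInnerModule G A E₁]
  [NormedAddCommGroup E₂] [NormedSpace ℂ E₂] [CompleteSpace E₂] [InnerModule B E₂]
  [GInnerModule G B E₂]
  (φ : A →⋆ₙₐ[ℂ] AdjAlg B E₂)

/-- The function `g ↦ γ_g(ξ) ⊗ k(g)`. -/
def ccTmul (ξ : E₁) : C_c(G, E₂) →ₗ[ℂ] C_c(G, InteriorTensor E₁ φ) where
  toFun k := ccMk (fun g => InteriorTensor.tmul φ (actE A g ξ) (k g))
    (by
      have h1 : Continuous fun g : G => actE A g ξ := GInnerModule.continuous_act (B := A) ξ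
      have h2 : Continuous fun g : G => k g := k.continuous
      exact Continuous.tmul φ h1 h2)
    (HasCompactSupport.intro k.hasCompactSupport fun g hg => by
      rw [cc_apply_eq_zero k hg, ← InteriorTensor.tmulL_apply, map_zero])
  map_add' f k := cc_ext fun g => map_add (InteriorTensor.tmulL E₁ φ (actE A g ξ)) (f g) (k g)
  map_smul' c f := cc_ext fun g => map_smul (InteriorTensor.tmulL E₁ φ (actE A g ξ)) c (f g)

theorem ccTmul_apply (ξ : E₁) (k : C_c(G, E₂)) (g : G) :
    ccTmul φ ξ k g = InteriorTensor.tmul φ (actE A g ξ) (k g) := rfl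

variable {φ} (hφ : IsEssential φ)

variable {μ} in
-- Both sides are bounded in the inductive limit sense, so it is enough to take `k = φ(f) ζ`. There
-- it is the balancing relation `γ_g(ξ) f(g) ⊗ ζ = γ_g(ξ) ⊗ φ(f(g)) ζ` under the integral.
theorem IsKet.liftL_toL2E {ξ : E₁} {T : L2 μ A →L[ℂ] E₁} (hT : IsKet μ ξ T) (k : C_c(G, E₂)) :
    liftL μ hφ T (toL2E μ B E₂ k) = ∫ g, ccTmul φ ξ k g ∂μ := by
  have hP : IndBdd ((liftL μ hφ T).toLinearMap ∘ₗ toL2E μ B E₂) :=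
    (indBdd_toL2E (B := B) μ).comp _
  have hQ : IndBdd (ccIntegral μ ∘ₗ ccTmul (G := G) φ ξ) :=
    IndBdd.comp_pointwise (E := InteriorTensor E₁ φ) (D := E₂) (indBdd_ccIntegral μ)
      (ccTmul φ ξ) (c := ‖ξ‖) fun f g => by
        rw [ccTmul_apply, ← norm_actE (B := A) g ξ]
        exact InteriorTensor.norm_tmul_le φ _ _
  refine DFunLike.congr_fun (hP.ext_ccAmp φ hφ hQ fun ζ f => ?_) k
  change liftL μ hφ T (toL2E μ B E₂ (ccAmp φ ζ f)) = ∫ g, ccTmul φ ξ (ccAmp φ ζ f) g ∂μ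
  rw [liftL_ccAmp μ hφ hT.1, hT.2, ketFun_eq]
  refine ((InteriorTensor.tmulL E₁ φ).flip ζ).integral_comp_comm
    (cc_integrable μ (ccKet ξ f)) |>.symm.trans ?_
  refine integral_congr_ae (Eventually.of_forall fun g => ?_)
  exact InteriorTensor.tmul_rs φ _ _ _

variable [IsEquivariant G φ]

theorem actE_tmul (g : G) (x : E₁) (ξ : E₂) :
    actE B g (InteriorTensor.tmul φ x ξ) = InteriorTensor.tmul φ (actE A g x) (actE B g ξ) :=
  (PreTensor.actL E₁ φ g).completion_apply_coe (PreTensor.tmul φ x ξ)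

variable {μ} in
-- On `f` in `C_c(G, B)` the composite yields `∫ γ_g(ξ) ⊗ γ_g(η) f(g) dg`, and the action on the
-- tensor product is diagonal. Adjointability is inherited from the two factors, whence `ξ ⊗ η` is
-- square-integrable for every `η`.
theorem IsKet.tmul {ξ : E₁} {T : L2 μ A →L[ℂ] E₁} (hT : IsKet μ ξ T) (η : E₂) :
    IsKet μ (InteriorTensor.tmul φ ξ η) ((liftL μ hφ T).comp (ketL μ B η)) := by
  refine ⟨((isAdjointPair_ketL μ η).comp (isAdjointPair_liftL μ hφ hT.1.isAdjointPair)).isAdjointable,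
    fun f => ?_⟩
  rw [ContinuousLinearMap.comp_apply, ketL_toL2, hT.liftL_toL2E]
  refine integral_congr_ae (Eventually.of_forall fun g => ?_)
  change InteriorTensor.tmul φ (actE A g ξ) (rs (actE B g η) (f g)) =
    rs (actE B g (InteriorTensor.tmul φ ξ η)) (f g)
  rw [actE_tmul, InteriorTensor.rs_tmul]

end LiftKet

/-! ### The action of `C*_r(G, A)` on `L²(G, E₂)`. -/

section LaurentE

variable {G : Type*} [Group G] [TopologicalSpace G] [IsTopologicalGroup G] [T2Space G]
  [MeasurableSpace G] [BorelSpace G] (μ : Measure G) [μ.IsHaarMeasure]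
  {A B E₂ : Type*} [NonUnitalCStarAlgebra A] [GCStarAlgebra G A]
  [NonUnitalCStarAlgebra B] [GCStarAlgebra G B]
  [NormedAddCommGroup E₂] [NormedSpace ℂ E₂] [CompleteSpace E₂] [InnerModule B E₂]
  [GInnerModule G B E₂]
  (φ : A →⋆ₙₐ[ℂ] AdjAlg B E₂)

/-- The function `(g, h) ↦ φ(α_g(K(g⁻¹ h))) k(h)`. -/
def rhoKer (K : C_c(G, A)) (k : C_c(G, E₂)) (g h : G) : E₂ :=
  (φ (actB g (K (g⁻¹ * h))) : E₂ →L[ℂ] E₂) (k h)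

theorem continuous_rhoKer (K : C_c(G, A)) (k : C_c(G, E₂)) :
    Continuous (rhoKer φ K k).uncurry :=
  Continuous.repr φ
    (continuous_fst.actB (K.continuous.comp (continuous_fst.inv.mul continuous_snd)))
    (k.continuous.comp continuous_snd)

theorem hasCompactSupport_rhoKer (K : C_c(G, A)) (k : C_c(G, E₂)) :
    HasCompactSupport (rhoKer φ K k).uncurry :=
  hasCompactSupport_rho K k _ (fun g h h0 => by rw [rhoKer, h0, map_zero])
    (fun g h h0 => by rw [rhoKer, h0, map_zero, map_zero]; rfl)

theorem integrable_rhoKer (K : C_c(G, A)) (k : C_c(G, E₂)) (g : G) :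
    Integrable (rhoKer φ K k g) μ :=
  cc_integrable μ (ccSlice _ (continuous_rhoKer φ K k) (hasCompactSupport_rhoKer φ K k) g)

/-- `(ρ_K k)(g) = ∫ φ(α_g(K(g⁻¹ h))) k(h) dh` for `K` in `C_c(G, A)` and `k` in `C_c(G, E₂)`. -/
def ccRhoE (K : C_c(G, A)) : C_c(G, E₂) →ₗ[ℂ] C_c(G, E₂) where
  toFun k := ccInt μ (rhoKer φ K k) (continuous_rhoKer φ K k) (hasCompactSupport_rhoKer φ K k)
  map_add' k k' := cc_ext fun g => by
    refine Eq.trans ?_ (integral_add (integrable_rhoKer μ φ K k g) (integrable_rhoKer μ φ K k' g))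
    exact integral_congr_ae (Eventually.of_forall fun h => map_add (φ _ : E₂ →L[ℂ] E₂) _ _)
  map_smul' c k := cc_ext fun g => by
    refine Eq.trans ?_ (integral_smul c _)
    exact integral_congr_ae (Eventually.of_forall fun h => map_smul (φ _ : E₂ →L[ℂ] E₂) c _)

theorem ccRhoE_apply (K : C_c(G, A)) (k : C_c(G, E₂)) (g : G) :
    ccRhoE μ φ K k g = ∫ h, rhoKer φ K k g h ∂μ := rfl

theorem indBdd_ccRhoE (K : C_c(G, A)) : IndBdd (toL2E μ B E₂ ∘ₗ ccRhoE μ φ K) := fun S hS => by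
  -- A nonzero value at `g` needs some `h` in `S` with `g⁻¹ h` in the support of `K`, so `g = h (g⁻¹
  -- h)⁻¹` lies in `S · supp(K)⁻¹`.
  obtain ⟨C, hC, h⟩ := indBdd_toL2E (B := B) (E := E₂) μ
    ((fun p : G × G => p.1 * p.2⁻¹) '' (S ×ˢ tsupport K))
    ((hS.prod K.hasCompactSupport.isCompact).image (by fun_prop))
  obtain ⟨c, hc⟩ := K.continuous.bounded_above_of_compact_support K.hasCompactSupport
  have hc0 : 0 ≤ c := (norm_nonneg _).trans (hc 1)
  refine ⟨C * (c * μ.real S), by positivity, fun k M h0 hM => ?_⟩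
  have hM0 : 0 ≤ M := (norm_nonneg _).trans (hM 1)
  rw [mul_assoc]
  refine h _ _ (fun g hg => ?_) fun g => ?_
  · rw [ccRhoE_apply]
    refine integral_eq_zero_of_ae (Eventually.of_forall fun s => ?_)
    by_cases hs : s ∈ S
    · have : g⁻¹ * s ∉ tsupport K := fun hK => hg ⟨(s, g⁻¹ * s), ⟨hs, hK⟩, by simp⟩
      rw [rhoKer, cc_apply_eq_zero K this, map_zero, map_zero]; rfl
    · rw [rhoKer, h0 s hs, map_zero]; rfl
  · rw [ccRhoE_apply, show c * μ.real S * M = c * M * μ.real S by ring]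
    refine norm_integral_le_of_support μ hS (fun s hs => by rw [rhoKer, h0 s hs, map_zero])
      fun s => (norm_repr_apply_le φ _ _).trans ?_
    rw [norm_actB]
    exact mul_le_mul (hc _) (hM s) (norm_nonneg _) hc0

/-- Multiplicativity of `φ` under the integral shows that `ρ_K ⊗ 1` acts on functions `φ(f) ζ` by
the same kernel, now with values in the operators on `E₂`. -/
theorem ccAmp_rhoCc (K f : C_c(G, A)) (ζ : E₂) :
    ccAmp φ ζ (rhoCc μ K f) = ccRhoE μ φ K (ccAmp φ ζ f) := cc_ext fun g => by
  rw [ccRhoE_apply, ccAmp_apply, rhoCc_apply, ← reprL_apply]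
  refine ((reprL φ).flip ζ).integral_comp_comm (cc_integrable μ (ccMk
    (fun h => actB g (K (g⁻¹ * h)) * f h)
    ((continuous_const.actB (K.continuous.comp (continuous_const.mul continuous_id))).mul
      f.continuous) (hasCompactSupport_of_left f _ fun h h0 => by rw [h0, mul_zero])))
    |>.symm.trans ?_
  refine integral_congr_ae (Eventually.of_forall fun h => ?_)
  change (φ (actB g (K (g⁻¹ * h)) * f h) : E₂ →L[ℂ] E₂) ζ = _
  rw [map_mul]; rfl

/-- The function `h ↦ φ(K(h)) γ_h(η)`. -/
def ccTwist (K : C_c(G, A)) (η : E₂) : C_c(G, E₂) :=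
  ccMk (fun h => (φ (K h) : E₂ →L[ℂ] E₂) (actE B h η))
    (Continuous.repr φ K.continuous (GInnerModule.continuous_act (B := B) η))
    (HasCompactSupport.intro K.hasCompactSupport fun g hg => by
      rw [cc_apply_eq_zero K hg, map_zero]; rfl)

theorem continuous_ccKet_ccRhoG (k : C_c(G, E₂)) (v : C_c(G, B)) :
    Continuous fun p : G × G => ccKet (k p.1) (ccRhoG p.1 v) p.2 := by
  have h1 : Continuous fun p : G × G => actE B p.2 (k p.1) :=
    continuous_snd.actE (k.continuous.comp continuous_fst)
  have h2 : Continuous fun p : G × G => v (p.2 * p.1) :=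
    v.continuous.comp (continuous_snd.mul continuous_fst)
  exact Continuous.rs (E := E₂) h1 h2

theorem hasCompactSupport_ccKet_ccRhoG (k : C_c(G, E₂)) (v : C_c(G, B)) :
    HasCompactSupport fun p : G × G => ccKet (k p.1) (ccRhoG p.1 v) p.2 := by
  refine HasCompactSupport.intro (K := (fun p : G × G => (p.1, p.2 * p.1⁻¹)) ''
    (tsupport k ×ˢ tsupport v)) ((k.hasCompactSupport.isCompact.prod
      v.hasCompactSupport.isCompact).image (by fun_prop)) ?_
  rintro ⟨h, g⟩ hp
  change rs (actE B g (k h)) (v (g * h)) = 0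
  by_cases hk : h ∈ tsupport k
  · have : g * h ∉ tsupport v := fun hv => hp ⟨(h, g * h), ⟨hk, hv⟩, by simp⟩
    rw [cc_apply_eq_zero v this, rs_zero]
  · rw [cc_apply_eq_zero k hk, map_zero, ← rsL_apply, map_zero]

variable [IsEquivariant G φ]

theorem repr_actB_rs (g h : G) (a : A) (η : E₂) (b : B) :
    (φ (actB g a) : E₂ →L[ℂ] E₂) (rs (actE B (g * h) η) b) =
      rs (actE B g ((φ a : E₂ →L[ℂ] E₂) (actE B h η))) b := by
  rw [(φ (actB g a)).isAdjointPair.map_rs, actE_mul, IsEquivariant.map_act]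

/-- Left invariance, with `h` replaced by `g h`, and equivariance of `φ` turn the kernel into
`φ(α_g(K(h))) γ_{gh}(η) = γ_g(φ(K(h)) γ_h(η))`. This is `ρ_K |η⟩ = ∫ |φ(K(h)) γ_h(η)⟩ ρ_h dh`,
pointwise in `g`. -/
theorem ccRhoE_ccKet (K : C_c(G, A)) (η : E₂) (v : C_c(G, B)) (g : G) :
    ccRhoE μ φ K (ccKet η v) g = ∫ h, ccKet (ccTwist (B := B) φ K η h) (ccRhoG h v) g ∂μ := by
  rw [ccRhoE_apply, ← integral_mul_left_eq_self _ g]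
  refine integral_congr_ae (Eventually.of_forall fun h => ?_)
  change (φ (actB g (K (g⁻¹ * (g * h)))) : E₂ →L[ℂ] E₂) (rs (actE B (g * h) η) (v (g * h))) =
    rs (actE B g ((φ (K h) : E₂ →L[ℂ] E₂) (actE B h η))) (v (g * h))
  rw [inv_mul_cancel_left, repr_actB_rs]

/-- The function `h ↦ ⟨η, φ(K(h)) γ_h(η')⟩`. -/
def ccCoeff (η : E₂) (K : C_c(G, A)) (η' : E₂) : C_c(G, B) :=
  ccMk (fun h => ip B η (ccTwist (B := B) φ K η' h))
    (by
      have h1 : Continuous fun h : G => ccTwist (B := B) φ K η' h :=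
        (ccTwist (B := B) φ K η').continuous
      exact Continuous.ip (E := E₂) continuous_const h1)
    (HasCompactSupport.intro (ccTwist (B := B) φ K η').hasCompactSupport fun g hg => by
      rw [cc_apply_eq_zero _ hg, ip_zero_right])

/-- By equivariance the matrix coefficient of the kernel between `γ_g(η)` and `γ_h(η')` is `β_g` of
a function of `g⁻¹ h` alone. This is the form of the kernel of some `ρ_L`, so `⟨η| (ρ_K ⊗ 1) |η'⟩`
is again of this type over `B`. -/
theorem ccBra_ccRhoE (η : E₂) (K : C_c(G, A)) (η' : E₂) (f : C_c(G, B)) :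
    ccBra η (ccRhoE μ φ K (ccKet η' f)) = rhoCc μ (ccCoeff φ η K η') f := cc_ext fun g => by
  rw [ccBra_apply, ccRhoE_apply, rhoCc_apply]
  refine (ipSL B E₂ (actE B g η)).integral_comp_comm (integrable_rhoKer μ φ K _ g)
    |>.symm.trans ?_
  refine integral_congr_ae (Eventually.of_forall fun h => ?_)
  change ip B (actE B g η) ((φ (actB g (K (g⁻¹ * h))) : E₂ →L[ℂ] E₂) (rs (actE B h η') (f h))) =
    actB g (ip B η ((φ (K (g⁻¹ * h)) : E₂ →L[ℂ] E₂) (actE B (g⁻¹ * h) η'))) * f h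
  -- Writing `h = g (g⁻¹ h)` in the action on `η'` allows `γ_g` to be factored out.
  nth_rw 2 [← mul_inv_cancel_left g h]
  rw [repr_actB_rs, ip_rs_right, GInnerModule.inner_act]

variable {φ} (hφ : IsEssential φ) [LocallyCompactSpace G]

variable {K : C_c(G, A)} {T : L2 μ A →L[ℂ] L2 μ A}

theorem hatL_toL2E_of_isLaurent (k : C_c(G, E₂)) (hK : IsLaurent μ K T)
    (hT : IsAdjointable A T) :
    hatL μ hφ T (toL2E μ B E₂ k) = toL2E μ B E₂ (ccRhoE μ φ K k) := by
  have hP : IndBdd ((hatL μ hφ T).toLinearMap ∘ₗ toL2E μ B E₂) :=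
    (indBdd_toL2E (B := B) μ).comp _
  refine DFunLike.congr_fun (hP.ext_ccAmp φ hφ (indBdd_ccRhoE μ φ K) fun ζ f => ?_) k
  change hatL μ hφ T (toL2E μ B E₂ (ccAmp φ ζ f)) = toL2E μ B E₂ (ccRhoE μ φ K (ccAmp φ ζ f))
  rw [hatL_ccAmp μ hφ hT (hK f), ccAmp_rhoCc]

theorem hatL_ketL_toL2 [μ.Regular] (hK : IsLaurent μ K T) (hT : IsAdjointable A T) (η : E₂)
    (v : C_c(G, B)) : hatL μ hφ T (ketL μ B η (toL2 μ v)) =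
      ∫ h, ketL μ B (ccTwist (B := B) φ K η h)
        ((rhoG μ h : AdjAlg B (L2 μ B)).1 (toL2 μ v)) ∂μ := by
  rw [ketL_toL2, hatL_toL2E_of_isLaurent μ hφ _ hK hT]
  simp only [rhoG_toL2, ketL_toL2]
  exact toL2E_integral (B := B) (E := E₂) μ
    (v := fun h => ccKet (ccTwist (B := B) φ K η h) (ccRhoG h v))
    (continuous_ccKet_ccRhoG (ccTwist (B := B) φ K η) v)
    (hasCompactSupport_ccKet_ccRhoG (ccTwist (B := B) φ K η) v)
    (w := ccRhoE μ φ K (ccKet η v)) (ccRhoE_ccKet μ φ K η v)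

theorem isLaurent_bra_hatL_ket (hK : IsLaurent μ K T) (hT : IsAdjointable A T) (η η' : E₂) :
    IsLaurent μ (ccCoeff φ η K η') ((braL μ B η).comp ((hatL μ hφ T).comp (ketL μ B η'))) :=
  fun f => by
    rw [ContinuousLinearMap.comp_apply, ContinuousLinearMap.comp_apply, ketL_toL2,
      hatL_toL2E_of_isLaurent μ hφ _ hK hT, braL_toL2E, ccBra_ccRhoE]

theorem mem_crOps_of_isLaurent {K : C_c(G, B)} {T : L2 μ B →L[ℂ] L2 μ B} (hK : IsLaurent μ K T)
    (hT : IsAdjointable B T) : T ∈ crOps μ B :=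
  ⟨⟨⟨T, hT⟩, subset_closure ⟨K, hK⟩⟩, rfl⟩

/-- The map `T ↦ T ⊗ 1` from the reduced crossed product to the operators on `L²(G, E₂)`. -/
def hatCr : Cr μ A →L[ℂ] (L2E μ B E₂ →L[ℂ] L2E μ B E₂) :=
  LinearMap.mkContinuous
    { toFun := fun T => hatL μ hφ T.1.1
      map_add' := fun T S => hatL_add μ hφ T.1.2 S.1.2
      map_smul' := fun c T => hatL_smul μ hφ c T.1.2 } 1 fun T => by
    rw [one_mul]; exact norm_hatL_le μ hφ T.1.2

/-- A closed property of elements of the reduced crossed product holds if it holds for the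
operators `ρ_K`. -/
theorem Cr.induction {p : Cr μ A → Prop} (hc : IsClosed {T | p T})
    (h : ∀ (K : C_c(G, A)) (T : Cr μ A), IsLaurent μ K T.1.1 → p T) (T : Cr μ A) : p T := by
  have hT : T.1 ∈ closure (laurentAlg μ A : Set (AdjAlg A (L2 μ A))) := T.2
  have h1 : T ∈ closure {T : Cr μ A | ∃ K : C_c(G, A), IsLaurent μ K T.1.1} := by
    refine Metric.mem_closure_iff.2 fun ε hε => ?_
    obtain ⟨S, hS, hd⟩ := Metric.mem_closure_iff.1 hT ε hε
    exact ⟨⟨S, subset_closure hS⟩, hS, hd⟩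
  exact closure_minimal (by rintro T ⟨K, hK⟩; exact h K T hK) hc h1

/-- For `T = ρ_K` the operator is some `ρ_L`. The general case follows because `T ↦ T ⊗ 1` is
continuous and `C*_r(G, B)` is closed. -/
theorem bra_hatL_ket_mem_crOps (T : Cr μ A) (η η' : E₂) :
    (braL μ B η).comp ((hatL μ hφ T.1.1).comp (ketL μ B η')) ∈ crOps μ B := by
  refine Cr.induction μ (p := fun T => (braL μ B η).comp ((hatL μ hφ T.1.1).comp (ketL μ B η')) ∈
    crOps μ B) ?_ (fun K T hK => ?_) T
  · refine (isClosed_crOps μ).preimage (f := fun T : Cr μ A =>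
      (braL μ B η).comp ((hatCr μ hφ T).comp (ketL μ B η'))) ?_
    exact continuous_const.clm_comp ((hatCr μ hφ).continuous.clm_comp continuous_const)
  · refine mem_crOps_of_isLaurent μ (isLaurent_bra_hatL_ket μ hφ hK T.1.2 η η') ?_
    exact (((isAdjointPair_ketL μ η').comp (isAdjointPair_hatL μ hφ T.1.isAdjointPair)).comp
      (isAdjointPair_ketL μ η).symm).isAdjointable

end LaurentE

/-! ### Density and relative continuity of the image of `R ⊗ E₂`. -/

section TensorImage

variable {G : Type*} [Group G] [TopologicalSpace G] [IsTopologicalGroup G] [T2Space G]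
  [LocallyCompactSpace G] [MeasurableSpace G] [BorelSpace G] (μ : Measure G) [μ.IsHaarMeasure]
  {A B E₁ E₂ : Type*} [NonUnitalCStarAlgebra A] [GCStarAlgebra G A]
  [NonUnitalCStarAlgebra B] [GCStarAlgebra G B]
  [NormedAddCommGroup E₁] [NormedSpace ℂ E₁] [InnerModule A E₁] [CompleteSpace E₁]
  [GInnerModule G A E₁]
  [NormedAddCommGroup E₂] [NormedSpace ℂ E₂] [CompleteSpace E₂] [InnerModule B E₂]
  [GInnerModule G B E₂]
  (φ : A →⋆ₙₐ[ℂ] AdjAlg B E₂)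

theorem tmul_mem_tensorImage {R : Submodule ℂ E₁} {ξ : E₁} (hξ : ξ ∈ R) (η : E₂) :
    InteriorTensor.tmul φ ξ η ∈ tensorImage φ R := ⟨(⟨ξ, hξ⟩ : R) ⊗ₜ[ℂ] η, rfl⟩

theorem dense_tensorImage {R : Submodule ℂ E₁} (hR : Dense (R : Set E₁)) :
    Dense (tensorImage φ R : Set (InteriorTensor E₁ φ)) := by
  intro t
  induction t using InteriorTensor.induction with
  | hc => exact isClosed_closure
  | h x ξ =>
    refine map_mem_closure (f := fun x => InteriorTensor.tmul φ x ξ)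
      (Continuous.tmul φ continuous_id continuous_const) (hR x) fun y hy => ?_
    exact tmul_mem_tensorImage φ hy ξ
  | ha s t hs ht => exact (tensorImage φ R).topologicalClosure.add_mem hs ht

variable {μ} in
-- Square-integrability excludes the default value `0` in the definition of `ket`.
theorem RelCont.isKet_ket {R : Set E₁} (hR : RelCont μ A R) {ξ : E₁} (hξ : ξ ∈ R) :
    IsKet μ ξ (ket μ A ξ) := by
  obtain ⟨T, hT⟩ := (hR.1 ξ hξ).exists_isKet
  rwa [hT.ket_eq]

theorem isKet_zero : IsKet μ (0 : E₁) (0 : L2 μ A →L[ℂ] E₁) :=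
  ⟨isAdjointPair_zero.isAdjointable, fun f => by
    refine (integral_eq_zero_of_ae (Eventually.of_forall fun g => ?_)).symm
    change rs (actE A g (0 : E₁)) (f g) = 0
    rw [map_zero, ← rsL_apply, map_zero]⟩

variable {φ} (hφ : IsEssential φ) (R : Submodule ℂ E₁)

/-- The operators `(|ξ⟩⟩ ⊗ 1) |η⟩` for `ξ` in `R` and `η` in `E₂`. -/
def liftSet : Set (L2 μ B →L[ℂ] InteriorTensor E₁ φ) :=
  {T | ∃ ξ ∈ R, ∃ η : E₂, T = (liftL μ hφ (ket μ A ξ)).comp (ketL μ B η)}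

/-- The operator `|t⟩⟩` is additive in `t`, so a sum of elementary tensors has the sum of the
operators `(|ξ⟩⟩ ⊗ 1) |η⟩` as its ket. -/
theorem exists_isKet_of_mem_tensorImage [IsEquivariant G φ] {R : Submodule ℂ E₁}
    (hR : RelCont μ A (R : Set E₁)) {t : InteriorTensor E₁ φ} (ht : t ∈ tensorImage φ R) :
    ∃ T ∈ Submodule.span ℂ (liftSet μ hφ R), IsKet μ t T := by
  obtain ⟨z, rfl⟩ := ht
  induction z using TensorProduct.induction_on with
  | zero => rw [map_zero]; exact ⟨0, Submodule.zero_mem _, isKet_zero μ⟩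
  | tmul ξ η =>
    exact ⟨_, Submodule.subset_span ⟨ξ, ξ.2, η, rfl⟩, (hR.isKet_ket ξ.2).tmul hφ η⟩
  | add z w hz hw =>
    obtain ⟨T, hT, hzT⟩ := hz
    obtain ⟨S, hS, hwS⟩ := hw
    rw [map_add]
    exact ⟨_, Submodule.add_mem _ hT hS, hzT.add hwS⟩

theorem isAdjointPair_of_liftSet (ξ : E₁) (η : E₂) :
    IsAdjointPair B ((liftL μ hφ (ket μ A ξ)).comp (ketL μ B η))
      ((braL μ B η).comp ((ampU μ hφ).comp (tensorRight φ (adj A (ket μ A ξ))))) :=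
  (isAdjointPair_ketL μ η).comp (isAdjointPair_liftL μ hφ (isAdjointable_ket μ ξ).isAdjointPair)

/-- The operator is `⟨η| (⟨⟨ξ|ξ'⟩⟩ ⊗ 1) |η'⟩`, and `⟨⟨ξ|ξ'⟩⟩` belongs to `C*_r(G, A)` by relative
continuity of `R`. -/
theorem adj_comp_mem_crOps_of_liftSet {R : Submodule ℂ E₁} (hR : RelCont μ A (R : Set E₁))
    [IsEquivariant G φ]
    {T T' : L2 μ B →L[ℂ] InteriorTensor E₁ φ} (hT : T ∈ liftSet μ hφ R)
    (hT' : T' ∈ liftSet μ hφ R) : (adj B T).comp T' ∈ crOps μ B := by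
  obtain ⟨ξ, hξ, η, rfl⟩ := hT
  obtain ⟨ξ', hξ', η', rfl⟩ := hT'
  obtain ⟨c, hc⟩ := hR.2 ξ hξ ξ' hξ'
  have h := bra_hatL_ket_mem_crOps μ hφ c η η'
  rw [hc] at h
  rw [(isAdjointPair_of_liftSet μ hφ ξ η).adj_eq]
  convert h using 1
  simp only [hatL, liftL, ContinuousLinearMap.comp_assoc]
  rw [tensorRight_comp φ (isAdjointable_ket μ ξ')
    (isAdjointable_ket μ ξ).isAdjointPair.symm.isAdjointable]
  rfl

theorem adj_comp_mem_crOps_of_span {R : Submodule ℂ E₁} (hR : RelCont μ A (R : Set E₁))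
    [IsEquivariant G φ]
    {T T' : L2 μ B →L[ℂ] InteriorTensor E₁ φ} (hT : T ∈ Submodule.span ℂ (liftSet μ hφ R))
    (hT' : T' ∈ Submodule.span ℂ (liftSet μ hφ R)) : (adj B T).comp T' ∈ crOps μ B := by
  have hadj : ∀ T ∈ Submodule.span ℂ (liftSet μ hφ R), IsAdjointable B T := fun T hT => by
    induction hT using Submodule.span_induction with
    | mem T h =>
      obtain ⟨ξ, -, η, rfl⟩ := h
      exact (isAdjointPair_of_liftSet μ hφ ξ η).isAdjointable
    | zero => exact isAdjointPair_zero.isAdjointable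
    | add S T _ _ hS hT => exact (hS.isAdjointPair.add hT.isAdjointPair).isAdjointable
    | smul c T _ hT => exact (hT.isAdjointPair.smul c).isAdjointable
  have key : ∀ S : L2 μ B →L[ℂ] InteriorTensor E₁ φ,
      (∀ S' ∈ liftSet μ hφ R, (adj B S).comp S' ∈ crOps μ B) →
      ∀ S' ∈ Submodule.span ℂ (liftSet μ hφ R), (adj B S).comp S' ∈ crOps μ B := by
    intro S hS S' hS'
    induction hS' using Submodule.span_induction with
    | mem T h => exact hS T h
    | zero => rw [ContinuousLinearMap.comp_zero]; exact Submodule.zero_mem _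
    | add S T _ _ hS hT => rw [ContinuousLinearMap.comp_add]; exact Submodule.add_mem _ hS hT
    | smul c T _ hT => rw [ContinuousLinearMap.comp_smul]; exact Submodule.smul_mem _ _ hT
  -- `T* T'` is linear in `T'`. Linearity in the first variable is reduced to this by taking
  -- adjoints.
  refine key T (fun S hS => ?_) T' hT'
  have hSa := hadj S (Submodule.subset_span hS)
  refine star_mem_crOps μ hSa (hadj T hT) ?_
  exact key S (fun S' hS' => adj_comp_mem_crOps_of_liftSet μ hφ hR hS hS') T hT

theorem relCont_tensorImage (hφ : IsEssential φ) [IsEquivariant G φ] {R : Submodule ℂ E₁}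
    (hR : RelCont μ A (R : Set E₁)) :
    RelCont μ B (tensorImage φ R : Set (InteriorTensor E₁ φ)) := by
  refine ⟨fun t ht => ?_, fun s hs t ht => ?_⟩
  · obtain ⟨T, -, hT⟩ := exists_isKet_of_mem_tensorImage μ hφ hR ht
    exact hT.squareIntegrable
  · obtain ⟨S, hS, hsS⟩ := exists_isKet_of_mem_tensorImage μ hφ hR hs
    obtain ⟨T, hT, htT⟩ := exists_isKet_of_mem_tensorImage μ hφ hR ht
    rw [hsS.ket_eq, htT.ket_eq]
    exact adj_comp_mem_crOps_of_span μ hφ hR hS hT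

end TensorImage

/-! ### Right translations, the modular function and strict continuity of `ρ_h`. -/

section Modular

variable {G : Type*} [Group G] [TopologicalSpace G] [IsTopologicalGroup G] [T2Space G]
  [LocallyCompactSpace G] [MeasurableSpace G] [BorelSpace G]
  (μ : Measure G) [μ.IsHaarMeasure] [μ.Regular]

/-- A right translate of `μ` is again a left Haar measure, hence a multiple of `μ`. Identifying the
factor with the modular function is what gives control of `ρ_h` as `h` varies. -/
theorem integral_mul_right_eq_modularCharacterFun {E : Type*} [NormedAddCommGroup E]
    [NormedSpace ℝ E] (f : G → E) (h : G) :
    ∫ g, f (g * h) ∂μ = (Measure.modularCharacterFun h : ℝ) • ∫ g, f g ∂μ := by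
  have hreg : (Measure.map (· * h) μ).Regular := Measure.Regular.map (Homeomorph.mulRight h)
  have h1 := Measure.isMulLeftInvariant_eq_smul_of_regular (Measure.map (· * h) μ) μ
  have h2 : ∫ g, f g ∂(Measure.map (· * h) μ) = ∫ g, f (g * h) ∂μ :=
    (Homeomorph.mulRight h).measurableEmbedding.integral_map f
  rw [← h2, Measure.modularCharacterFun_eq_haarScalarFactor μ]
  nth_rw 1 [h1]
  rw [integral_smul_nnreal_measure]
  rfl

/-- For a fixed bump function `f`, the modular function is `h ↦ ∫ f(g h) dg / ∫ f(g) dg`, and the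
numerator is an integral depending continuously on `h`. -/
theorem continuous_modularCharacterFun (μ : Measure G) [μ.IsHaarMeasure] [μ.Regular] :
    Continuous fun h : G => (Measure.modularCharacterFun h : ℝ) := by
  obtain ⟨⟨f, hf⟩, hfc, hf0, hf1⟩ :
    ∃ f : C(G, ℝ), HasCompactSupport f ∧ 0 ≤ f ∧ f 1 ≠ 0 := exists_continuous_nonneg_pos 1
  change HasCompactSupport f at hfc
  have hpos : 0 < ∫ g, f g ∂μ :=
    hf.integral_pos_of_hasCompactSupport_nonneg_nonzero hfc hf0 hf1
  have h1 : (fun h : G => (Measure.modularCharacterFun h : ℝ)) =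
      fun h => (∫ g, f (g * h) ∂μ) / ∫ g, f g ∂μ := funext fun h => by
    rw [integral_mul_right_eq_modularCharacterFun, smul_eq_mul, mul_div_cancel_right₀ _ hpos.ne']
  rw [h1]
  refine Continuous.div_const (continuous_iff_continuousAt.2 fun h₀ => ?_) _
  obtain ⟨N, hN, hh⟩ := exists_compact_mem_nhds h₀
  -- For `h` in `N`, the function `g ↦ f(g h)` vanishes outside the compact set `supp(f) · N⁻¹`.
  refine (continuousOn_integral_of_compact_support (s := N)
    (k := (fun p : G × G => p.1 * p.2⁻¹) '' (tsupport f ×ˢ N))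
    ((hfc.isCompact.prod hN).image (by fun_prop)) ?_ fun h g hhN hg => ?_).continuousAt hh
  · exact (hf.comp (continuous_snd.mul continuous_fst)).continuousOn
  · refine image_eq_zero_of_notMem_tsupport fun h' => hg ⟨(g * h, h), ⟨h', hhN⟩, by simp⟩

variable {B : Type*} [NonUnitalCStarAlgebra B] [GCStarAlgebra G B]

/-- Right translation is not isometric for a left Haar measure: it multiplies `⟨f, f⟩` by the
modular function. -/
theorem norm_rhoG_le (h : G) :
    ‖(rhoG μ h : AdjAlg B (L2 μ B)).1‖ ≤ √(Measure.modularCharacterFun h : ℝ) := by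
  refine ContinuousLinearMap.opNorm_le_bound _ (Real.sqrt_nonneg _) fun x => ?_
  induction x using (denseRange_toL2 μ).induction_on with
  | hp => exact isClosed_le ((rhoG μ h : AdjAlg B (L2 μ B)).1.continuous.norm)
            (continuous_const.mul continuous_norm)
  | ih f =>
    rw [rhoG_toL2]
    refine abs_le_of_sq_le_sq' (le_of_eq ?_) (by positivity) |>.2
    rw [mul_pow, Real.sq_sqrt (NNReal.coe_nonneg _), norm_sq_ip B (toL2 μ (ccRhoG h f)),
      norm_sq_ip B (toL2 μ f), ip_toL2, ip_toL2]
    have := integral_mul_right_eq_modularCharacterFun μ (fun g => star (f g) * f g) h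
    change ‖∫ g, star (f (g * h)) * f (g * h) ∂μ‖ = _
    rw [this, norm_smul, Real.norm_of_nonneg (NNReal.coe_nonneg _)]

theorem exists_norm_rhoG_le {S : Set G} (hS : IsCompact S) :
    ∃ C : ℝ, 0 ≤ C ∧ ∀ h ∈ S, ‖(rhoG μ h : AdjAlg B (L2 μ B)).1‖ ≤ C := by
  obtain ⟨C, hC⟩ := hS.exists_bound_of_continuousOn
    (continuous_modularCharacterFun μ).sqrt.continuousOn
  exact ⟨|C|, abs_nonneg C, fun h hh => (norm_rhoG_le μ h).trans
    ((le_abs_self _).trans ((hC h hh).trans (le_abs_self C)))⟩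

theorem continuous_ccRhoB_ccRhoG (K f : C_c(G, B)) :
    Continuous fun p : G × G => ccRhoB (K p.1) (ccRhoG p.1 f) p.2 := by
  have h1 : Continuous fun p : G × G => actB p.2 (K p.1) :=
    continuous_snd.actB (K.continuous.comp continuous_fst)
  have h2 : Continuous fun p : G × G => f (p.2 * p.1) :=
    f.continuous.comp (continuous_snd.mul continuous_fst)
  exact h1.mul h2

theorem hasCompactSupport_ccRhoB_ccRhoG (K f : C_c(G, B)) :
    HasCompactSupport fun p : G × G => ccRhoB (K p.1) (ccRhoG p.1 f) p.2 := by
  refine HasCompactSupport.intro (K := (fun p : G × G => (p.1, p.2 * p.1⁻¹)) ''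
    (tsupport K ×ˢ tsupport f)) ((K.hasCompactSupport.isCompact.prod
      f.hasCompactSupport.isCompact).image (by fun_prop)) ?_
  rintro ⟨h, g⟩ hp
  change actB g (K h) * f (g * h) = 0
  by_cases hk : h ∈ tsupport K
  · have : g * h ∉ tsupport f := fun hv => hp ⟨(h, g * h), ⟨hk, hv⟩, by simp⟩
    rw [cc_apply_eq_zero f this, mul_zero]
  · rw [cc_apply_eq_zero K hk, map_zero, zero_mul]

/-- Substituting `g h` for `h` writes `ρ_K` in integrated form `∫ ρ_{K(h)} ρ_h dh`. Its norm can
then be estimated under the integral. -/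
theorem toL2_rhoCc (K f : C_c(G, B)) : toL2 μ (rhoCc μ K f) =
    ∫ h, (rhoB μ (K h)).1 ((rhoG μ h : AdjAlg B (L2 μ B)).1 (toL2 μ f)) ∂μ := by
  simp only [rhoG_toL2, rhoB_toL2]
  refine toL2_integral μ (v := fun h => ccRhoB (K h) (ccRhoG h f))
    (continuous_ccRhoB_ccRhoG K f) (hasCompactSupport_ccRhoB_ccRhoG K f) fun g => ?_
  rw [rhoCc_apply, ← integral_mul_left_eq_self _ g]
  refine integral_congr_ae (Eventually.of_forall fun h => ?_)
  change actB g (K (g⁻¹ * (g * h))) * f (g * h) = actB g (K h) * f (g * h)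
  rw [inv_mul_cancel_left]

theorem norm_rhoB_le (b : B) : ‖(rhoB μ b).1‖ ≤ ‖b‖ :=
  ContinuousLinearMap.opNorm_le_bound _ (norm_nonneg b) fun x => by
    induction x using (denseRange_toL2 μ).induction_on with
    | hp => exact isClosed_le ((rhoB μ b).1.continuous.norm) (continuous_const.mul continuous_norm)
    | ih f => rw [rhoB_toL2]; exact norm_ccRhoB_le μ b f

/-- The constant is the supremum of `‖ρ_h‖` over `S` times the measure of `S`, while `‖ρ_b‖ ≤ ‖b‖`.
So `ρ_K` is a bounded operator and depends continuously on `K` in the inductive limit sense. -/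
theorem exists_norm_rhoCc_le {S : Set G} (hS : IsCompact S) : ∃ C : ℝ, 0 ≤ C ∧
    ∀ (K : C_c(G, B)) (M : ℝ), (∀ g ∉ S, K g = 0) → (∀ g, ‖K g‖ ≤ M) → ∀ f : C_c(G, B),
      ‖toL2 μ (rhoCc μ K f)‖ ≤ C * M * ‖toL2 μ f‖ := by
  obtain ⟨C, hC, h⟩ := exists_norm_rhoG_le (B := B) μ hS
  refine ⟨C * μ.real S, by positivity, fun K M h0 hM f => ?_⟩
  have hM0 : 0 ≤ M := (norm_nonneg _).trans (hM 1)
  rw [toL2_rhoCc, show C * μ.real S * M * ‖toL2 μ f‖ = M * (C * ‖toL2 μ f‖) * μ.real S by ring]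
  refine norm_integral_le_of_support μ hS (fun g hg => ?_) fun g => ?_
  · rw [h0 g hg, ← zero_smul ℂ (0 : B), rhoB_smul, zero_smul]; rfl
  · by_cases hg : g ∈ S
    · refine ((rhoB μ (K g)).1.le_of_opNorm_le ((norm_rhoB_le μ _).trans (hM g)) _).trans ?_
      gcongr
      exact (rhoG μ g : AdjAlg B (L2 μ B)).1.le_of_opNorm_le (h g hg) _
    · rw [h0 g hg, ← zero_smul ℂ (0 : B), rhoB_smul, zero_smul]
      change ‖(0 : L2 μ B)‖ ≤ _
      rw [norm_zero]
      positivity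

/-- The map `f ↦ ρ_K f` as a linear map. -/
def rhoCcₗ (K : C_c(G, B)) : C_c(G, B) →ₗ[ℂ] C_c(G, B) where
  toFun := rhoCc μ K
  map_add' f f' := cc_ext fun g => by
    have hi : ∀ f : C_c(G, B), Integrable (fun h => actB g (K (g⁻¹ * h)) * f h) μ := fun f =>
      cc_integrable μ (ccMk (fun h => actB g (K (g⁻¹ * h)) * f h)
        ((continuous_const.actB (K.continuous.comp (continuous_const.mul continuous_id))).mul
          f.continuous) (hasCompactSupport_of_left f _ fun h h0 => by rw [h0, mul_zero]))
    refine Eq.trans ?_ (integral_add (hi f) (hi f'))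
    exact integral_congr_ae (Eventually.of_forall fun h => mul_add _ (f h) (f' h))
  map_smul' c f := cc_ext fun g => by
    refine Eq.trans ?_ (integral_smul c _)
    exact integral_congr_ae (Eventually.of_forall fun h => mul_smul_comm c _ (f h))

theorem exists_norm_rhoCcₗ_le (K : C_c(G, B)) :
    ∃ C : ℝ, ∀ f : C_c(G, B), ‖toL2 μ (rhoCcₗ μ K f)‖ ≤ C * ‖toL2 μ f‖ := by
  obtain ⟨C, -, h⟩ := exists_norm_rhoCc_le (B := B) μ K.hasCompactSupport
  obtain ⟨M, hM⟩ := K.continuous.bounded_above_of_compact_support K.hasCompactSupport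
  exact ⟨C * M, h K M (fun g hg => cc_apply_eq_zero K hg) hM⟩

theorem exists_isLaurent (K : C_c(G, B)) : ∃ T : Cr μ B, IsLaurent μ K T.1.1 := by
  obtain ⟨c, hc⟩ := exists_norm_rhoCcₗ_le μ K
  obtain ⟨c', hc'⟩ := exists_norm_rhoCcₗ_le μ (ccAdj K)
  obtain ⟨T, hT⟩ := exists_adjAlg μ (rhoCcₗ μ K) (rhoCcₗ μ (ccAdj K)) c c' (ip_rhoCc μ K) hc hc'
  exact ⟨⟨T, subset_closure ⟨K, hT⟩⟩, hT⟩

theorem IsLaurent.eq {K : C_c(G, B)} {T S : Cr μ B} (hT : IsLaurent μ K T.1.1)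
    (hS : IsLaurent μ K S.1.1) : T = S :=
  Subtype.ext (AdjAlg.ext_toL2 μ fun f => by rw [hT, hS])

/-- The element `ρ_K` of the reduced crossed product. -/
def rhoK : C_c(G, B) →ₗ[ℂ] Cr μ B where
  toFun K := (exists_isLaurent μ K).choose
  map_add' K L := IsLaurent.eq μ (exists_isLaurent μ (K + L)).choose_spec
    ((exists_isLaurent μ K).choose_spec.add μ (exists_isLaurent μ L).choose_spec)
  map_smul' c K := IsLaurent.eq μ (exists_isLaurent μ (c • K)).choose_spec
    ((exists_isLaurent μ K).choose_spec.smul μ c)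

theorem isLaurent_rhoK (K : C_c(G, B)) : IsLaurent μ K (rhoK μ K).1.1 :=
  (exists_isLaurent μ K).choose_spec

theorem indBdd_rhoK : IndBdd (rhoK (B := B) μ) := fun S hS => by
  obtain ⟨C, hC, h⟩ := exists_norm_rhoCc_le (B := B) μ hS
  refine ⟨C, hC, fun K M h0 hM => ?_⟩
  have hM0 : 0 ≤ M := (norm_nonneg _).trans (hM 1)
  refine ContinuousLinearMap.opNorm_le_bound (rhoK μ K).1.1 (by positivity) fun x => ?_
  induction x using (denseRange_toL2 μ).induction_on with
  | hp => exact isClosed_le ((rhoK μ K).1.1.continuous.norm) (continuous_const.mul continuous_norm)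
  | ih f => rw [isLaurent_rhoK]; exact h K M h0 hM f

/-- The function `g ↦ β_h(K(h⁻¹ g))`. -/
def ccTrans (h : G) (K : C_c(G, B)) : C_c(G, B) :=
  ccMk (fun g => actB h (K (h⁻¹ * g)))
    (continuous_const.actB (K.continuous.comp (continuous_const_mul _)))
    (HasCompactSupport.intro (K.hasCompactSupport.isCompact.image (continuous_const_mul h))
      fun g hg => by
        have : h⁻¹ * g ∉ tsupport K := fun h' => hg ⟨h⁻¹ * g, h', by simp⟩
        rw [cc_apply_eq_zero K this, map_zero])

theorem crLeftG_rhoK (h : G) (K : C_c(G, B)) :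
    crLeftG μ h (rhoK μ K) = rhoK μ (ccTrans h K) := by
  refine IsLaurent.eq μ (K := ccTrans h K) (fun f => ?_) (isLaurent_rhoK μ _)
  change (rhoG μ h : AdjAlg B (L2 μ B)).1 ((rhoK μ K).1.1 (toL2 μ f)) = _
  rw [isLaurent_rhoK, rhoG_toL2]
  congr 1
  refine cc_ext fun g => ?_
  rw [ccRhoG_apply, rhoCc_apply, rhoCc_apply]
  refine integral_congr_ae (Eventually.of_forall fun s => ?_)
  change actB (g * h) (K ((g * h)⁻¹ * s)) * f s = actB g (actB h (K (h⁻¹ * (g⁻¹ * s)))) * f s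
  rw [actB_mul, mul_inv_rev, mul_assoc]

/-- For `h` in a compact neighbourhood `N` of `h₀` the translates of `K` are supported in `N ·
supp(K)`, so inductive boundedness of `K ↦ ρ_K` applies. -/
theorem continuousAt_rhoK_ccTrans (K : C_c(G, B)) (h₀ : G) :
    ContinuousAt (fun h => rhoK μ (ccTrans h K)) h₀ := by
  obtain ⟨N, hN, hh⟩ := exists_compact_mem_nhds h₀
  refine (indBdd_rhoK μ).continuousAt (v := fun h => ccTrans h K) ?_
    ((hN.prod K.hasCompactSupport.isCompact).image (continuous_fst.mul continuous_snd)) ?_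
  · exact continuous_fst.actB (K.continuous.comp (continuous_fst.inv.mul continuous_snd))
  · filter_upwards [hh] with h hhN g hg
    have : h⁻¹ * g ∉ tsupport K := fun h' => hg ⟨(h, h⁻¹ * g), ⟨hhN, h'⟩, by simp⟩
    change actB h (K (h⁻¹ * g)) = 0
    rw [cc_apply_eq_zero K this, map_zero]

theorem crLeftG_sub (h : G) (x y : Cr μ B) :
    crLeftG μ h x - crLeftG μ h y = crLeftG μ h (x - y) :=
  Subtype.ext (mul_sub (rhoG μ h) x.1 y.1).symm

theorem norm_crLeftG_le (h : G) (x : Cr μ B) :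
    ‖crLeftG μ h x‖ ≤ ‖(rhoG μ h : AdjAlg B (L2 μ B)).1‖ * ‖x‖ :=
  norm_mul_le (rhoG μ h) x.1

/-- The multipliers `ρ_h` depend strictly continuously on `h`. -/
theorem continuous_crLeftG (x : Cr μ B) : Continuous fun h => crLeftG μ h x := by
  refine continuous_iff_continuousAt.2 fun h₀ => ?_
  obtain ⟨N, hN, hh⟩ := exists_compact_mem_nhds h₀
  obtain ⟨C, hC, hCN⟩ := exists_norm_rhoG_le (B := B) μ hN
  -- Continuity at `h₀` is a closed condition on `x` because `‖ρ_h‖` is bounded on the neighbourhood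
  -- `N`. It remains to treat `x = ρ_K`, where `ρ_h` acts by translating `K`.
  refine Cr.induction μ (p := fun x => ContinuousAt (fun h => crLeftG μ h x) h₀) ?_
    (fun K T hT => ?_) x
  · refine isClosed_of_closure_subset fun x hx => ?_
    change ContinuousAt (fun h => crLeftG μ h x) h₀
    refine continuousAt_of_locally_uniform_approx_of_continuousAt fun u hu => ?_
    obtain ⟨ε, hε, hεu⟩ := Metric.mem_uniformity_dist.1 hu
    obtain ⟨y, hy, hxy⟩ := Metric.mem_closure_iff.1 hx (ε / (C + 1)) (by positivity)
    refine ⟨N, hh, fun h => crLeftG μ h y, hy, fun h hhN => hεu ?_⟩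
    rw [dist_eq_norm, crLeftG_sub]
    refine (norm_crLeftG_le μ h (x - y)).trans_lt ?_
    have h2 : ‖x - y‖ < ε / (C + 1) := by rwa [dist_eq_norm] at hxy
    calc _ ≤ C * (ε / (C + 1)) :=
          mul_le_mul (hCN h hhN) h2.le (norm_nonneg _) hC
      _ < ε := by
          rw [mul_div_assoc', div_lt_iff₀ (by positivity)]
          nlinarith
  · rw [IsLaurent.eq μ hT (isLaurent_rhoK μ K)]
    simp only [crLeftG_rhoK]
    exact continuousAt_rhoK_ccTrans μ K h₀

end Modular

/-! ### Hilbert modules over `C*_r(G, B)` realised by operators on `L²(G, B)`. -/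

section OperatorModules

variable {G : Type*} [Group G] [TopologicalSpace G] [IsTopologicalGroup G] [T2Space G]
  [MeasurableSpace G] [BorelSpace G] {μ : Measure G} [μ.IsHaarMeasure]
  {B H : Type*} [NonUnitalCStarAlgebra B] [GCStarAlgebra G B]
  [NormedAddCommGroup H] [NormedSpace ℂ H] [CompleteSpace H] [InnerModule B H]

variable (μ B) in
/-- The inclusion of the reduced crossed product into the operators on `L²(G, B)`. -/
def Cr.opL : Cr μ B →L[ℂ] (L2 μ B →L[ℂ] L2 μ B) :=
  LinearMap.mkContinuous
    { toFun := fun x => x.1.1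
      map_add' := fun _ _ => rfl
      map_smul' := fun _ _ => rfl } 1 fun x => by rw [one_mul]; exact le_rfl

theorem Cr.eq_of_ip {x y : Cr μ B} (h : ∀ f k, ip B f (x.1.1 k) = ip B f (y.1.1 k)) : x = y :=
  Subtype.ext (Subtype.ext (ContinuousLinearMap.ext fun k => eq_of_forall_ip B fun f => h f k))

/-- A linear map `Θ` from a module over the reduced crossed product to operators on `L²(G, B)` is
compatible with the inner products if `Θ(s)* Θ(t) = ⟨s, t⟩`. -/
def IsOpRep {V : Type*} [AddCommGroup V] [Module ℂ V] [SemiInnerModule (Cr μ B) V]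
    (Θ : V → L2 μ B →L[ℂ] H) : Prop :=
  ∀ s t f k, ip B (Θ s f) (Θ t k) = ip B f ((ip (Cr μ B) s t).1.1 k)

/-- This is the C*-identity `‖Θ t‖² = ‖⟨t, t⟩‖`. The operator `Θ t` is not known to be adjointable,
so the two inequalities are derived from the inner products alone. -/
theorem IsOpRep.norm_eq {V : Type*} [SeminormedAddCommGroup V] [NormedSpace ℂ V]
    [InnerModule (Cr μ B) V] {Θ : V → L2 μ B →L[ℂ] H} (h : IsOpRep Θ) (t : V) : ‖Θ t‖ = ‖t‖ := by
  set c : Cr μ B := ip (Cr μ B) t t with hc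
  have hct : ‖t‖ ^ 2 = ‖c.1.1‖ := norm_sq_ip (Cr μ B) t
  refine le_antisymm ?_ ?_
  · refine ContinuousLinearMap.opNorm_le_bound _ (norm_nonneg t) fun f => ?_
    refine abs_le_of_sq_le_sq' ?_ (by positivity) |>.2
    rw [norm_sq_ip B, h, mul_pow, hct]
    calc _ ≤ ‖f‖ * ‖c.1.1 f‖ := norm_ip_le _ _
      _ ≤ ‖f‖ * (‖c.1.1‖ * ‖f‖) := by gcongr; exact c.1.1.le_opNorm f
      _ = _ := by ring
  · refine abs_le_of_sq_le_sq' ?_ (norm_nonneg _) |>.2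
    rw [hct]
    refine ContinuousLinearMap.opNorm_le_bound _ (by positivity) fun f => ?_
    -- Here `⟨c f, c f⟩ = ⟨Θ t (c f), Θ t f⟩` replaces the use of an adjoint.
    have h1 : ‖c.1.1 f‖ * ‖c.1.1 f‖ ≤ ‖Θ t‖ ^ 2 * ‖f‖ * ‖c.1.1 f‖ := by
      rw [← pow_two, norm_sq_ip B, ← h]
      calc _ ≤ ‖Θ t (c.1.1 f)‖ * ‖Θ t f‖ := norm_ip_le _ _
        _ ≤ (‖Θ t‖ * ‖c.1.1 f‖) * (‖Θ t‖ * ‖f‖) := by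
          gcongr <;> exact (Θ t).le_opNorm _
        _ = _ := by ring
    rcases (norm_nonneg (c.1.1 f)).eq_or_lt with h0 | h0
    · rw [← h0]; positivity
    · exact le_of_mul_le_mul_right h1 h0

variable {D E F : Type*} [NonUnitalCStarAlgebra D]
  [NormedAddCommGroup E] [NormedSpace ℂ E] [InnerModule D E]
  [NormedAddCommGroup F] [NormedSpace ℂ F] [CompleteSpace F] [InnerModule (Cr μ B) F]
  (ψ : D →⋆ₙₐ[ℂ] AdjAlg (Cr μ B) F)

theorem isOpRep_lift (b : E →ₗ[ℂ] F →ₗ[ℂ] (L2 μ B →L[ℂ] H)) (hb : ∀ x y ξ η f k,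
    ip B (b x ξ f) (b y η k) =
      ip B f ((ip (Cr μ B) ξ ((ψ (ip D x y) : F →L[ℂ] F) η)).1.1 k))
    (t : PreTensor E ψ →ₗ[ℂ] (L2 μ B →L[ℂ] H)) (ht : ∀ x ξ, t (PreTensor.tmul ψ x ξ) = b x ξ) :
    IsOpRep t := by
  intro x y f k
  have h0 : (0 : Cr μ B).1.1 = 0 := rfl
  induction x using PreTensor.induction with
  | h0 =>
    rw [map_zero, ip_zero_left, h0, _root_.zero_apply, _root_.zero_apply, ip_zero_left,
      ip_zero_right]
  | h2 x x' hx hx' =>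
    rw [map_add, ip_add_left, _root_.add_apply, ip_add_left, hx, hx', ← ip_add_right]; rfl
  | h1 x ξ =>
    induction y using PreTensor.induction with
    | h0 =>
      rw [map_zero, ip_zero_right, h0, _root_.zero_apply, _root_.zero_apply, ip_zero_right,
        ip_zero_right]
    | h2 y y' hy hy' =>
      rw [map_add, ip_add_right, _root_.add_apply, ip_add_right, hy, hy', ← ip_add_right]; rfl
    | h1 y η => rw [ht, ht, hb, PreTensor.ip_tmul]

/-- A bilinear map to operators on `L²(G, B)` that is compatible with the inner products extends to
the interior tensor product. -/
theorem exists_isOpRep (b : E →ₗ[ℂ] F →ₗ[ℂ] (L2 μ B →L[ℂ] H)) (hb : ∀ x y ξ η f k,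
    ip B (b x ξ f) (b y η k) =
      ip B f ((ip (Cr μ B) ξ ((ψ (ip D x y) : F →L[ℂ] F) η)).1.1 k)) :
    ∃ Θ : InteriorTensor E ψ →L[ℂ] (L2 μ B →L[ℂ] H), IsOpRep Θ ∧
      ∀ x ξ, Θ (InteriorTensor.tmul ψ x ξ) = b x ξ := by
  let t : PreTensor E ψ →ₗ[ℂ] (L2 μ B →L[ℂ] H) := TensorProduct.lift b
  have ht : IsOpRep t := isOpRep_lift ψ b hb t fun x ξ => rfl
  obtain ⟨Θ, hΘ⟩ := exists_extension (PreTensor.toInterior E ψ)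
    (PreTensor.denseRange_toInterior ψ) t (c := 1) fun x => by
      rw [one_mul, PreTensor.norm_toInterior, ht.norm_eq]
  refine ⟨Θ, fun x y f k => ?_, fun x ξ => hΘ _⟩
  have hc : ∀ z : InteriorTensor E ψ → Cr μ B, Continuous z →
      Continuous fun x => ip B f ((z x).1.1 k) := fun z hz =>
    continuous_const.ip (((Cr.opL μ B).continuous.comp hz).clm_apply continuous_const)
  induction x using (PreTensor.denseRange_toInterior ψ).induction_on with
  | hp =>
    exact isClosed_eq ((Θ.continuous.clm_apply continuous_const).ip continuous_const)
      (hc _ (continuous_id.ip continuous_const))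
  | ih x =>
    induction y using (PreTensor.denseRange_toInterior ψ).induction_on with
    | hp =>
      exact isClosed_eq (continuous_const.ip (Θ.continuous.clm_apply continuous_const))
        (hc _ (continuous_const.ip continuous_id))
    | ih y => rw [hΘ, hΘ, ht, PreTensor.ip_toInterior]

end OperatorModules

/-! ### `C*_r(G, E₂)` as a space of operators. -/

section Theta

variable {G : Type*} [Group G] [TopologicalSpace G] [IsTopologicalGroup G] [T2Space G]
  [LocallyCompactSpace G] [MeasurableSpace G] [BorelSpace G]
  (μ : Measure G) [μ.IsHaarMeasure] [μ.Regular]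
  (B E₂ : Type*) [NonUnitalCStarAlgebra B] [GCStarAlgebra G B]
  [NormedAddCommGroup E₂] [NormedSpace ℂ E₂] [CompleteSpace E₂] [InnerModule B E₂]
  [GInnerModule G B E₂]

/-- Compatibility with inner products is `(|η⟩ x)* (|η'⟩ x') = x* ρ_b x'` with `b = ⟨η, η'⟩`, and
the right side is the inner product of `η ⊗ x` and `η' ⊗ x'`. -/
theorem exists_thetaL : ∃ Θ : CrMod μ B E₂ →L[ℂ] (L2 μ B →L[ℂ] L2E μ B E₂), IsOpRep Θ ∧
    ∀ η x, Θ (InteriorTensor.tmul (crLeftB μ B) η x) = (ketL μ B η).comp x.1.1 := by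
  obtain ⟨Θ, h1, h2⟩ := exists_isOpRep (E := E₂) (F := Cr μ B) (H := L2E μ B E₂) (crLeftB μ B)
    (LinearMap.mk₂ ℂ (fun η x => (ketL μ B η).comp (Cr.opL μ B x))
      (fun η η' x => by rw [ketL_add, ContinuousLinearMap.add_comp])
      (fun c η x => by rw [ketL_smul, ContinuousLinearMap.smul_comp])
      (fun η x x' => by rw [map_add, ContinuousLinearMap.comp_add])
      (fun c η x => by rw [map_smul, ContinuousLinearMap.comp_smul])) fun η η' x x' f k => by
        change ip B (ketL μ B η (x.1.1 f)) (ketL μ B η' (x'.1.1 k)) =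
          ip B f (((star x.1 * (rhoB μ (ip B η η') * x'.1)).1 : L2 μ B →L[ℂ] L2 μ B) k)
        rw [ip_ketL]
        exact x.1.isAdjointPair f _
  exact ⟨Θ, h1, h2⟩

/-- The map from `C*_r(G, E₂)` to the operators `L²(G, B) → L²(G, E₂)`, `η ⊗ x ↦ |η⟩ x`. -/
def thetaL : CrMod μ B E₂ →L[ℂ] (L2 μ B →L[ℂ] L2E μ B E₂) := (exists_thetaL μ B E₂).choose

variable {B E₂}

theorem isOpRep_thetaL : IsOpRep (thetaL μ B E₂) := (exists_thetaL μ B E₂).choose_spec.1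

theorem thetaL_tmul (η : E₂) (x : Cr μ B) :
    thetaL μ B E₂ (InteriorTensor.tmul (crLeftB μ B) η x) = (ketL μ B η).comp x.1.1 :=
  (exists_thetaL μ B E₂).choose_spec.2 η x

theorem norm_thetaL (t : CrMod μ B E₂) : ‖thetaL μ B E₂ t‖ = ‖t‖ := (isOpRep_thetaL μ).norm_eq t

theorem thetaL_injective : Function.Injective (thetaL μ B E₂) :=
  (AddMonoidHomClass.isometry_of_norm _ (norm_thetaL μ)).injective

theorem isClosed_range_thetaL :
    IsClosed (LinearMap.range (thetaL μ B E₂).toLinearMap : Set (L2 μ B →L[ℂ] L2E μ B E₂)) :=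
  (AddMonoidHomClass.isometry_of_norm _ (norm_thetaL μ)).isClosedEmbedding.isClosed_range

end Theta

/-! ### The integrals `∫ k(h) ⊗ ρ_h x dh`. -/

section TwistedIntegral

variable {G : Type*} [Group G] [TopologicalSpace G] [IsTopologicalGroup G] [T2Space G]
  [LocallyCompactSpace G] [MeasurableSpace G] [BorelSpace G]
  (μ : Measure G) [μ.IsHaarMeasure] [μ.Regular]
  {B E₂ : Type*} [NonUnitalCStarAlgebra B] [GCStarAlgebra G B]
  [NormedAddCommGroup E₂] [NormedSpace ℂ E₂] [CompleteSpace E₂] [InnerModule B E₂]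
  [GInnerModule G B E₂]

/-- The function `h ↦ k(h) ⊗ ρ_h x`. -/
def ccTmulG (k : C_c(G, E₂)) (x : Cr μ B) : C_c(G, CrMod μ B E₂) :=
  ccMk (fun h => InteriorTensor.tmul (crLeftB μ B) (k h) (crLeftG μ h x))
    (by
      have h1 : Continuous fun h => k h := k.continuous
      exact Continuous.tmul (crLeftB μ B) h1 (continuous_crLeftG μ x))
    (HasCompactSupport.intro k.hasCompactSupport fun g hg => by
      rw [cc_apply_eq_zero k hg, ← InteriorTensor.tmulL_apply, map_zero, _root_.zero_apply])

theorem ccTmulG_apply (k : C_c(G, E₂)) (x : Cr μ B) (h : G) :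
    ccTmulG μ k x h = InteriorTensor.tmul (crLeftB μ B) (k h) (crLeftG μ h x) := rfl

theorem crLeftG_add (h : G) (x y : Cr μ B) :
    crLeftG μ h (x + y) = crLeftG μ h x + crLeftG μ h y :=
  Subtype.ext (mul_add (rhoG μ h) x.1 y.1)

theorem crLeftG_smul (h : G) (c : ℂ) (x : Cr μ B) :
    crLeftG μ h (c • x) = c • crLeftG μ h x :=
  Subtype.ext (mul_smul_comm c (rhoG μ h) x.1)

/-- Boundedness in `x` holds because `‖ρ_h‖` is bounded on the support of `k`. It allows identities
about these integrals to be checked for `x = ρ_L` only. -/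
theorem exists_twistInt (k : C_c(G, E₂)) : ∃ T : Cr μ B →L[ℂ] CrMod μ B E₂,
    ∀ x, T x = ∫ h, ccTmulG μ k x h ∂μ := by
  obtain ⟨C, hC, hCk⟩ := exists_norm_rhoG_le (B := B) μ k.hasCompactSupport.isCompact
  obtain ⟨M, hM⟩ := k.continuous.bounded_above_of_compact_support k.hasCompactSupport
  have hM0 : 0 ≤ M := (norm_nonneg _).trans (hM 1)
  refine ⟨LinearMap.mkContinuous
    { toFun := fun x => ∫ h, ccTmulG μ k x h ∂μ
      map_add' := fun x y => ?_
      map_smul' := fun c x => ?_ } (M * C * μ.real (tsupport k)) fun x => ?_, fun x => rfl⟩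
  · rw [← integral_add (cc_integrable μ _) (cc_integrable μ _)]
    refine integral_congr_ae (Eventually.of_forall fun h => ?_)
    simp only [ccTmulG_apply, crLeftG_add, ← InteriorTensor.tmulL_apply, map_add]
  · rw [RingHom.id_apply, ← integral_smul]
    refine integral_congr_ae (Eventually.of_forall fun h => ?_)
    simp only [ccTmulG_apply, crLeftG_smul, ← InteriorTensor.tmulL_apply, map_smul]
  · change ‖∫ h, ccTmulG μ k x h ∂μ‖ ≤ _
    rw [show M * C * μ.real (tsupport k) * ‖x‖ = M * (C * ‖x‖) * μ.real (tsupport k) by ring]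
    refine norm_integral_le_of_support μ k.hasCompactSupport.isCompact (fun h hh => ?_) fun h => ?_
    · rw [ccTmulG_apply, cc_apply_eq_zero k hh, ← InteriorTensor.tmulL_apply, map_zero,
        _root_.zero_apply]
    · by_cases hh : h ∈ tsupport k
      · refine (InteriorTensor.norm_tmul_le (crLeftB μ B) (k h) (crLeftG μ h x)).trans ?_
        refine mul_le_mul (hM h) ((norm_crLeftG_le μ h x).trans ?_) (norm_nonneg _) hM0
        exact mul_le_mul_of_nonneg_right (hCk h hh) (norm_nonneg x)
      · rw [ccTmulG_apply, cc_apply_eq_zero k hh, ← InteriorTensor.tmulL_apply, map_zero,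
          _root_.zero_apply, norm_zero]
        positivity

/-- The operator `x ↦ ∫ k(h) ⊗ ρ_h x dh` from `C*_r(G, B)` to `C*_r(G, E₂)`. -/
def twistInt (k : C_c(G, E₂)) : Cr μ B →L[ℂ] CrMod μ B E₂ := (exists_twistInt μ k).choose

theorem twistInt_apply (k : C_c(G, E₂)) (x : Cr μ B) :
    twistInt μ k x = ∫ h, ccTmulG μ k x h ∂μ := (exists_twistInt μ k).choose_spec x

theorem thetaL_twistInt (k : C_c(G, E₂)) (x : Cr μ B) (f : L2 μ B) :
    thetaL μ B E₂ (twistInt μ k x) f =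
      ∫ h, ketL μ B (k h) ((rhoG μ h : AdjAlg B (L2 μ B)).1 (x.1.1 f)) ∂μ := by
  rw [twistInt_apply]
  refine (((ContinuousLinearMap.apply ℂ (L2E μ B E₂) f).comp
    (thetaL μ B E₂)).integral_comp_comm (cc_integrable μ (ccTmulG μ k x))).symm.trans ?_
  refine integral_congr_ae (Eventually.of_forall fun h => ?_)
  change thetaL μ B E₂ (ccTmulG μ k x h) f = _
  rw [ccTmulG_apply, thetaL_tmul]
  rfl

end TwistedIntegral

/-! ### The induced homomorphism `Φ`. -/

section InducedHom

variable {G : Type*} [Group G] [TopologicalSpace G] [IsTopologicalGroup G] [T2Space G]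
  [LocallyCompactSpace G] [MeasurableSpace G] [BorelSpace G]
  (μ : Measure G) [μ.IsHaarMeasure] [μ.Regular]
  {A B E₂ : Type*} [NonUnitalCStarAlgebra A] [GCStarAlgebra G A]
  [NonUnitalCStarAlgebra B] [GCStarAlgebra G B]
  [NormedAddCommGroup E₂] [NormedSpace ℂ E₂] [CompleteSpace E₂] [InnerModule B E₂]
  [GInnerModule G B E₂]
  {φ : A →⋆ₙₐ[ℂ] AdjAlg B E₂} [IsEquivariant G φ] (hφ : IsEssential φ)

/-- Both sides are continuous in `x`, so `x = ρ_L` may be assumed. Then `x` maps `C_c(G, B)` to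
itself, and the formula for `(ρ_K ⊗ 1) |η⟩` on functions in `C_c(G, B)` applies. -/
theorem thetaL_twistInt_eq {K : C_c(G, A)} {T : Cr μ A} (hK : IsLaurent μ K T.1.1) (η : E₂)
    (x : Cr μ B) : thetaL μ B E₂ (twistInt μ (ccTwist (B := B) φ K η) x) =
      (hatL μ hφ T.1.1).comp ((ketL μ B η).comp x.1.1) := by
  refine Cr.induction μ (p := fun x => thetaL μ B E₂ (twistInt μ (ccTwist (B := B) φ K η) x) =
      (hatL μ hφ T.1.1).comp ((ketL μ B η).comp x.1.1)) ?_ (fun L x hx => ?_) x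
  · exact isClosed_eq ((thetaL μ B E₂).continuous.comp (twistInt μ _).continuous)
      (continuous_const.clm_comp (continuous_const.clm_comp (Cr.opL μ B).continuous))
  · refine L2.ext_toL2 μ fun v => ?_
    rw [thetaL_twistInt, ContinuousLinearMap.comp_apply, ContinuousLinearMap.comp_apply, hx,
      hatL_ketL_toL2 μ hφ hK T.1.2]

/-- The range of `thetaL` is invariant under all `T ⊗ 1`. As it is a closed subspace, the case `T =
ρ_K` and `t = η ⊗ x` suffices, where the preimage is an explicit integral. -/
theorem exists_thetaL_eq (T : Cr μ A) (t : CrMod μ B E₂) :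
    ∃ s, thetaL μ B E₂ s = (hatCr μ hφ T).comp (thetaL μ B E₂ t) := by
  refine Cr.induction μ (p := fun T => (hatCr μ hφ T).comp (thetaL μ B E₂ t) ∈
    LinearMap.range (thetaL μ B E₂).toLinearMap) ?_ (fun K T hK => ?_) T
  · exact (isClosed_range_thetaL μ).preimage
      ((hatCr μ hφ).continuous.clm_comp continuous_const)
  · refine InteriorTensor.induction (crLeftB μ B) (p := fun t =>
      (hatCr μ hφ T).comp (thetaL μ B E₂ t) ∈ LinearMap.range (thetaL μ B E₂).toLinearMap)
      ?_ (fun η x => ?_) (fun s t hs ht => ?_) t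
    · exact (isClosed_range_thetaL μ).preimage
        (continuous_const.clm_comp (thetaL μ B E₂).continuous)
    · rw [thetaL_tmul]
      exact ⟨_, thetaL_twistInt_eq μ hφ hK η x⟩
    · rw [map_add, ContinuousLinearMap.comp_add]
      exact Submodule.add_mem _ hs ht

theorem exists_inducedOp (T : Cr μ A) : ∃ S : CrMod μ B E₂ →L[ℂ] CrMod μ B E₂,
    ∀ t, thetaL μ B E₂ (S t) = (hatCr μ hφ T).comp (thetaL μ B E₂ t) := by
  choose S hS using exists_thetaL_eq (B := B) μ hφ T
  refine ⟨LinearMap.mkContinuous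
    { toFun := S
      map_add' := fun s t => thetaL_injective μ ?_
      map_smul' := fun c t => thetaL_injective μ ?_ } ‖hatCr (B := B) μ hφ T‖ fun t => ?_, hS⟩
  · rw [map_add, hS, hS, hS, map_add, ContinuousLinearMap.comp_add]
  · rw [map_smul, hS, hS, map_smul, ContinuousLinearMap.comp_smul, RingHom.id_apply]
  · rw [← norm_thetaL, ← norm_thetaL μ t]
    change ‖thetaL μ B E₂ (S t)‖ ≤ _
    rw [hS]
    exact ContinuousLinearMap.opNorm_comp_le _ _

/-- The operator on `C*_r(G, E₂)` induced by `T` in `C*_r(G, A)`. -/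
def inducedOp (T : Cr μ A) : CrMod μ B E₂ →L[ℂ] CrMod μ B E₂ := (exists_inducedOp μ hφ T).choose

theorem thetaL_inducedOp (T : Cr μ A) (t : CrMod μ B E₂) :
    thetaL μ B E₂ (inducedOp μ hφ T t) = (hatL μ hφ T.1.1).comp (thetaL μ B E₂ t) :=
  (exists_inducedOp μ hφ T).choose_spec t

/-- Under the embedding `thetaL`, this is adjointness of `T ⊗ 1` and `T* ⊗ 1` on `L²(G, E₂)`, since
elements of `C*_r(G, B)` are determined by their matrix coefficients. -/
theorem isAdjointPair_inducedOp (T : Cr μ A) :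
    IsAdjointPair (Cr μ B) (inducedOp (B := B) μ hφ T) (inducedOp μ hφ (star T)) := fun s t =>
  Cr.eq_of_ip fun f k => by
    rw [← isOpRep_thetaL, ← isOpRep_thetaL, thetaL_inducedOp, thetaL_inducedOp]
    exact isAdjointPair_hatL μ hφ T.1.isAdjointPair _ _

theorem inducedOp_add (T S : Cr μ A) (t : CrMod μ B E₂) :
    inducedOp μ hφ (T + S) t = inducedOp μ hφ T t + inducedOp μ hφ S t :=
  thetaL_injective μ <| by
    rw [map_add, thetaL_inducedOp, thetaL_inducedOp, thetaL_inducedOp,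
      ← ContinuousLinearMap.add_comp, ← hatL_add μ hφ T.1.2 S.1.2]
    rfl

theorem inducedOp_smul (c : ℂ) (T : Cr μ A) (t : CrMod μ B E₂) :
    inducedOp μ hφ (c • T) t = c • inducedOp μ hφ T t :=
  thetaL_injective μ <| by
    rw [map_smul, thetaL_inducedOp, thetaL_inducedOp, ← ContinuousLinearMap.smul_comp,
      ← hatL_smul μ hφ c T.1.2]
    rfl

theorem inducedOp_mul (T S : Cr μ A) (t : CrMod μ B E₂) :
    inducedOp μ hφ (T * S) t = inducedOp μ hφ T (inducedOp μ hφ S t) :=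
  thetaL_injective μ <| by
    rw [thetaL_inducedOp, thetaL_inducedOp, thetaL_inducedOp, ← ContinuousLinearMap.comp_assoc,
      ← hatL_comp μ hφ S.1.2 T.1.2]
    rfl

/-- The *-homomorphism from `C*_r(G, A)` to the adjointable operators on `C*_r(G, E₂)` induced by
`φ`. -/
def inducedHom : Cr μ A →⋆ₙₐ[ℂ] AdjAlg (Cr μ B) (CrMod μ B E₂) where
  toFun T := ⟨inducedOp μ hφ T, _, isAdjointPair_inducedOp μ hφ T⟩
  map_smul' c T := Subtype.ext (ContinuousLinearMap.ext fun t => inducedOp_smul μ hφ c T t)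
  map_zero' := Subtype.ext (ContinuousLinearMap.ext fun t => by
    have := inducedOp_smul μ hφ 0 (0 : Cr μ A) t
    rw [zero_smul, zero_smul] at this
    exact this)
  map_add' T S := Subtype.ext (ContinuousLinearMap.ext fun t => inducedOp_add μ hφ T S t)
  map_mul' T S := Subtype.ext (ContinuousLinearMap.ext fun t => inducedOp_mul μ hφ T S t)
  map_star' T := (AdjAlg.star_eq (T := ⟨inducedOp μ hφ T, _, isAdjointPair_inducedOp μ hφ T⟩)
    (S := ⟨inducedOp μ hφ (star T), _, isAdjointPair_inducedOp μ hφ (star T)⟩)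
    (isAdjointPair_inducedOp μ hφ T)).symm

theorem inducedHom_apply (T : Cr μ A) (t : CrMod μ B E₂) :
    (inducedHom μ hφ T : CrMod μ B E₂ →L[ℂ] CrMod μ B E₂) t = inducedOp μ hφ T t := rfl

theorem isInduced_inducedHom : IsInduced μ φ (inducedHom (B := B) μ hφ) := by
  intro K T hK η x
  rw [inducedHom_apply]
  refine thetaL_injective μ ?_
  rw [thetaL_inducedOp, thetaL_tmul, ← thetaL_twistInt_eq μ hφ hK, twistInt_apply]
  rfl

end InducedHom

/-! ### Approximate units acting on operators. -/

section ApproximateUnit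

variable {G : Type*} [Group G] [TopologicalSpace G] [IsTopologicalGroup G] [T2Space G]
  [MeasurableSpace G] [BorelSpace G] {μ : Measure G} [μ.IsHaarMeasure]
  {B H : Type*} [NonUnitalCStarAlgebra B] [GCStarAlgebra G B]
  [NormedAddCommGroup H] [NormedSpace ℂ H] [CompleteSpace H] [InnerModule B H]

/-- With `c = T* T` one has `(T - T u)* (T - T u) = (c - c u) - u* (c - c u)`, an expression within
the reduced crossed product. -/
theorem norm_sub_comp_sq_le {T : L2 μ B →L[ℂ] H} (hT : IsAdjointable B T) {c : Cr μ B}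
    (hc : c.1.1 = (adj B T).comp T) (u : Cr μ B) :
    ‖T - T.comp u.1.1‖ * ‖T - T.comp u.1.1‖ ≤ (1 + ‖u‖) * ‖c - c * u‖ := by
  have h1 := hT.isAdjointPair
  have h2 := h1.sub (u.1.isAdjointPair.comp h1)
  refine h2.norm_sq_le.trans ?_
  have h3 : (adj B T - (star u).1.1.comp (adj B T)).comp (T - T.comp u.1.1) =
      ((c - c * u) - star u * (c - c * u)).1.1 := by
    refine ContinuousLinearMap.ext fun f => ?_
    have hcf : ∀ f, c.1.1 f = adj B T (T f) := fun f => by rw [hc]; rfl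
    change adj B T (T f - T (u.1.1 f)) - (star u).1.1 (adj B T (T f - T (u.1.1 f))) =
      (c.1.1 f - c.1.1 (u.1.1 f)) - (star u).1.1 (c.1.1 f - c.1.1 (u.1.1 f))
    rw [hcf, hcf, map_sub]
  have h4 : ‖(adj B T - (star u).1.1.comp (adj B T)).comp (T - T.comp u.1.1)‖ ≤
      (1 + ‖u‖) * ‖c - c * u‖ := by
    rw [h3]
    change ‖(c - c * u) - star u * (c - c * u)‖ ≤ _
    refine (norm_sub_le _ _).trans ?_
    rw [add_mul, one_mul, ← norm_star u]
    gcongr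
    exact norm_mul_le _ _
  exact h4

/-- If `T* T` belongs to the reduced crossed product, then `T` is a limit of operators `T u` with
`u` in the reduced crossed product. -/
theorem mem_of_comp_mem {T : L2 μ B →L[ℂ] H} (hT : IsAdjointable B T)
    (hc : (adj B T).comp T ∈ crOps μ B) {S : Set (L2 μ B →L[ℂ] H)} (hS : IsClosed S)
    (h : ∀ u : Cr μ B, T.comp u.1.1 ∈ S) : T ∈ S := by
  let _ := CStarAlgebra.spectralOrder (Cr μ B)
  have _ := CStarAlgebra.spectralOrderedRing (Cr μ B)
  obtain ⟨c, hc⟩ := hc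
  have hl := CStarAlgebra.increasingApproximateUnit (Cr μ B)
  have _ := hl.neBot
  -- The factor `2` bounds `1 + ‖u‖`, since the approximate unit is eventually in the unit ball.
  have h1 : Tendsto (fun u : Cr μ B => 2 * ‖c - c * u‖) (CStarAlgebra.approximateUnit (Cr μ B))
      (𝓝 0) := by
    have := ((tendsto_const_nhds (x := c)).sub (hl.tendsto_mul_left c)).norm.const_mul 2
    simpa using this
  have h2 : Tendsto (fun u : Cr μ B => T.comp u.1.1) (CStarAlgebra.approximateUnit (Cr μ B))
      (𝓝 T) := by
    refine Metric.tendsto_nhds.2 fun ε hε => ?_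
    filter_upwards [h1.eventually_lt_const (show 0 < ε * ε by positivity), hl.eventually_norm]
      with u hu hu1
    rw [dist_comm, dist_eq_norm]
    refine lt_of_mul_self_lt_mul_self₀ hε.le ((norm_sub_comp_sq_le hT hc u).trans_lt ?_)
    refine lt_of_le_of_lt ?_ hu
    gcongr
    linarith
  exact hS.mem_of_tendsto h2 (Eventually.of_forall h)

end ApproximateUnit

/-! ### The isomorphism `F(E₁₂, R₁₂) ≅ F(E₁, R₁) ⊗ C*_r(G, E₂)`. -/

section TensorIso

variable {G : Type*} [Group G] [TopologicalSpace G] [IsTopologicalGroup G] [T2Space G]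
  [LocallyCompactSpace G] [MeasurableSpace G] [BorelSpace G]
  (μ : Measure G) [μ.IsHaarMeasure] [μ.Regular]
  {A B E₁ E₂ : Type*} [NonUnitalCStarAlgebra A] [GCStarAlgebra G A]
  [NonUnitalCStarAlgebra B] [GCStarAlgebra G B]
  [NormedAddCommGroup E₁] [NormedSpace ℂ E₁] [CompleteSpace E₁] [InnerModule A E₁]
  [GInnerModule G A E₁]
  [NormedAddCommGroup E₂] [NormedSpace ℂ E₂] [CompleteSpace E₂] [InnerModule B E₂]
  [GInnerModule G B E₂]

theorem FMod.mem_of_closed {R : Set E₁} (hR : RelCont μ A R) {N : Submodule ℂ (FMod μ hR)}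
    (hN : IsClosed (N : Set (FMod μ hR))) (h : ∀ T : FMod μ hR, T.1 ∈ ketSet μ A R → T ∈ N)
    (T : FMod μ hR) : T ∈ N := by
  have hc : IsClosed (ketSpan μ A R : Set (L2 μ A →L[ℂ] E₁)) :=
    Submodule.isClosed_topologicalClosure _
  obtain ⟨S, hS, hST⟩ := mem_of_mem_ketSpan μ (R := R)
    (S := Submodule.map (ketSpan μ A R).subtype N)
    (hc.isClosedEmbedding_subtypeVal.isClosedMap _ hN)
    (fun S hS => ⟨⟨S, subset_ketSpan μ R hS⟩, h _ hS, rfl⟩) T.2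
  have : S = T := Subtype.ext hST
  rwa [← this]

variable {φ : A →⋆ₙₐ[ℂ] AdjAlg B E₂} [IsEquivariant G φ] (hφ : IsEssential φ)

section

variable {R : Set E₁} (hR : RelCont μ A R)

/-- By `ip_liftL`, the inner product of `(T ⊗ 1) θ(n)` and `(T' ⊗ 1) θ(n')` involves `T* T' ⊗ 1`
applied to `θ(n')`, where `θ` is `thetaL`. By construction this is `θ(Φ(⟨T, T'⟩) n')`, which gives
the inner product of the tensor product along `Φ`. -/
theorem exists_tensorOp : ∃ Ξ : InteriorTensor (FMod μ hR) (inducedHom (B := B) μ hφ) →L[ℂ]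
      (L2 μ B →L[ℂ] InteriorTensor E₁ φ), IsOpRep Ξ ∧
    ∀ T n, Ξ (InteriorTensor.tmul (inducedHom μ hφ) T n) =
      (liftL μ hφ T.1).comp (thetaL μ B E₂ n) := by
  have ha : ∀ T : FMod μ hR, IsAdjointable A T.1 := fun T => isAdjointable_of_mem_ketSpan μ T.2
  obtain ⟨Ξ, h1, h2⟩ := exists_isOpRep (E := FMod μ hR) (F := CrMod μ B E₂)
    (H := InteriorTensor E₁ φ) (inducedHom (B := B) μ hφ)
    (LinearMap.mk₂ ℂ (fun T n => (liftL μ hφ T.1).comp (thetaL μ B E₂ n))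
      (fun T T' n => by
        rw [← ContinuousLinearMap.add_comp, ← liftL_add μ hφ (ha T) (ha T')]; rfl)
      (fun c T n => by
        rw [← ContinuousLinearMap.smul_comp, ← liftL_smul μ hφ c (ha T)]; rfl)
      (fun T n n' => by rw [map_add, ContinuousLinearMap.comp_add])
      (fun c T n => by rw [map_smul, ContinuousLinearMap.comp_smul])) fun T T' n n' f k => by
        change ip B (liftL μ hφ T.1 (thetaL μ B E₂ n f)) (liftL μ hφ T'.1 (thetaL μ B E₂ n' k)) =
          ip B f ((ip (Cr μ B) n (inducedOp μ hφ (ip (Cr μ A) T T') n')).1.1 k)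
        rw [ip_liftL μ hφ (ha T) (ha T'), ← isOpRep_thetaL, thetaL_inducedOp]
        rfl
  exact ⟨Ξ, h1, h2⟩

/-- The map from `F(E₁, R) ⊗ C*_r(G, E₂)` to the operators `L²(G, B) → E₁ ⊗_A E₂`. -/
def tensorOp : InteriorTensor (FMod μ hR) (inducedHom (B := B) μ hφ) →L[ℂ]
    (L2 μ B →L[ℂ] InteriorTensor E₁ φ) := (exists_tensorOp μ hφ hR).choose

theorem isOpRep_tensorOp : IsOpRep (tensorOp (B := B) μ hφ hR) :=
  (exists_tensorOp μ hφ hR).choose_spec.1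

theorem tensorOp_tmul (T : FMod μ hR) (n : CrMod μ B E₂) :
    tensorOp μ hφ hR (InteriorTensor.tmul (inducedHom μ hφ) T n) =
      (liftL μ hφ T.1).comp (thetaL μ B E₂ n) :=
  (exists_tensorOp μ hφ hR).choose_spec.2 T n

theorem isometry_tensorOp : Isometry (tensorOp (B := B) μ hφ hR) :=
  AddMonoidHomClass.isometry_of_norm _ (isOpRep_tensorOp μ hφ hR).norm_eq

end

variable {R : Submodule ℂ E₁} (hR : RelCont μ A (R : Set E₁))

/-- For `n = η ⊗ x` the operator is `|ξ ⊗ η⟩⟩ x`, one of the generators; such `n` span a dense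
subspace. -/
theorem liftL_ket_comp_mem_ketSpan (hR : RelCont μ A (R : Set E₁)) {ξ : E₁} (hξ : ξ ∈ R) (n : CrMod μ B E₂) :
    (liftL μ hφ (ket μ A ξ)).comp (thetaL μ B E₂ n) ∈
      ketSpan μ B (tensorImage φ R : Set (InteriorTensor E₁ φ)) := by
  refine InteriorTensor.induction (crLeftB μ B)
    (p := fun n => (liftL μ hφ (ket μ A ξ)).comp (thetaL μ B E₂ n) ∈
      ketSpan μ B (tensorImage φ R : Set (InteriorTensor E₁ φ))) ?_ (fun η x => ?_)
    (fun s t hs ht => ?_) n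
  · exact (Submodule.isClosed_topologicalClosure _).preimage
      (continuous_const.clm_comp (thetaL μ B E₂).continuous)
  · refine subset_ketSpan μ _ (Or.inr ⟨_, tmul_mem_tensorImage φ hξ η, x, ?_⟩)
    rw [((hR.isKet_ket hξ).tmul hφ η).ket_eq, thetaL_tmul]
    rfl
  · rw [map_add, ContinuousLinearMap.comp_add]
    exact Submodule.add_mem _ hs ht

theorem tensorOp_mem_ketSpan (z : InteriorTensor (FMod μ hR) (inducedHom (B := B) μ hφ)) :
    tensorOp μ hφ hR z ∈ ketSpan μ B (tensorImage φ R : Set (InteriorTensor E₁ φ)) := by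
  have hc : IsClosed (ketSpan μ B (tensorImage φ R : Set (InteriorTensor E₁ φ)) :
      Set (L2 μ B →L[ℂ] InteriorTensor E₁ φ)) := Submodule.isClosed_topologicalClosure _
  refine InteriorTensor.induction (inducedHom (B := B) μ hφ)
    (p := fun z => tensorOp μ hφ hR z ∈
      ketSpan μ B (tensorImage φ R : Set (InteriorTensor E₁ φ))) ?_ (fun T n => ?_)
    (fun s t hs ht => ?_) z
  · exact hc.preimage (tensorOp μ hφ hR).continuous
  · let M : FMod μ hR →L[ℂ] (L2 μ B →L[ℂ] InteriorTensor E₁ φ) := (tensorOp μ hφ hR).comp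
      ((InteriorTensor.tmulL (FMod μ hR) (inducedHom (B := B) μ hφ)).flip n)
    refine FMod.mem_of_closed μ hR (N := (ketSpan μ B
      (tensorImage φ R : Set (InteriorTensor E₁ φ))).comap M.toLinearMap)
      (hc.preimage M.continuous) (fun T hT => ?_) T
    change tensorOp μ hφ hR (InteriorTensor.tmul (inducedHom μ hφ) T n) ∈
      ketSpan μ B (tensorImage φ R : Set (InteriorTensor E₁ φ))
    rw [tensorOp_tmul]
    rcases hT with ⟨ξ, hξ, hT⟩ | ⟨ξ, hξ, x, hT⟩
    · rw [hT]
      exact liftL_ket_comp_mem_ketSpan μ hφ hR hξ n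
    -- A generator `|ξ⟩⟩ x` is reduced to `|ξ⟩⟩` by moving `x` across the tensor sign: `(|ξ⟩⟩ x ⊗ 1)
    -- θ(n) = (|ξ⟩⟩ ⊗ 1) θ(Φ(x) n)`.
    · rw [hT, ← liftL_comp_hatL μ hφ x.1.2 (isAdjointable_ket μ ξ),
        ContinuousLinearMap.comp_assoc, ← thetaL_inducedOp]
      exact liftL_ket_comp_mem_ketSpan μ hφ hR hξ _
  · rw [map_add]
    exact Submodule.add_mem _ hs ht

theorem isClosed_range_tensorOp :
    IsClosed (LinearMap.range (tensorOp (B := B) μ hφ hR).toLinearMap :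
      Set (L2 μ B →L[ℂ] InteriorTensor E₁ φ)) :=
  (isometry_tensorOp μ hφ hR).isClosedEmbedding.isClosed_range

/-- The operator `(|ξ⟩⟩ ⊗ 1) |η⟩ x` is the image of `|ξ⟩⟩ ⊗ (η ⊗ x)`. The factor `x` is essential,
as `|η⟩` alone need not come from `C*_r(G, E₂)`. -/
theorem comp_mem_range_tensorOp {T : L2 μ B →L[ℂ] InteriorTensor E₁ φ}
    (hT : T ∈ Submodule.span ℂ (liftSet μ hφ R)) (x : Cr μ B) :
    T.comp x.1.1 ∈ LinearMap.range (tensorOp (B := B) μ hφ hR).toLinearMap := by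
  induction hT using Submodule.span_induction with
  | mem T h =>
    obtain ⟨ξ, hξ, η, rfl⟩ := h
    refine ⟨InteriorTensor.tmul (inducedHom μ hφ)
      ⟨ket μ A ξ, subset_ketSpan μ _ (Or.inl ⟨ξ, hξ, rfl⟩)⟩
      (InteriorTensor.tmul (crLeftB μ B) η x), ?_⟩
    refine (tensorOp_tmul μ hφ hR _ _).trans ?_
    rw [thetaL_tmul]
    rfl
  | zero => rw [ContinuousLinearMap.zero_comp]; exact Submodule.zero_mem _
  | add S T _ _ hS hT => rw [ContinuousLinearMap.add_comp]; exact Submodule.add_mem _ hS hT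
  | smul c T _ hT => rw [ContinuousLinearMap.smul_comp]; exact Submodule.smul_mem _ _ hT

theorem mem_range_tensorOp {T : L2 μ B →L[ℂ] InteriorTensor E₁ φ}
    (hT : T ∈ ketSpan μ B (tensorImage φ R : Set (InteriorTensor E₁ φ))) :
    T ∈ LinearMap.range (tensorOp (B := B) μ hφ hR).toLinearMap := by
  refine mem_of_mem_ketSpan μ (isClosed_range_tensorOp μ hφ hR) (fun T hT => ?_) hT
  rcases hT with ⟨t, ht, rfl⟩ | ⟨t, ht, x, rfl⟩
  · obtain ⟨S, hS, htS⟩ := exists_isKet_of_mem_tensorImage μ hφ hR ht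
    rw [htS.ket_eq]
    -- The bare operator `|t⟩⟩` has no factor from the crossed product. It is recovered as a limit
    -- of `|t⟩⟩ u`, using that `⟨⟨t|t⟩⟩` lies in `C*_r(G, B)` and that the range is closed.
    exact mem_of_comp_mem htS.1 (adj_comp_mem_crOps_of_span μ hφ hR hS hS)
      (isClosed_range_tensorOp μ hφ hR) (comp_mem_range_tensorOp μ hφ hR hS)
  · obtain ⟨S, hS, htS⟩ := exists_isKet_of_mem_tensorImage μ hφ hR ht
    rw [htS.ket_eq]
    exact comp_mem_range_tensorOp μ hφ hR hS x

/-- A linear bijection that preserves the inner products is an isomorphism of Hilbert modules. -/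
def HilbertModuleIso.ofIpMap {C E F : Type*} [NonUnitalCStarAlgebra C]
    [NormedAddCommGroup E] [NormedSpace ℂ E] [CompleteSpace E] [InnerModule C E]
    [NormedAddCommGroup F] [NormedSpace ℂ F] [CompleteSpace F] [InnerModule C F] (e : E ≃ₗ[ℂ] F)
    (h : ∀ x y, ip C (e x) (e y) = ip C x y) : HilbertModuleIso C E F :=
  { e with
    map_rs := map_rs_of_ip_map e.surjective h
    ip_map := h }

theorem nonempty_hilbertModuleIso
    (h₁₂ : RelCont μ B (tensorImage φ R : Set (InteriorTensor E₁ φ))) :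
    Nonempty (HilbertModuleIso (Cr μ B) (FMod μ h₁₂)
      (InteriorTensor (FMod μ hR) (inducedHom (B := B) μ hφ))) := by
  let F : InteriorTensor (FMod μ hR) (inducedHom (B := B) μ hφ) →ₗ[ℂ] FMod μ h₁₂ :=
    { toFun := fun z => ⟨tensorOp μ hφ hR z, tensorOp_mem_ketSpan μ hφ hR z⟩
      map_add' := fun s t => Subtype.ext (map_add _ s t)
      map_smul' := fun c t => Subtype.ext (map_smul _ c t) }
  have hF : Function.Bijective F := by
    refine ⟨fun s t hst => (isometry_tensorOp μ hφ hR).injective (congrArg Subtype.val hst),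
      fun T => ?_⟩
    obtain ⟨z, hz⟩ := mem_range_tensorOp μ hφ hR T.2
    exact ⟨z, Subtype.ext hz⟩
  have hip : ∀ s t, ip (Cr μ B) (F s) (F t) = ip (Cr μ B) s t := fun s t =>
    Cr.eq_of_ip fun f k => by
      rw [← isOpRep_tensorOp μ hφ hR]
      exact ((FMod.isAdjointPair μ h₁₂ (F s)) f _).symm
  -- The operator picture maps the tensor product to `F(E₁₂, R₁₂)`, so the inverse is taken.
  -- Compatibility with the right action follows from preservation of inner products and
  -- surjectivity.
  let e := (LinearEquiv.ofBijective F hF).symm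
  refine ⟨HilbertModuleIso.ofIpMap e fun x y => ?_⟩
  rw [← hip]
  exact congrArg₂ (ip (Cr μ B)) ((LinearEquiv.ofBijective F hF).apply_symm_apply x)
    ((LinearEquiv.ofBijective F hF).apply_symm_apply y)

end TensorIso

end

theorem mainTheorem8 {G A B E₁ E₂ : Type*}
    [Group G] [TopologicalSpace G] [IsTopologicalGroup G] [LocallyCompactSpace G] [T2Space G]
    [MeasurableSpace G] [BorelSpace G] (μ : Measure G) [μ.IsHaarMeasure] [μ.Regular]
    [NonUnitalCStarAlgebra A] [GCStarAlgebra G A]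
    [NonUnitalCStarAlgebra B] [GCStarAlgebra G B]
    [NormedAddCommGroup E₁] [NormedSpace ℂ E₁] [CompleteSpace E₁] [InnerModule A E₁]
    [GInnerModule G A E₁]
    [NormedAddCommGroup E₂] [NormedSpace ℂ E₂] [CompleteSpace E₂] [InnerModule B E₂]
    [GInnerModule G B E₂]
    (φ : A →⋆ₙₐ[ℂ] AdjAlg B E₂) [IsEquivariant G φ] (hφ : IsEssential φ)
    (R₁ : Submodule ℂ E₁) (h₁ : RelCont μ A (R₁ : Set E₁)) :
    (Dense (R₁ : Set E₁) → Dense (tensorImage φ R₁ : Set (InteriorTensor E₁ φ))) ∧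
      ∃ h₁₂ : RelCont μ B (tensorImage φ R₁ : Set (InteriorTensor E₁ φ)),
        ∃ Φ : Cr μ A →⋆ₙₐ[ℂ] AdjAlg (Cr μ B) (CrMod μ B E₂), IsInduced μ φ Φ ∧
          Nonempty (HilbertModuleIso (Cr μ B) (FMod μ h₁₂) (InteriorTensor (FMod μ h₁) Φ)) :=
  ⟨dense_tensorImage φ, relCont_tensorImage μ hφ h₁, inducedHom μ hφ, isInduced_inducedHom μ hφ,
    nonempty_hilbertModuleIso μ hφ h₁ _⟩
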